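/- **Syntax.** Types are $A,B ::= I \mid A+B \mid A\otimes B \mid A\multimap B \mid {!A}$; the non-linear types are $P,R ::= I \mid P+R \mid P\otimes R \mid {!A}$. Terms, up to renaming of bound variables, are $$m,n,p ::= x \mid * \mid m;n \mid \mathtt{left}_{A,B}\,m \mid \mathtt{right}_{A,B}\,m \mid \mathtt{case}\ m\ \mathtt{of}\ \{\mathtt{left}\ x\to n \mid \mathtt{right}\ y\to p\} \mid \langle m,n\rangle \mid \mathtt{let}\ \langle x,y\rangle = m\ \mathtt{in}\ n \mid \lambda x^A.m \mid mn \mid \mathtt{lift}\ m \mid \mathtt{force}\ m \mid \mathtt{rec}\ z^{!A}.m .$$ A context is a finite assignment of types to variables; $\Phi$ ranges over non-linear contexts (all types non-linear), $\Gamma,\Sigma$ over arbitrary contexts, and a comma denotes disjoint union. The calculi $\lambda_l$ and $\lambda_a$ share the following typing rules: * from $\Phi,\Gamma\vdash m:I$ and $\Phi,\Sigma\vdash n:A$ infer $\Phi,\Gamma,\Sigma\vdash m;n:A$; from $\Gamma\vdash m:{!A}$ infer $\Gamma\vdash\mathtt{force}\ m:A$; * from $\Gamma\vdash m:A$ infer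 $\Gamma\vdash\mathtt{left}_{A,B}m:A+B$; from $\Gamma\vdash m:B$ infer $\Gamma\vdash\mathtt{right}_{A,B}m:A+B$; * from $\Phi,\Gamma\vdash m:A+B$, $\Phi,\Sigma,x:A\vdash n:C$ and $\Phi,\Sigma,y:B\vdash p:C$ infer $\Phi,\Gamma,\Sigma\vdash \mathtt{case}\ m\ \mathtt{of}\ \{\mathtt{left}\ x\to n\mid\mathtt{right}\ y\to p\}:C$; * from $\Phi,\Gamma\vdash m:A$ and $\Phi,\Sigma\vdash n:B$ infer $\Phi,\Gamma,\Sigma\vdash\langle m,n\rangle:A\otimes B$; from $\Phi,\Gamma\vdash m:A\otimes B$ and $\Phi,\Sigma,x:A,y:B\vdash n:C$ infer $\Phi,\Gamma,\Sigma\vdash\mathtt{let}\ \langle x,y\rangle=m\ \mathtt{in}\ n:C$; * from $\Gamma,x:A\vdash m:B$ infer $\Gamma\vdash\lambda x^A.m:A\multimap B$; from $\Phi,\Gamma\vdash m:A\multimap B$ and $\Phi,\Sigma\vdash n:A$ infer $\Phi,\Gamma,\Sigma\vdash mn:B$; * from $\Phi,z:{!A}\vdash m:A$ infer $\Phi\vdash\mathtt{rec}\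 z^{!A}.m:A$. In addition, $\lambda_l$ has $\Phi,x:A\vdash x:A$, $\Phi\vdash *:I$, and from $\Phi\vdash m:A$ infer $\Phi\vdash\mathtt{lift}\ m:{!A}$; while $\lambda_a$ has $\Gamma,x:A\vdash x:A$, $\Gamma\vdash *:I$, from $\Phi\vdash m:A$ infer $\Phi,\Gamma\vdash\mathtt{lift}\ m:{!A}$, and from $\Phi,z:{!A}\vdash m:A$ infer $\Phi,\Gamma\vdash\mathtt{rec}\ z^{!A}.m:A$. **Evaluation.** $m\Downarrow v$ is the least relation with: $x\Downarrow x$, $*\Downarrow *$, $\lambda x.m\Downarrow\lambda x.m$, $\mathtt{lift}\ m\Downarrow\mathtt{lift}\ m$; $m;n\Downarrow v$ if $m\Downarrow *$ and $n\Downarrow v$; $\mathtt{left}\ m\Downarrow\mathtt{left}\ v$ and $\mathtt{right}\ m\Downarrow\mathtt{right}\ v$ if $m\Downarrow v$; the case term evaluates to $w$ if $m\Downarrow\mathtt{left}\ v$ and $n[v/x]\Downarrow w$, or $m\Downarrow\mathtt{right}\ v$ and $p[v/y]\Downarrow w$; $\langle m,n\rangle\Downarrow\langle v,w\rangle$ if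 $m\Downarrow v$ and $n\Downarrow w$; $\mathtt{let}\ \langle x,y\rangle=m\ \mathtt{in}\ n\Downarrow w$ if $m\Downarrow\langle v,v'\rangle$ and $n[v/x,v'/y]\Downarrow w$; $mn\Downarrow w$ if $m\Downarrow\lambda x.m'$, $n\Downarrow v$ and $m'[v/x]\Downarrow w$; $\mathtt{force}\ m\Downarrow v$ if $m\Downarrow\mathtt{lift}\ m'$ and $m'\Downarrow v$; $\mathtt{rec}\ z^{!A}.m\Downarrow v$ if $m[\mathtt{lift}\ \mathtt{rec}\ z^{!A}.m/z]\Downarrow v$. **Models.** A (compact) $\lambda_l$-model consists of a cartesian category $\mathbf B$ and symmetric monoidal categories $\mathbf V$, $\mathbf C$, all with finite coproducts; symmetric monoidal adjunctions $J\dashv K:\mathbf V\to\mathbf B$ and $L\dashv R:\mathbf C\to\mathbf V$ (with $J$, $L$ strong), where we put $F=LJ$, $G=KR$, ${!}=FG$ and let $\eta,\epsilon$ be the unit and counit of $F\dashv G$; for every $A\in\mathbf V$ an adjunction $L\circ(-\otimes A)\dashv(A\multimap-):\mathbf C\to\mathbf V$ (currying); and for every $X\in\mathbf B$ an initial algebra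 $\omega:FX\otimes{!\Omega_X}\to\Omega_X$ of the functor $FX\otimes{!(-)}$ such that $\omega^{-1}$ is a final coalgebra. A (compact) $\lambda_a$-model is a $\lambda_l$-model in which the tensor unit of $\mathbf V$ is terminal. **Interpretation.** Types are interpreted in $\mathbf C$ by $[\![I]\!]=I$, $[\![A+B]\!]=[\![A]\!]+[\![B]\!]$, $[\![A\otimes B]\!]=[\![A]\!]\otimes[\![B]\!]$, $[\![A\multimap B]\!]=L([\![A]\!]_V\multimap[\![B]\!])$, $[\![{!A}]\!]={!}[\![A]\!]$; in $\mathbf V$ in the same way, except that $[\![A\multimap B]\!]_V=[\![A]\!]_V\multimap[\![B]\!]$ and $[\![{!A}]\!]_V=JG[\![A]\!]$; and the non-linear types in $\mathbf B$ in the same way with $\times$ for $\otimes$ and $[\![{!A}]\!]_B=G[\![A]\!]$. Contexts are interpreted as tensor products (in $\mathbf B$, for non-linear contexts: products). There are canonical isomorphisms $[\![\Gamma]\!]\cong L[\![\Gamma]\!]_V$ and $[\![\Phi]\!]\cong F[\![\Phi]\!]_B$ and likewise for types; they and the structural isomorphisms (associativity, unit, symmetry, the strong monoidal structure of $J$, $L$,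 and preservation of coproducts) are left implicit below. On non-linear contexts, discarding $\diamond:[\![\Phi]\!]\to I$, copying $\triangle:[\![\Phi]\!]\to[\![\Phi]\!]\otimes[\![\Phi]\!]$ and promotion $\Box:[\![\Phi]\!]\to{!}[\![\Phi]\!]$ are the images under $F$ of the terminal map, the diagonal and $\eta$; in a $\lambda_a$-model, $\diamond:[\![\Gamma]\!]\to I$ is defined on every context as the image under $L$ of the unique map $[\![\Gamma]\!]_V\to I$. A derivation of $\Gamma\vdash m:A$ is interpreted as a morphism $[\![m]\!]:[\![\Gamma]\!]\to[\![A]\!]$ of $\mathbf C$ by induction. Each rule with conclusion context $\Phi,\Gamma,\Sigma$ first applies $\triangle$ to $[\![\Phi]\!]$ and rearranges, giving $[\![\Phi,\Gamma]\!]\otimes[\![\Phi,\Sigma]\!]$, after which $m;n$ and $\langle m,n\rangle$ are $[\![m]\!]\otimes[\![n]\!]$; $mn$ is $\mathrm{eval}\circ([\![m]\!]\otimes[\![n]\!])$ with $\mathrm{eval}$ the counit of currying; $\mathtt{let}$ applies $[\![m]\!]$ and then $[\![n]\!]$; and $\mathtt{case}$ applies $[\![m]\!]$, the distributivity isomorphism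 $[\![\Phi,\Sigma]\!]\otimes([\![A]\!]+[\![B]\!])\cong[\![\Phi,\Sigma]\!]\otimes[\![A]\!]+[\![\Phi,\Sigma]\!]\otimes[\![B]\!]$ and then $[[\![n]\!],[\![p]\!]]$. Variables and $*$ discard the rest of the context with $\diamond$; $\mathtt{left}$ and $\mathtt{right}$ are composition with the coproduct injections; $[\![\lambda x^A.m]\!]=L(\mathbf{curry}[\![m]\!])$; $[\![\mathtt{lift}\ m]\!]={!}[\![m]\!]\circ\Box$; $[\![\mathtt{force}\ m]\!]=\epsilon\circ[\![m]\!]$; and $[\![\mathtt{rec}\ z^{!A}.m]\!]=\sigma\circ\gamma$, where, for $X=[\![\Phi]\!]_B$, $\gamma:FX\to\Omega_X$ is the unique coalgebra morphism from $(\mathrm{id}\otimes\Box)\circ\triangle:FX\to FX\otimes{!FX}$, and $\sigma:\Omega_X\to[\![A]\!]$ is the unique algebra morphism to $[\![m]\!]:FX\otimes{!}[\![A]\!]\to[\![A]\!]$. In the rules of $\lambda_a$ for $\mathtt{lift}$ and $\mathtt{rec}$ with context $\Phi,\Gamma$, the part $\Gamma$ is first discarded with $\diamond$. **Theorem (Soundness).**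 In $\lambda_l$, suppose $\Gamma\vdash m:A$ and $m\Downarrow v$. Then $\Gamma\vdash v:A$, and in every $\lambda_l$-model $[\![m]\!]=[\![v]\!]$, for all derivations of $\Gamma\vdash m:A$ and of $\Gamma\vdash v:A$. Likewise in $\lambda_a$, suppose $\Gamma\vdash m:A$ and $m\Downarrow v$. Then $\Gamma\vdash v:A$, and in every $\lambda_a$-model $[\![m]\!]=[\![v]\!]$, for all derivations of $\Gamma\vdash m:A$ and of $\Gamma\vdash v:A$. -/

import Mathlib

open CategoryTheory CategoryTheory.Limits MonoidalCategory

universe v₁ v₂ v₃ u₁ u₂ u₃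

namespace SubLambda

/-! ## Types, terms, contexts -/

/-- Types `I | A + B | A ⊗ B | A ⊸ B | !A`. -/
inductive Ty : Type
  | unit : Ty
  | sum : Ty → Ty → Ty
  | tensor : Ty → Ty → Ty
  | lolli : Ty → Ty → Ty
  | bang : Ty → Ty

/-- The non-linear types `P, R ::= I | P + R | P ⊗ R | !A`. -/
def Ty.NonLinear : Ty → Prop
  | .unit => True
  | .sum P R => P.NonLinear ∧ R.NonLinear
  | .tensor P R => P.NonLinear ∧ R.NonLinear
  | .lolli _ _ => False
  | .bang _ => True

/-- Terms up to renaming of bound variables, with de Bruijn indices. In `case m n p` each of `n` and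
`p` binds index `0`; in `letPair m n` (that is `let ⟨x, y⟩ = m in n`) the variable `x` is index `1`
and `y` is index `0` of `n`; `recur A m` is `rec z^{!A}. m`. -/
inductive Tm : Type
  | var : ℕ → Tm
  | star : Tm
  | seq : Tm → Tm → Tm
  | left : Ty → Ty → Tm → Tm
  | right : Ty → Ty → Tm → Tm
  | case : Tm → Tm → Tm → Tm
  | pair : Tm → Tm → Tm
  | letPair : Tm → Tm → Tm
  | lam : Ty → Tm → Tm
  | app : Tm → Tm → Tm
  | lift : Tm → Tm
  | force : Tm → Tm
  | recur : Ty → Tm → Tm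

namespace Tm

/-- A renaming under one more binder. -/
def upRen (ρ : ℕ → ℕ) : ℕ → ℕ
  | 0 => 0
  | i + 1 => ρ i + 1

/-- Renaming of the free variables. -/
def rename : (ℕ → ℕ) → Tm → Tm
  | ρ, .var i => .var (ρ i)
  | _, .star => .star
  | ρ, .seq m n => .seq (rename ρ m) (rename ρ n)
  | ρ, .left A B m => .left A B (rename ρ m)
  | ρ, .right A B m => .right A B (rename ρ m)
  | ρ, .case m n p => .case (rename ρ m) (rename (upRen ρ) n) (rename (upRen ρ) p)
  | ρ, .pair m n => .pair (rename ρ m) (rename ρ n)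
  | ρ, .letPair m n => .letPair (rename ρ m) (rename (upRen (upRen ρ)) n)
  | ρ, .lam A m => .lam A (rename (upRen ρ) m)
  | ρ, .app m n => .app (rename ρ m) (rename ρ n)
  | ρ, .lift m => .lift (rename ρ m)
  | ρ, .force m => .force (rename ρ m)
  | ρ, .recur A m => .recur A (rename (upRen ρ) m)

/-- A simultaneous substitution under one more binder. -/
def upSub (σ : ℕ → Tm) : ℕ → Tm
  | 0 => .var 0
  | i + 1 => rename Nat.succ (σ i)

/-- Simultaneous capture-avoiding substitution. -/
def subst : (ℕ → Tm) → Tm → Tm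
  | σ, .var i => σ i
  | _, .star => .star
  | σ, .seq m n => .seq (subst σ m) (subst σ n)
  | σ, .left A B m => .left A B (subst σ m)
  | σ, .right A B m => .right A B (subst σ m)
  | σ, .case m n p => .case (subst σ m) (subst (upSub σ) n) (subst (upSub σ) p)
  | σ, .pair m n => .pair (subst σ m) (subst σ n)
  | σ, .letPair m n => .letPair (subst σ m) (subst (upSub (upSub σ)) n)
  | σ, .lam A m => .lam A (subst (upSub σ) m)
  | σ, .app m n => .app (subst σ m) (subst σ n)
  | σ, .lift m => .lift (subst σ m)
  | σ, .force m => .force (subst σ m)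
  | σ, .recur A m => .recur A (subst (upSub σ) m)

/-- The substitution `0 ↦ v`, `i + 1 ↦ i`. -/
def scons (v : Tm) (σ : ℕ → Tm) : ℕ → Tm
  | 0 => v
  | i + 1 => σ i

/-- `m[v/x]`, where `x` is index `0` of `m`. -/
def subst1 (m v : Tm) : Tm := m.subst (scons v .var)

/-- `m[v/x, w/y]`, where `x` is index `1` and `y` is index `0` of `m`. -/
def subst2 (m v w : Tm) : Tm := m.subst (scons w (scons v .var))

end Tm

/-- Values `x | * | left v | right v | ⟨v, w⟩ | λx.m | lift m`. -/
inductive IsValue : Tm → Prop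
  | var (i : ℕ) : IsValue (.var i)
  | star : IsValue .star
  | left {A B : Ty} {v : Tm} : IsValue v → IsValue (.left A B v)
  | right {A B : Ty} {v : Tm} : IsValue v → IsValue (.right A B v)
  | pair {v w : Tm} : IsValue v → IsValue w → IsValue (.pair v w)
  | lam (A : Ty) (m : Tm) : IsValue (.lam A m)
  | lift (m : Tm) : IsValue (.lift m)

/-- The big-step call-by-value reduction relation `m ⇓ v`. -/
inductive Eval : Tm → Tm → Prop
  | var (i : ℕ) : Eval (.var i) (.var i)
  | star : Eval .star .star
  | seq {m n v : Tm} : Eval m .star → Eval n v → Eval (.seq m n) v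
  | left {A B : Ty} {m v : Tm} : Eval m v → Eval (.left A B m) (.left A B v)
  | right {A B : Ty} {m v : Tm} : Eval m v → Eval (.right A B m) (.right A B v)
  | caseLeft {A B : Ty} {m n p v w : Tm} :
      Eval m (.left A B v) → Eval (n.subst1 v) w → Eval (.case m n p) w
  | caseRight {A B : Ty} {m n p v w : Tm} :
      Eval m (.right A B v) → Eval (p.subst1 v) w → Eval (.case m n p) w
  | pair {m n v w : Tm} : Eval m v → Eval n w → Eval (.pair m n) (.pair v w)
  | letPair {m n v v' w : Tm} :
      Eval m (.pair v v') → Eval (n.subst2 v v') w → Eval (.letPair m n) w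
  | lam (A : Ty) (m : Tm) : Eval (.lam A m) (.lam A m)
  | app {A : Ty} {m n m' v w : Tm} :
      Eval m (.lam A m') → Eval n v → Eval (m'.subst1 v) w → Eval (.app m n) w
  | lift (m : Tm) : Eval (.lift m) (.lift m)
  | force {m m' v : Tm} : Eval m (.lift m') → Eval m' v → Eval (.force m) v
  | recur {A : Ty} {m v : Tm} :
      Eval (m.subst1 (.lift (.recur A m))) v → Eval (.recur A m) v

/-- The results of evaluation are values. -/
theorem Eval.isValue {m v : Tm} (h : Eval m v) : IsValue v := by
  induction h <;> first | assumption | (constructor <;> assumption)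

/-- A context is a finite assignment of types to variables: if entry `i` of the list is `some A`
then the context declares `xᵢ : A`, and if it is `none` then the variable `xᵢ` is not declared. -/
abbrev Ctx : Type := List (Option Ty)

/-- Contexts that declare only variables of non-linear types. -/
def Ctx.NonLinear : Ctx → Prop
  | [] => True
  | none :: Φ => Ctx.NonLinear Φ
  | some P :: Φ => Ctx.NonLinear Φ ∧ P.NonLinear

/-- `Insert Γ i A Θ`: the context `Θ` is `Γ, xᵢ : A`, the variable `xᵢ` being undeclared in `Γ`. -/
inductive Insert : Ctx → ℕ → Ty → Ctx → Type
  | here (Γ : Ctx) (A : Ty) : Insert (none :: Γ) 0 A (some A :: Γ)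
  | there (o : Option Ty) {Γ : Ctx} {i : ℕ} {A : Ty} {Θ : Ctx} :
      Insert Γ i A Θ → Insert (o :: Γ) (i + 1) A (o :: Θ)

/-- `Union Γ Δ Θ`: the context `Θ` is the union `Γ, Δ` of the disjoint contexts `Γ` and `Δ`. -/
inductive Union : Ctx → Ctx → Ctx → Type
  | nil : Union [] [] []
  | skip {Γ Δ Θ : Ctx} : Union Γ Δ Θ → Union (none :: Γ) (none :: Δ) (none :: Θ)
  | inl (A : Ty) {Γ Δ Θ : Ctx} : Union Γ Δ Θ → Union (some A :: Γ) (none :: Δ) (some A :: Θ)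
  | inr (A : Ty) {Γ Δ Θ : Ctx} : Union Γ Δ Θ → Union (none :: Γ) (some A :: Δ) (some A :: Θ)

/-- A presentation of contexts `Γ₁`, `Γ₂`, `Θ` as `Γ₁ = Φ, Γ` and `Γ₂ = Φ, Δ` and `Θ = Φ, Γ, Δ`
with `Φ` non-linear: the context management of the rules with several premises. -/
structure Split (Γ₁ Γ₂ Θ : Ctx) : Type where
  (Φ Γ Δ : Ctx)
  nonLinear : Φ.NonLinear
  first : Union Φ Γ Γ₁
  second : Union Φ Δ Γ₂
  total : Union Γ₁ Δ Θ

/-- The two calculi `λ_l` and `λ_a`. -/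
inductive Calculus : Type
  | linear : Calculus
  | affine : Calculus

/-- Derivations of `Γ ⊢ m : A` in either calculus. The rules whose names end in `L` and `A` belong to
`λ_l` and `λ_a` only. The rule `recurA` is the weakened form of `recur`, exactly as `liftA` is of
`lift`: in `λ_a` all variables are discardable, and without it weakening by a linear variable and
subject reduction fail in `λ_a` (see `(λ f^{I⊸I}. λ a^{I⊸I}. f) (λ b^I. rec z^{!I}. force z)`). -/
inductive Der : Calculus → Ctx → Tm → Ty → Type
  | varL {Φ Θ : Ctx} {i : ℕ} {A : Ty} :
      Φ.NonLinear → Insert Φ i A Θ → Der .linear Θ (.var i) A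
  | starL {Φ : Ctx} : Φ.NonLinear → Der .linear Φ .star .unit
  | liftL {Φ : Ctx} {m : Tm} {A : Ty} :
      Φ.NonLinear → Der .linear Φ m A → Der .linear Φ (.lift m) (.bang A)
  | varA {Γ Θ : Ctx} {i : ℕ} {A : Ty} : Insert Γ i A Θ → Der .affine Θ (.var i) A
  | starA {Γ : Ctx} : Der .affine Γ .star .unit
  | liftA {Φ Γ Θ : Ctx} {m : Tm} {A : Ty} :
      Φ.NonLinear → Union Φ Γ Θ → Der .affine Φ m A → Der .affine Θ (.lift m) (.bang A)
  | recurA {Φ Γ Θ : Ctx} {m : Tm} {A : Ty} :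
      Φ.NonLinear → Union Φ Γ Θ → Der .affine (some (.bang A) :: Φ) m A →
      Der .affine Θ (.recur A m) A
  | seq {c : Calculus} {Γ₁ Γ₂ Θ : Ctx} {m n : Tm} {A : Ty} :
      Split Γ₁ Γ₂ Θ → Der c Γ₁ m .unit → Der c Γ₂ n A → Der c Θ (.seq m n) A
  | force {c : Calculus} {Γ : Ctx} {m : Tm} {A : Ty} :
      Der c Γ m (.bang A) → Der c Γ (.force m) A
  | left {c : Calculus} {Γ : Ctx} {m : Tm} {A B : Ty} :
      Der c Γ m A → Der c Γ (.left A B m) (.sum A B)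
  | right {c : Calculus} {Γ : Ctx} {m : Tm} {A B : Ty} :
      Der c Γ m B → Der c Γ (.right A B m) (.sum A B)
  | case {c : Calculus} {Γ₁ Γ₂ Θ : Ctx} {m n p : Tm} {A B D : Ty} :
      Split Γ₁ Γ₂ Θ → Der c Γ₁ m (.sum A B) → Der c (some A :: Γ₂) n D →
      Der c (some B :: Γ₂) p D → Der c Θ (.case m n p) D
  | pair {c : Calculus} {Γ₁ Γ₂ Θ : Ctx} {m n : Tm} {A B : Ty} :
      Split Γ₁ Γ₂ Θ → Der c Γ₁ m A → Der c Γ₂ n B → Der c Θ (.pair m n) (.tensor A B)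
  | letPair {c : Calculus} {Γ₁ Γ₂ Θ : Ctx} {m n : Tm} {A B D : Ty} :
      Split Γ₁ Γ₂ Θ → Der c Γ₁ m (.tensor A B) → Der c (some B :: some A :: Γ₂) n D →
      Der c Θ (.letPair m n) D
  | lam {c : Calculus} {Γ : Ctx} {m : Tm} {A B : Ty} :
      Der c (some A :: Γ) m B → Der c Γ (.lam A m) (.lolli A B)
  | app {c : Calculus} {Γ₁ Γ₂ Θ : Ctx} {m n : Tm} {A B : Ty} :
      Split Γ₁ Γ₂ Θ → Der c Γ₁ m (.lolli A B) → Der c Γ₂ n A → Der c Θ (.app m n) B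
  | recur {c : Calculus} {Φ : Ctx} {m : Tm} {A : Ty} :
      Φ.NonLinear → Der c (some (.bang A) :: Φ) m A → Der c Φ (.recur A m) A

/-! ## Models -/

noncomputable section

/-- A (compact) `λ_l`-model on a cartesian category `B` and symmetric monoidal categories `V`, `C`,
all with finite coproducts. -/
structure LinearModel (B : Type u₁) [Category.{v₁} B] [CartesianMonoidalCategory B]
    [BraidedCategory B] [HasFiniteCoproducts B]
    (V : Type u₂) [Category.{v₂} V] [MonoidalCategory V] [SymmetricCategory V]
    [HasFiniteCoproducts V]
    (C : Type u₃) [Category.{v₃} C] [MonoidalCategory C] [SymmetricCategory C]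
    [HasFiniteCoproducts C] where
  J : B ⥤ V
  K : V ⥤ B
  L : V ⥤ C
  R : C ⥤ V
  -- the symmetric monoidal adjunction `J ⊣ K`
  [braidedJ : J.Braided]
  [laxBraidedK : K.LaxBraided]
  adjJK : J ⊣ K
  monoidalJK : adjJK.IsMonoidal
  -- the symmetric monoidal adjunction `L ⊣ R`
  [braidedL : L.Braided]
  [laxBraidedR : R.LaxBraided]
  adjLR : L ⊣ R
  monoidalLR : adjLR.IsMonoidal
  /-- The functors `A ⊸ - : C ⥤ V`. -/
  hom : V → (C ⥤ V)
  /-- Currying: `L ∘ (- ⊗ A) ⊣ (A ⊸ -)`. -/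
  adjHom (A : V) : tensorRight A ⋙ L ⊣ hom A
  /-- The initial algebra `ω : F X ⊗ !Ω ⟶ Ω` of `F X ⊗ !(-)`, where `F = L J` and `! = L J K R`. -/
  omega (X : B) :
    Endofunctor.Algebra (((R ⋙ K) ⋙ J ⋙ L) ⋙ tensorLeft ((J ⋙ L).obj X))
  omegaInitial (X : B) : IsInitial (omega X)
  /-- `ω⁻¹ : Ω ⟶ F X ⊗ !Ω` is a final coalgebra. -/
  omegaFinal (X : B) :
    IsTerminal (⟨(omega X).a, Endofunctor.Algebra.Initial.strInv (omegaInitial X)⟩ :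
      Endofunctor.Coalgebra (((R ⋙ K) ⋙ J ⋙ L) ⋙ tensorLeft ((J ⋙ L).obj X)))

attribute [instance] LinearModel.braidedJ LinearModel.laxBraidedK LinearModel.braidedL
  LinearModel.laxBraidedR LinearModel.monoidalJK LinearModel.monoidalLR

/-- A (compact) `λ_a`-model: a `λ_l`-model in which the tensor unit of `V` is terminal. -/
structure AffineModel (B : Type u₁) [Category.{v₁} B] [CartesianMonoidalCategory B]
    [BraidedCategory B] [HasFiniteCoproducts B]
    (V : Type u₂) [Category.{v₂} V] [MonoidalCategory V] [SymmetricCategory V]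
    [HasFiniteCoproducts V]
    (C : Type u₃) [Category.{v₃} C] [MonoidalCategory C] [SymmetricCategory C]
    [HasFiniteCoproducts C] extends LinearModel B V C where
  unitTerminal : IsTerminal (𝟙_ V)

namespace LinearModel

variable {B : Type u₁} [Category.{v₁} B] [CartesianMonoidalCategory B]
  [BraidedCategory B] [HasFiniteCoproducts B]
  {V : Type u₂} [Category.{v₂} V] [MonoidalCategory V] [SymmetricCategory V]
  [HasFiniteCoproducts V]
  {C : Type u₃} [Category.{v₃} C] [MonoidalCategory C] [SymmetricCategory C]
  [HasFiniteCoproducts C]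
  (M : LinearModel B V C)

/-- `F = L J`. -/
abbrev F : B ⥤ C := M.J ⋙ M.L

/-- `G = K R`. -/
abbrev G : C ⥤ B := M.R ⋙ M.K

/-- `! = F G`. -/
abbrev bang : C ⥤ C := M.G ⋙ M.F

/-- The composite adjunction `F ⊣ G`. -/
def adjFG : M.F ⊣ M.G := M.adjJK.comp M.adjLR

instance : PreservesColimitsOfSize.{0, 0} M.J := M.adjJK.leftAdjoint_preservesColimits

instance : PreservesColimitsOfSize.{0, 0} M.L := M.adjLR.leftAdjoint_preservesColimits

instance (A : V) : PreservesColimitsOfSize.{0, 0} (tensorRight A ⋙ M.L) :=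
  (M.adjHom A).leftAdjoint_preservesColimits

/-! ### Interpretation of types and contexts -/

/-- The interpretations `⟦A⟧` in `C` and `⟦A⟧` in `V`, by simultaneous induction. -/
@[reducible] def ty : Ty → C × V
  | .unit => (𝟙_ C, 𝟙_ V)
  | .sum A B => ((ty A).1 ⨿ (ty B).1, (ty A).2 ⨿ (ty B).2)
  | .tensor A B => ((ty A).1 ⊗ (ty B).1, (ty A).2 ⊗ (ty B).2)
  | .lolli A B => (M.L.obj ((M.hom (ty A).2).obj (ty B).1), (M.hom (ty A).2).obj (ty B).1)
  | .bang A => (M.bang.obj (ty A).1, M.J.obj (M.G.obj (ty A).1))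

/-- `⟦A⟧` in `C`. -/
@[reducible] def tyC (A : Ty) : C := (M.ty A).1

/-- `⟦A⟧` in `V`. -/
@[reducible] def tyV (A : Ty) : V := (M.ty A).2

/-- `⟦P⟧` in `B`, for non-linear `P`. -/
@[reducible] def tyB : (P : Ty) → P.NonLinear → B
  | .unit, _ => 𝟙_ B
  | .sum P R, h => tyB P h.1 ⨿ tyB R h.2
  | .tensor P R, h => tyB P h.1 ⊗ tyB R h.2
  | .lolli _ _, h => h.elim
  | .bang A, _ => M.G.obj (M.tyC A)

/-- `L⟦A⟧ ≅ ⟦A⟧`. -/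
def tyIsoC : (A : Ty) → (M.L.obj (M.tyV A) ≅ M.tyC A)
  | .unit => (Functor.Monoidal.εIso M.L).symm
  | .sum A B => (PreservesColimitPair.iso M.L (M.tyV A) (M.tyV B)).symm ≪≫
      coprod.mapIso (tyIsoC A) (tyIsoC B)
  | .tensor A B => (Functor.Monoidal.μIso M.L (M.tyV A) (M.tyV B)).symm ≪≫
      tensorIso (tyIsoC A) (tyIsoC B)
  | .lolli _ _ => Iso.refl _
  | .bang _ => Iso.refl _

/-- `J⟦P⟧ ≅ ⟦P⟧`. -/
def tyIsoV : (P : Ty) → (h : P.NonLinear) → (M.J.obj (M.tyB P h) ≅ M.tyV P)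
  | .unit, _ => (Functor.Monoidal.εIso M.J).symm
  | .sum P R, h => (PreservesColimitPair.iso M.J (M.tyB P h.1) (M.tyB R h.2)).symm ≪≫
      coprod.mapIso (tyIsoV P h.1) (tyIsoV R h.2)
  | .tensor P R, h => (Functor.Monoidal.μIso M.J (M.tyB P h.1) (M.tyB R h.2)).symm ≪≫
      tensorIso (tyIsoV P h.1) (tyIsoV R h.2)
  | .lolli _ _, h => h.elim
  | .bang _, _ => Iso.refl _

/-- `⟦Γ⟧` in `C`. -/
@[reducible] def ctxC : Ctx → C
  | [] => 𝟙_ C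
  | none :: Γ => ctxC Γ
  | some A :: Γ => ctxC Γ ⊗ M.tyC A

/-- `⟦Γ⟧` in `V`. -/
@[reducible] def ctxV : Ctx → V
  | [] => 𝟙_ V
  | none :: Γ => ctxV Γ
  | some A :: Γ => ctxV Γ ⊗ M.tyV A

/-- `⟦Φ⟧` in `B`, for non-linear `Φ`. -/
@[reducible] def ctxB : (Φ : Ctx) → Φ.NonLinear → B
  | [], _ => 𝟙_ B
  | none :: Φ, h => ctxB Φ h
  | some P :: Φ, h => ctxB Φ h.1 ⊗ M.tyB P h.2

/-- `L⟦Γ⟧ ≅ ⟦Γ⟧`. -/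
def ctxIsoC : (Γ : Ctx) → (M.L.obj (M.ctxV Γ) ≅ M.ctxC Γ)
  | [] => (Functor.Monoidal.εIso M.L).symm
  | none :: Γ => ctxIsoC Γ
  | some A :: Γ => (Functor.Monoidal.μIso M.L (M.ctxV Γ) (M.tyV A)).symm ≪≫
      tensorIso (ctxIsoC Γ) (M.tyIsoC A)

/-- `J⟦Φ⟧ ≅ ⟦Φ⟧`. -/
def ctxIsoV : (Φ : Ctx) → (h : Φ.NonLinear) → (M.J.obj (M.ctxB Φ h) ≅ M.ctxV Φ)
  | [], _ => (Functor.Monoidal.εIso M.J).symm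
  | none :: Φ, h => ctxIsoV Φ h
  | some P :: Φ, h => (Functor.Monoidal.μIso M.J (M.ctxB Φ h.1) (M.tyB P h.2)).symm ≪≫
      tensorIso (ctxIsoV Φ h.1) (M.tyIsoV P h.2)

/-- `F⟦Φ⟧ ≅ ⟦Φ⟧`. -/
def ctxIsoF (Φ : Ctx) (h : Φ.NonLinear) : M.F.obj (M.ctxB Φ h) ≅ M.ctxC Φ :=
  M.L.mapIso (M.ctxIsoV Φ h) ≪≫ M.ctxIsoC Φ

/-! ### Structural and substructural morphisms -/

/-- `⟦Γ, xᵢ : A⟧ ≅ ⟦Γ⟧ ⊗ ⟦A⟧`. -/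
def insertIso : {Γ : Ctx} → {i : ℕ} → {A : Ty} → {Θ : Ctx} → Insert Γ i A Θ →
    (M.ctxC Θ ≅ M.ctxC Γ ⊗ M.tyC A)
  | _, _, _, _, .here _ _ => Iso.refl _
  | _, _, _, _, .there none s => (insertIso s :)
  | _, _, _, _, .there (some D) (Γ := Γ) (A := A) s =>
      whiskerRightIso (insertIso s) (M.tyC D) ≪≫ α_ (M.ctxC Γ) (M.tyC A) (M.tyC D) ≪≫
        whiskerLeftIso (M.ctxC Γ) (β_ (M.tyC A) (M.tyC D)) ≪≫
        (α_ (M.ctxC Γ) (M.tyC D) (M.tyC A)).symm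

/-- `⟦Γ, Δ⟧ ≅ ⟦Γ⟧ ⊗ ⟦Δ⟧`. -/
def unionIso : {Γ Δ Θ : Ctx} → Union Γ Δ Θ → (M.ctxC Θ ≅ M.ctxC Γ ⊗ M.ctxC Δ)
  | _, _, _, .nil => (λ_ (𝟙_ C)).symm
  | _, _, _, .skip s => (unionIso s :)
  | _, _, _, .inl A (Γ := Γ) (Δ := Δ) s =>
      whiskerRightIso (unionIso s) (M.tyC A) ≪≫ α_ (M.ctxC Γ) (M.ctxC Δ) (M.tyC A) ≪≫
        whiskerLeftIso (M.ctxC Γ) (β_ (M.ctxC Δ) (M.tyC A)) ≪≫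
        (α_ (M.ctxC Γ) (M.tyC A) (M.ctxC Δ)).symm
  | _, _, _, .inr A (Γ := Γ) (Δ := Δ) s =>
      whiskerRightIso (unionIso s) (M.tyC A) ≪≫ α_ (M.ctxC Γ) (M.ctxC Δ) (M.tyC A)

/-- Discarding `⟦Φ⟧ ⟶ I`. -/
def discard (Φ : Ctx) (h : Φ.NonLinear) : M.ctxC Φ ⟶ 𝟙_ C :=
  (M.ctxIsoF Φ h).inv ≫ M.F.map (SemiCartesianMonoidalCategory.toUnit (M.ctxB Φ h)) ≫
    Functor.OplaxMonoidal.η M.F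

/-- Copying `⟦Φ⟧ ⟶ ⟦Φ⟧ ⊗ ⟦Φ⟧`. -/
def copy (Φ : Ctx) (h : Φ.NonLinear) : M.ctxC Φ ⟶ M.ctxC Φ ⊗ M.ctxC Φ :=
  (M.ctxIsoF Φ h).inv ≫ M.F.map (CartesianMonoidalCategory.lift (𝟙 _) (𝟙 _)) ≫
    Functor.OplaxMonoidal.δ M.F (M.ctxB Φ h) (M.ctxB Φ h) ≫
    ((M.ctxIsoF Φ h).hom ⊗ₘ (M.ctxIsoF Φ h).hom)

/-- Promotion `⟦Φ⟧ ⟶ !⟦Φ⟧`. -/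
def promote (Φ : Ctx) (h : Φ.NonLinear) : M.ctxC Φ ⟶ M.bang.obj (M.ctxC Φ) :=
  (M.ctxIsoF Φ h).inv ≫ M.F.map (M.adjFG.unit.app (M.ctxB Φ h)) ≫
    M.bang.map (M.ctxIsoF Φ h).hom

/-- Discarding of an arbitrary context `⟦Γ⟧ ⟶ I` when the tensor unit of `V` is terminal. -/
def discardAll (t : IsTerminal (𝟙_ V)) (Γ : Ctx) : M.ctxC Γ ⟶ 𝟙_ C :=
  (M.ctxIsoC Γ).inv ≫ M.L.map (t.from (M.ctxV Γ)) ≫ Functor.OplaxMonoidal.η M.L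

/-- `⟦Φ, Γ, Δ⟧ ⟶ ⟦Φ⟧ ⊗ ⟦Φ⟧ ⊗ ⟦Γ⟧ ⊗ ⟦Δ⟧ ≅ ⟦Φ, Γ⟧ ⊗ ⟦Φ, Δ⟧`, copying `Φ`. -/
def split {Γ₁ Γ₂ Θ : Ctx} (s : Split Γ₁ Γ₂ Θ) : M.ctxC Θ ⟶ M.ctxC Γ₁ ⊗ M.ctxC Γ₂ :=
  (M.unionIso s.total).hom ≫ (M.unionIso s.first).hom ▷ M.ctxC s.Δ ≫
    (M.copy s.Φ s.nonLinear ▷ M.ctxC s.Γ) ▷ M.ctxC s.Δ ≫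
    (α_ (M.ctxC s.Φ ⊗ M.ctxC s.Φ) (M.ctxC s.Γ) (M.ctxC s.Δ)).hom ≫
    tensorμ (M.ctxC s.Φ) (M.ctxC s.Φ) (M.ctxC s.Γ) (M.ctxC s.Δ) ≫
    ((M.unionIso s.first).inv ⊗ₘ (M.unionIso s.second).inv)

/-- Distributivity of `⊗` over `+` in the image of `L`:
`⟦Γ⟧ ⊗ (⟦A⟧ + ⟦B⟧) ≅ (⟦Γ⟧ ⊗ ⟦A⟧) + (⟦Γ⟧ ⊗ ⟦B⟧)`, since `L ∘ (- ⊗ ⟦Γ⟧)` preserves coproducts. -/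
def distrib (Γ : Ctx) (A B : Ty) :
    M.ctxC Γ ⊗ M.tyC (.sum A B) ≅ (M.ctxC Γ ⊗ M.tyC A) ⨿ (M.ctxC Γ ⊗ M.tyC B) :=
  -- `L (⟦D⟧ ⊗ ⟦Γ⟧) ≅ ⟦Γ⟧ ⊗ ⟦D⟧`
  let e : (D : Ty) → ((tensorRight (M.ctxV Γ) ⋙ M.L).obj (M.tyV D) ≅ M.ctxC Γ ⊗ M.tyC D) :=
    fun D => (Functor.Monoidal.μIso M.L (M.tyV D) (M.ctxV Γ)).symm ≪≫
      tensorIso (M.tyIsoC D) (M.ctxIsoC Γ) ≪≫ β_ (M.tyC D) (M.ctxC Γ)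
  (e (.sum A B)).symm ≪≫
    (PreservesColimitPair.iso (tensorRight (M.ctxV Γ) ⋙ M.L) (M.tyV A) (M.tyV B)).symm ≪≫
    coprod.mapIso (e A) (e B)

/-- `curry f : ⟦Γ⟧ ⟶ ⟦A⟧ ⊸ ⟦B⟧` in `V`, for `f : ⟦Γ, x : A⟧ ⟶ ⟦B⟧` in `C`. -/
def curry {Γ : Ctx} {A B : Ty} (f : M.ctxC (some A :: Γ) ⟶ M.tyC B) :
    M.ctxV Γ ⟶ M.tyV (.lolli A B) :=
  ((M.adjHom (M.tyV A)).homEquiv (M.ctxV Γ) (M.tyC B)) ((M.ctxIsoC (some A :: Γ)).hom ≫ f)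

/-- `eval : ⟦A ⊸ B⟧ ⊗ ⟦A⟧ ≅ L ((⟦A⟧ ⊸ ⟦B⟧) ⊗ ⟦A⟧) ⟶ ⟦B⟧`. -/
def eval (A B : Ty) : M.tyC (.lolli A B) ⊗ M.tyC A ⟶ M.tyC B :=
  ((M.tyIsoC (.lolli A B)).inv ⊗ₘ (M.tyIsoC A).inv) ≫
    Functor.LaxMonoidal.μ M.L (M.tyV (.lolli A B)) (M.tyV A) ≫
    (M.adjHom (M.tyV A)).counit.app (M.tyC B)

/-- The functor `F X ⊗ !(-)`. -/
abbrev recFunctor (X : B) : C ⥤ C := M.bang ⋙ tensorLeft (M.F.obj X)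

/-- The coalgebra `F X ⟶ F X ⊗ F X ⟶ F X ⊗ !F X`, copying and then promoting the second copy. -/
def unfoldCoalgebra (X : B) : Endofunctor.Coalgebra (M.recFunctor X) where
  V := M.F.obj X
  str := M.F.map (CartesianMonoidalCategory.lift (𝟙 X) (𝟙 X)) ≫
    Functor.OplaxMonoidal.δ M.F X X ≫ M.F.obj X ◁ M.F.map (M.adjFG.unit.app X)

/-- `γ : F X ⟶ Ω`, the unique coalgebra morphism to the final coalgebra. -/
def gamma (X : B) : M.F.obj X ⟶ (M.omega X).a :=
  ((M.omegaFinal X).from (M.unfoldCoalgebra X)).f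

/-- `σ_m : Ω ⟶ D`, the unique algebra morphism from the initial algebra to `m : F X ⊗ !D ⟶ D`. -/
def sigma (X : B) {D : C} (m : M.F.obj X ⊗ M.bang.obj D ⟶ D) : (M.omega X).a ⟶ D :=
  ((M.omegaInitial X).to (⟨D, m⟩ : Endofunctor.Algebra (M.recFunctor X))).f

/-- `⟦lift m⟧`, given `⟦m⟧`. -/
def liftMap {Φ : Ctx} (h : Φ.NonLinear) {A : Ty} (f : M.ctxC Φ ⟶ M.tyC A) :
    M.ctxC Φ ⟶ M.tyC (.bang A) :=
  M.promote Φ h ≫ M.bang.map f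

/-- `⟦rec z. m⟧ = σ_{⟦m⟧} ∘ γ`, given `⟦m⟧`. -/
def recMap {Φ : Ctx} (h : Φ.NonLinear) {A : Ty} (f : M.ctxC (some (.bang A) :: Φ) ⟶ M.tyC A) :
    M.ctxC Φ ⟶ M.tyC A :=
  (M.ctxIsoF Φ h).inv ≫ M.gamma (M.ctxB Φ h) ≫
    M.sigma (M.ctxB Φ h) ((M.ctxIsoF Φ h).hom ▷ M.bang.obj (M.tyC A) ≫ f)

/-! ### Interpretation of terms -/

/-- What a `λ_l`-model must have in addition in order to interpret the given calculus. -/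
def Supports (_ : LinearModel B V C) : Calculus → Type (max u₂ v₂)
  | .linear => PUnit
  | .affine => IsTerminal (𝟙_ V)

/-- `⟦Γ ⊢ m : A⟧ : ⟦Γ⟧ ⟶ ⟦A⟧`, by induction on the derivation. -/
def interp : {c : Calculus} → M.Supports c → {Γ : Ctx} → {m : Tm} → {A : Ty} → Der c Γ m A →
    (M.ctxC Γ ⟶ M.tyC A)
  | _, _, _, _, _, .varL (Φ := Φ) (A := A) h s =>
      (M.insertIso s).hom ≫ M.discard Φ h ▷ M.tyC A ≫ (λ_ (M.tyC A)).hom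
  | _, _, _, _, _, .starL (Φ := Φ) h => M.discard Φ h
  | _, t, _, _, _, .liftL h d => M.liftMap h (interp t d)
  | _, t, _, _, _, .varA (Γ := Γ) (A := A) s =>
      (M.insertIso s).hom ≫ M.discardAll t Γ ▷ M.tyC A ≫ (λ_ (M.tyC A)).hom
  | _, t, _, _, _, .starA (Γ := Γ) => M.discardAll t Γ
  | _, t, _, _, _, .liftA (Φ := Φ) (Γ := Γ) h s d =>
      (M.unionIso s).hom ≫ M.ctxC Φ ◁ M.discardAll t Γ ≫ (ρ_ (M.ctxC Φ)).hom ≫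
        M.liftMap h (interp t d)
  | _, t, _, _, _, .recurA (Φ := Φ) (Γ := Γ) h s d =>
      (M.unionIso s).hom ≫ M.ctxC Φ ◁ M.discardAll t Γ ≫ (ρ_ (M.ctxC Φ)).hom ≫
        M.recMap h (interp t d)
  | _, t, _, _, _, .seq (A := A) s d e =>
      M.split s ≫ (interp t d ⊗ₘ interp t e) ≫ (λ_ (M.tyC A)).hom
  | _, t, _, _, _, .force (A := A) d => interp t d ≫ M.adjFG.counit.app (M.tyC A)
  | _, t, _, _, _, .left (A := A) (B := B) d =>
      interp t d ≫ (coprod.inl : M.tyC A ⟶ M.tyC A ⨿ M.tyC B)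
  | _, t, _, _, _, .right (A := A) (B := B) d =>
      interp t d ≫ (coprod.inr : M.tyC B ⟶ M.tyC A ⨿ M.tyC B)
  | _, t, _, _, _, .case (Γ₁ := Γ₁) (Γ₂ := Γ₂) (A := A) (B := B) s d e f =>
      M.split s ≫ (β_ (M.ctxC Γ₁) (M.ctxC Γ₂)).hom ≫ M.ctxC Γ₂ ◁ interp t d ≫
        (M.distrib Γ₂ A B).hom ≫ coprod.desc (interp t e) (interp t f)
  | _, t, _, _, _, .pair s d e => M.split s ≫ (interp t d ⊗ₘ interp t e)
  | _, t, _, _, _, .letPair (Γ₂ := Γ₂) (A := A) (B := B) s d e =>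
      M.split s ≫ interp t d ▷ M.ctxC Γ₂ ≫ (β_ (M.tyC A ⊗ M.tyC B) (M.ctxC Γ₂)).hom ≫
        (α_ (M.ctxC Γ₂) (M.tyC A) (M.tyC B)).inv ≫ interp t e
  | _, t, _, _, _, .lam (Γ := Γ) d => (M.ctxIsoC Γ).inv ≫ M.L.map (M.curry (interp t d))
  | _, t, _, _, _, .app (A := A) (B := B) s d e =>
      M.split s ≫ (interp t d ⊗ₘ interp t e) ≫ M.eval A B
  | _, t, _, _, _, .recur h d => M.recMap h (interp t d)

/-- The interpretation of `λ_l` in a `λ_l`-model. -/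
def interpL {Γ : Ctx} {m : Tm} {A : Ty} (d : Der .linear Γ m A) : M.ctxC Γ ⟶ M.tyC A :=
  M.interp (c := .linear) PUnit.unit d

end LinearModel

/-- The interpretation of `λ_a` in a `λ_a`-model. -/
def AffineModel.interpA {B : Type u₁} [Category.{v₁} B] [CartesianMonoidalCategory B]
    [BraidedCategory B] [HasFiniteCoproducts B]
    {V : Type u₂} [Category.{v₂} V] [MonoidalCategory V] [SymmetricCategory V]
    [HasFiniteCoproducts V]
    {C : Type u₃} [Category.{v₃} C] [MonoidalCategory C] [SymmetricCategory C]
    [HasFiniteCoproducts C] (M : AffineModel B V C)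
    {Γ : Ctx} {m : Tm} {A : Ty} (d : Der .affine Γ m A) :
    M.toLinearModel.ctxC Γ ⟶ M.toLinearModel.tyC A :=
  M.toLinearModel.interp (c := .affine) M.unitTerminal d

end

end SubLambda

/-! The proof is an induction on evaluation with a substitution lemma for values at its core.
Substitution moves the interpretation of a value past copying, discarding, promotion, currying and
recursion, and a general morphism of `C` commutes with none of these. Values do. Every value is the
image under `L` of a morphism of `V`; this suffices for currying and, when the unit of `V` is
terminal, for discarding. A value of non-linear type is moreover, up to discarding unused variables,
the image under `F` of a morphism of `B`; this suffices for copying, discarding, promotion and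
recursion, because diagonals, terminal maps and the unit of `F ⊣ G` are natural
(`GDer.img_of_isValue`, `GDer.imgF_of_isValue`).

The second difficulty is that a judgement has many derivations, which differ in where variables are
discarded or shared. Derivations are therefore replaced by the relation `GDer` between judgements
and morphisms. All its context management is done by `dropMap` and `shareMap`, which depend only on
the contexts involved and satisfy the laws of commutative comonoids (`shareMap_assoc`,
`shareMap_swap`, `shareMap_discSnd`, `shareMap_interchange`). Interpretations of derivations satisfy
`GDer` (`gDer_interp`), and a judgement in `GDer` is derivable (`GDer.nonempty_der`). Coherence
(`GDer.same`) compares two derivations of one term in contexts that need only be compatible: they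
factor in the same way through a common subcontext. Hence the morphism is determined by the
judgement (`GDer.unique`).

With `GDer.subst` available, each evaluation rule becomes an equation of the model: a counit law for
`m; n`, the injections of a coproduct for `case`, the beta law `curry_eval` for application, a
triangle identity (`liftMap_counit`) for `force`, and for `rec` the fact that a coalgebra morphism
followed by an algebra morphism solves the fixed point equation (`recMap_unfold`). So `GDer.eval`
relates the result `v` to the very morphism that interprets `m`, and uniqueness identifies it with
the interpretation of any derivation of `v`. Typability of `v` must not depend on the given model,
and is obtained by running the same argument in a model with a single morphism. -/

namespace SubLambda

/-! ## Objects and morphisms in the image of a functor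

An isomorphism `x : H.obj d ≅ X` represents `X` as an object in the image of `H`. -/

namespace Rep

open Functor.LaxMonoidal Functor.OplaxMonoidal

section Category

variable {D : Type u₁} [Category.{v₁} D] {C : Type u₃} [Category.{v₃} C] {H : D ⥤ C}
  {a b c : D} {X Y Z : C}

/-- The morphism `X ⟶ Y` given by the image of `g`. -/
def push (x : H.obj a ≅ X) (y : H.obj b ≅ Y) (g : a ⟶ b) : X ⟶ Y := x.inv ≫ H.map g ≫ y.hom

theorem push_id (x : H.obj a ≅ X) : push x x (𝟙 _) = 𝟙 X := by simp [push]

theorem push_comp (x : H.obj a ≅ X) (y : H.obj b ≅ Y) (z : H.obj c ≅ Z) (f : a ⟶ b) (g : b ⟶ c) :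
    push x y f ≫ push y z g = push x z (f ≫ g) := by simp [push]

theorem eq_push_iff {x : H.obj a ≅ X} {y : H.obj b ≅ Y} {g : a ⟶ b} {f : X ⟶ Y} :
    f = push x y g ↔ x.hom ≫ f = H.map g ≫ y.hom := by
  rw [push, Iso.eq_inv_comp]

theorem push_eq_inv {x : H.obj a ≅ X} {y : H.obj b ≅ Y} {e : X ≅ Y} {g : a ≅ b}
    (h : e.hom = push x y g.hom) : e.inv = push y x g.inv := by
  rw [← cancel_mono e.hom, Iso.inv_hom_id, h, push_comp, g.inv_hom_id, push_id]

/-- The morphisms that are images under `H`. -/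
def Img (x : H.obj a ≅ X) (y : H.obj b ≅ Y) (f : X ⟶ Y) : Prop := ∃ g, f = push x y g

theorem img_push (x : H.obj a ≅ X) (y : H.obj b ≅ Y) (g : a ⟶ b) : Img x y (push x y g) := ⟨g, rfl⟩

theorem img_id (x : H.obj a ≅ X) : Img x x (𝟙 X) := ⟨𝟙 _, (push_id x).symm⟩

theorem Img.comp {x : H.obj a ≅ X} {y : H.obj b ≅ Y} {z : H.obj c ≅ Z} {f : X ⟶ Y} {g : Y ⟶ Z}
    (hf : Img x y f) (hg : Img y z g) : Img x z (f ≫ g) := by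
  obtain ⟨f, rfl⟩ := hf
  obtain ⟨g, rfl⟩ := hg
  exact ⟨f ≫ g, push_comp ..⟩

/-- A representation through a composite functor. -/
def comp {E : Type u₂} [Category.{v₂} E] {J : E ⥤ D} {e : E} (x : H.obj a ≅ X) (y : J.obj e ≅ a) :
    (J ⋙ H).obj e ≅ X := H.mapIso y ≪≫ x

theorem push_comp_rep {E : Type u₂} [Category.{v₂} E] {J : E ⥤ D} {e e' : E} (x : H.obj a ≅ X)
    (x' : J.obj e ≅ a) (y : H.obj b ≅ Y) (y' : J.obj e' ≅ b) (g : e ⟶ e') :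
    push (comp x x') (comp y y') g = push x y (push x' y' g) := by simp [push, comp]

/-- Since `F = LJ`, whatever lies in the image of `F` lies in the image of `L`; this is how the
`L`-statements are obtained from the `F`-statements. -/
theorem Img.of_comp {E : Type u₂} [Category.{v₂} E] {J : E ⥤ D} {e e' : E} {x : H.obj a ≅ X}
    {x' : J.obj e ≅ a} {y : H.obj b ≅ Y} {y' : J.obj e' ≅ b} {f : X ⟶ Y}
    (hf : Img (Rep.comp x x') (Rep.comp y y') f) : Img x y f := by
  obtain ⟨g, rfl⟩ := hf
  exact ⟨_, push_comp_rep ..⟩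

end Category

section Monoidal

variable {D : Type u₁} [Category.{v₁} D] [MonoidalCategory D]
  {C : Type u₃} [Category.{v₃} C] [MonoidalCategory C]
  {H : D ⥤ C} [H.Monoidal] {a b c d : D} {X Y Z W : C}

/-- The tensor unit. -/
def unit (H : D ⥤ C) [H.Monoidal] : H.obj (𝟙_ D) ≅ 𝟙_ C := (Functor.Monoidal.εIso H).symm

/-- Tensor products. -/
def tensor (x : H.obj a ≅ X) (y : H.obj b ≅ Y) : H.obj (a ⊗ b) ≅ X ⊗ Y :=
  (Functor.Monoidal.μIso H a b).symm ≪≫ tensorIso x y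

theorem push_tensor (x : H.obj a ≅ X) (y : H.obj b ≅ Y) (z : H.obj c ≅ Z) (w : H.obj d ≅ W)
    (f : a ⟶ b) (g : c ⟶ d) :
    (push x y f ⊗ₘ push z w g) = push (tensor x z) (tensor y w) (f ⊗ₘ g) := by
  rw [eq_push_iff]
  simp [tensor, push, tensorHom_comp_tensorHom, ← δ_natural_assoc]

theorem push_whiskerRight (x : H.obj a ≅ X) (y : H.obj b ≅ Y) (z : H.obj c ≅ Z) (f : a ⟶ b) :
    push x y f ▷ Z = push (tensor x z) (tensor y z) (f ▷ c) := by
  rw [← tensorHom_id, ← tensorHom_id, ← push_id z, push_tensor]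

theorem push_whiskerLeft (x : H.obj a ≅ X) (y : H.obj b ≅ Y) (z : H.obj c ≅ Z) (f : a ⟶ b) :
    Z ◁ push x y f = push (tensor z x) (tensor z y) (c ◁ f) := by
  rw [← id_tensorHom, ← id_tensorHom, ← push_id z, push_tensor]

theorem push_associator (x : H.obj a ≅ X) (y : H.obj b ≅ Y) (z : H.obj c ≅ Z) :
    (α_ X Y Z).hom = push (tensor (tensor x y) z) (tensor x (tensor y z)) (α_ _ _ _).hom := by
  rw [eq_push_iff]
  simp only [tensor, Iso.trans_hom, Iso.symm_hom, Functor.Monoidal.μIso_inv, tensorIso_hom,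
    Category.assoc, ← whiskerRight_comp_tensorHom, ← whiskerLeft_comp_tensorHom,
    associator_naturality, Functor.OplaxMonoidal.associativity_assoc]

theorem push_leftUnitor (x : H.obj a ≅ X) :
    (λ_ X).hom = push (tensor (unit H) x) x (λ_ _).hom := by
  rw [eq_push_iff]
  simp [tensor, unit, MonoidalCategory.tensorHom_def]

theorem push_rightUnitor (x : H.obj a ≅ X) :
    (ρ_ X).hom = push (tensor x (unit H)) x (ρ_ _).hom := by
  rw [eq_push_iff]
  simp [tensor, unit, tensorHom_def']

theorem push_associator_inv (x : H.obj a ≅ X) (y : H.obj b ≅ Y) (z : H.obj c ≅ Z) :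
    (α_ X Y Z).inv = push (tensor x (tensor y z)) (tensor (tensor x y) z) (α_ _ _ _).inv :=
  push_eq_inv (push_associator x y z)

theorem push_leftUnitor_inv (x : H.obj a ≅ X) :
    (λ_ X).inv = push x (tensor (unit H) x) (λ_ _).inv :=
  push_eq_inv (push_leftUnitor x)

theorem push_rightUnitor_inv (x : H.obj a ≅ X) :
    (ρ_ X).inv = push x (tensor x (unit H)) (ρ_ _).inv :=
  push_eq_inv (push_rightUnitor x)

theorem Img.tensor {x : H.obj a ≅ X} {y : H.obj b ≅ Y} {z : H.obj c ≅ Z} {w : H.obj d ≅ W}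
    {f : X ⟶ Y} {g : Z ⟶ W} (hf : Img x y f) (hg : Img z w g) :
    Img (tensor x z) (tensor y w) (f ⊗ₘ g) := by
  obtain ⟨f, rfl⟩ := hf
  obtain ⟨g, rfl⟩ := hg
  exact ⟨_, push_tensor ..⟩

theorem Img.whiskerRight {x : H.obj a ≅ X} {y : H.obj b ≅ Y} {f : X ⟶ Y} (hf : Img x y f)
    (z : H.obj c ≅ Z) : Img (Rep.tensor x z) (Rep.tensor y z) (f ▷ Z) := by
  simpa using hf.tensor (img_id z)

theorem comp_tensor {E : Type u₂} [Category.{v₂} E] [MonoidalCategory E] {J : E ⥤ D}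
    [J.Monoidal] {e e' : E} (x : H.obj a ≅ X) (x' : J.obj e ≅ a) (y : H.obj b ≅ Y)
    (y' : J.obj e' ≅ b) : comp (tensor x y) (tensor x' y') = tensor (comp x x') (comp y y') := by
  ext
  simp [tensor, comp, ← tensorHom_comp_tensorHom]

theorem comp_unit {E : Type u₂} [Category.{v₂} E] [MonoidalCategory E] {J : E ⥤ D}
    [J.Monoidal] : comp (unit H) (unit J) = unit (J ⋙ H) := by
  ext
  simp [unit, comp]

end Monoidal

section Braided

variable {D : Type u₁} [Category.{v₁} D] [MonoidalCategory D] [BraidedCategory D]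
  {C : Type u₃} [Category.{v₃} C] [MonoidalCategory C] [BraidedCategory C]
  {H : D ⥤ C} [H.Braided] {a b c d : D} {X Y Z W : C}

theorem push_braiding (x : H.obj a ≅ X) (y : H.obj b ≅ Y) :
    (β_ X Y).hom = push (tensor x y) (tensor y x) (β_ _ _).hom := by
  rw [eq_push_iff]
  simp [tensor]

theorem push_tensorμ (x : H.obj a ≅ X) (y : H.obj b ≅ Y) (z : H.obj c ≅ Z) (w : H.obj d ≅ W) :
    tensorμ X Y Z W = push (tensor (tensor x y) (tensor z w)) (tensor (tensor x z) (tensor y w))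
      (tensorμ _ _ _ _) := by
  simp only [tensorμ, push_braiding y z, push_associator_inv y z w, push_associator z y w,
    push_associator_inv x z (tensor y w), push_associator x y (tensor z w),
    push_whiskerLeft _ _ x, push_whiskerRight _ _ w, push_comp]

end Braided

/-! ### Comonoids in the image of a cartesian category -/

section Cartesian

open CartesianMonoidalCategory SemiCartesianMonoidalCategory

variable {D : Type u₁} [Category.{v₁} D] [CartesianMonoidalCategory D] [BraidedCategory D]
  {C : Type u₃} [Category.{v₃} C] [MonoidalCategory C] [BraidedCategory C]
  {H : D ⥤ C} [H.Braided] {a b : D} {X Y : C}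

/-- Copying of an object in the image of a cartesian category. -/
def copy (x : H.obj a ≅ X) : X ⟶ X ⊗ X := push x (tensor x x) (lift (𝟙 _) (𝟙 _))

/-- Discarding of an object in the image of a cartesian category. -/
def discard (x : H.obj a ≅ X) : X ⟶ 𝟙_ C := push x (unit H) (toUnit _)

/-- In a cartesian category every morphism is a morphism of comonoids for the diagonals, and a
braided functor carries this along. It is the reason why a value of non-linear type may be
duplicated. -/
theorem Img.copy {x : H.obj a ≅ X} {y : H.obj b ≅ Y} {f : X ⟶ Y} (hf : Img x y f) :
    f ≫ Rep.copy y = Rep.copy x ≫ (f ⊗ₘ f) := by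
  obtain ⟨g, rfl⟩ := hf
  rw [Rep.copy, Rep.copy, push_tensor, push_comp, push_comp]
  congr 1
  ext <;> simp

theorem Img.discard {x : H.obj a ≅ X} {y : H.obj b ≅ Y} {f : X ⟶ Y} (hf : Img x y f) :
    f ≫ Rep.discard y = Rep.discard x := by
  obtain ⟨g, rfl⟩ := hf
  rw [Rep.discard, Rep.discard, push_comp]
  congr 1
  exact toUnit_unique _ _

/-- Both sides are images of maps into a product, compared projection by projection. With
`discard_tensor` this lets copying of a context be computed one variable at a time. -/
theorem copy_tensor (x : H.obj a ≅ X) (y : H.obj b ≅ Y) :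
    copy (tensor x y) = (copy x ⊗ₘ copy y) ≫ tensorμ X X Y Y := by
  rw [copy, copy, copy, push_tensor, push_tensorμ x x y y, push_comp]
  congr 1
  ext <;> simp

theorem discard_tensor (x : H.obj a ≅ X) (y : H.obj b ≅ Y) :
    discard (tensor x y) = (discard x ⊗ₘ discard y) ≫ (λ_ _).hom := by
  rw [discard, discard, discard, push_tensor, push_leftUnitor (unit H), push_comp]
  congr 1
  exact toUnit_unique _ _

theorem copy_unit : copy (unit H) = (λ_ (𝟙_ C)).inv := by
  rw [copy, push_leftUnitor_inv (unit H)]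
  congr 1
  ext

theorem discard_unit : discard (unit H) = 𝟙 (𝟙_ C) := by
  rw [discard, ← push_id (unit H)]
  congr 1
  exact toUnit_unique _ _

@[simp]
theorem copy_discard_left (x : H.obj a ≅ X) : copy x ≫ discard x ▷ X = (λ_ X).inv := by
  rw [copy, discard, push_whiskerRight _ _ x, push_leftUnitor_inv x, push_comp]
  congr 1
  ext; simp

@[simp]
theorem copy_discard_right (x : H.obj a ≅ X) : copy x ≫ X ◁ discard x = (ρ_ X).inv := by
  rw [copy, discard, push_whiskerLeft _ _ x, push_rightUnitor_inv x, push_comp]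
  congr 1
  ext; simp

@[simp]
theorem copy_braiding (x : H.obj a ≅ X) : copy x ≫ (β_ X X).hom = copy x := by
  rw [copy, push_braiding x x, push_comp]
  congr 1
  ext <;> simp

theorem copy_assoc (x : H.obj a ≅ X) :
    copy x ≫ copy x ▷ X ≫ (α_ X X X).hom = copy x ≫ X ◁ copy x := by
  rw [copy, push_whiskerRight _ _ x, push_whiskerLeft _ _ x, push_associator x x x, push_comp,
    push_comp, push_comp]
  congr 1
  ext <;> simp

theorem img_copy {x : H.obj a ≅ X} : Img x (tensor x x) (Rep.copy x) := img_push ..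

theorem img_discard {x : H.obj a ≅ X} : Img x (unit H) (Rep.discard x) := img_push ..

end Cartesian

end Rep

/-! ## Discarding and sharing of variables -/

/-- The types whose variables may be discarded. -/
def Disc : Calculus → Ty → Prop
  | .linear, A => A.NonLinear
  | .affine, _ => True

theorem Ty.NonLinear.disc {P : Ty} (h : P.NonLinear) : (c : Calculus) → Disc c P
  | .linear => h
  | .affine => trivial

/-- `OptDrop c o' o`: the entry `o'` is `o`, or `o` is discarded. -/
inductive OptDrop (c : Calculus) : Option Ty → Option Ty → Type
  | keep (o : Option Ty) : OptDrop c o o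
  | drop (A : Ty) (h : Disc c A) : OptDrop c none (some A)

/-- `OptShare c o₁ o₂ o`: the entry `o` is discarded, passed to one of two contexts, or shared. -/
inductive OptShare (c : Calculus) : Option Ty → Option Ty → Option Ty → Type
  | none : OptShare c none none none
  | drop (A : Ty) (h : Disc c A) : OptShare c none none (some A)
  | left (A : Ty) : OptShare c (some A) none (some A)
  | right (A : Ty) : OptShare c none (some A) (some A)
  | both (A : Ty) (h : A.NonLinear) : OptShare c (some A) (some A) (some A)

/-- `Drop c Γ' Γ`: the context `Γ'` arises from `Γ` by discarding variables. -/
inductive Drop (c : Calculus) : Ctx → Ctx → Type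
  | nil : Drop c [] []
  | cons {o' o : Option Ty} {Γ' Γ : Ctx} :
      OptDrop c o' o → Drop c Γ' Γ → Drop c (o' :: Γ') (o :: Γ)

/-- `Share c Γ₁ Γ₂ Θ`: the variables of `Θ` are discarded, passed to one of `Γ₁`, `Γ₂`, or shared. -/
inductive Share (c : Calculus) : Ctx → Ctx → Ctx → Type
  | nil : Share c [] [] []
  | cons {o₁ o₂ o : Option Ty} {Γ₁ Γ₂ Θ : Ctx} :
      OptShare c o₁ o₂ o → Share c Γ₁ Γ₂ Θ → Share c (o₁ :: Γ₁) (o₂ :: Γ₂) (o :: Θ)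

/-- The contexts all of whose variables may be discarded. -/
def DiscCtx (c : Calculus) : Ctx → Prop
  | [] => True
  | none :: Γ => DiscCtx c Γ
  | some A :: Γ => DiscCtx c Γ ∧ Disc c A

theorem discCtx_affine : (Γ : Ctx) → DiscCtx .affine Γ
  | [] => trivial
  | none :: Γ => discCtx_affine Γ
  | some _ :: Γ => ⟨discCtx_affine Γ, trivial⟩

theorem nonLinear_of_discCtx : {Γ : Ctx} → DiscCtx .linear Γ → Γ.NonLinear
  | [], _ => trivial
  | none :: Γ, h => nonLinear_of_discCtx (Γ := Γ) h
  | some _ :: Γ, h => ⟨nonLinear_of_discCtx (Γ := Γ) h.1, h.2⟩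

theorem Ctx.NonLinear.discCtx : {Γ : Ctx} → Γ.NonLinear → (c : Calculus) → DiscCtx c Γ
  | [], _, _ => trivial
  | none :: Γ, h, c => Ctx.NonLinear.discCtx (Γ := Γ) h c
  | some _ :: Γ, h, c => ⟨Ctx.NonLinear.discCtx (Γ := Γ) h.1 c, h.2.disc c⟩

/-! ### Operations on discardings and distributions of variables -/

variable {c : Calculus}

/-- The contexts determine the discarding or distribution between them. Laws can therefore be stated
for arbitrary composites with the right contexts, without computing any of them. -/
instance {o' o : Option Ty} : Subsingleton (OptDrop c o' o) :=
  ⟨fun x y => by cases x <;> cases y <;> rfl⟩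

instance {o₁ o₂ o : Option Ty} : Subsingleton (OptShare c o₁ o₂ o) :=
  ⟨fun x y => by cases x <;> cases y <;> rfl⟩

instance {Γ' Γ : Ctx} : Subsingleton (Drop c Γ' Γ) :=
  ⟨fun x y => by
    induction x with
    | nil => cases y; rfl
    | cons e x ih => cases y with | cons e' y => rw [ih y, Subsingleton.elim e e']⟩

instance {Γ₁ Γ₂ Θ : Ctx} : Subsingleton (Share c Γ₁ Γ₂ Θ) :=
  ⟨fun x y => by
    induction x with
    | nil => cases y; rfl
    | cons e x ih => cases y with | cons e' y => rw [ih y, Subsingleton.elim e e']⟩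

def OptDrop.comp : {o'' o' o : Option Ty} → OptDrop c o'' o' → OptDrop c o' o → OptDrop c o'' o
  | _, _, _, .keep _, e => e
  | _, _, _, e, .keep _ => e

def OptShare.dropBoth : {o₁ o₂ o o₁' o₂' : Option Ty} → OptShare c o₁ o₂ o → OptDrop c o₁' o₁ →
    OptDrop c o₂' o₂ → OptShare c o₁' o₂' o
  | _, _, _, _, _, l, .keep _, .keep _ => l
  | _, _, _, _, _, .left A, .drop _ h, .keep _ => .drop A h
  | _, _, _, _, _, .right A, .keep _, .drop _ h => .drop A h
  | _, _, _, _, _, .both A _, .keep _, .drop _ _ => .left A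
  | _, _, _, _, _, .both A _, .drop _ _, .keep _ => .right A
  | _, _, _, _, _, .both A _, .drop _ h, .drop _ _ => .drop A h

def OptShare.dropFirst : {o₁ o₂ o o' : Option Ty} → OptDrop c o' o → OptShare c o₁ o₂ o' →
    OptShare c o₁ o₂ o
  | _, _, _, _, .keep _, l => l
  | _, _, _, _, .drop A h, .none => .drop A h

def OptShare.swap : {o₁ o₂ o : Option Ty} → OptShare c o₁ o₂ o → OptShare c o₂ o₁ o
  | _, _, _, .none => .none
  | _, _, _, .drop A h => .drop A h
  | _, _, _, .left A => .right A
  | _, _, _, .right A => .left A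
  | _, _, _, .both A h => .both A h

/-- The entry of the union of the contexts with entries `o₁`, `o₂`. -/
def optJoin : Option Ty → Option Ty → Option Ty
  | none, o => o
  | some A, _ => some A

/-- The union of two contexts. -/
def join : Ctx → Ctx → Ctx
  | o₁ :: Γ₁, o₂ :: Γ₂ => optJoin o₁ o₂ :: join Γ₁ Γ₂
  | _, _ => []

/-- With `OptShare.dropJoin`: every distribution factors as discarding what neither side receives,
followed by a distribution of the union that discards nothing. -/
def OptShare.join : {o₁ o₂ o : Option Ty} → OptShare c o₁ o₂ o → OptShare c o₁ o₂ (optJoin o₁ o₂)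
  | _, _, _, .none => .none
  | _, _, _, .drop _ _ => .none
  | _, _, _, .left A => .left A
  | _, _, _, .right A => .right A
  | _, _, _, .both A h => .both A h

def OptShare.dropJoin : {o₁ o₂ o : Option Ty} → OptShare c o₁ o₂ o → OptDrop c (optJoin o₁ o₂) o
  | _, _, _, .none => .keep _
  | _, _, _, .drop A h => .drop A h
  | _, _, _, .left _ => .keep _
  | _, _, _, .right _ => .keep _
  | _, _, _, .both _ _ => .keep _

/-- The intermediate entry of a regrouped distribution could retain a variable that is discarded
later; taking the union of `o₄` and `o₂` makes all discarding happen in the outer step. -/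
def OptShare.assocOuter : {o₁ o₂ o o₃ o₄ : Option Ty} → OptShare c o₁ o₂ o → OptShare c o₃ o₄ o₁ →
    OptShare c o₃ (optJoin o₄ o₂) o
  | _, _, _, _, _, .none, .none => .none
  | _, _, _, _, _, .drop A h, .none => .drop A h
  | _, _, _, _, _, .left A, .drop _ h => .drop A h
  | _, _, _, _, _, .left A, .left _ => .left A
  | _, _, _, _, _, .left A, .right _ => .right A
  | _, _, _, _, _, .left A, .both _ h => .both A h
  | _, _, _, _, _, .right A, .none => .right A
  | _, _, _, _, _, .both A _, .drop _ _ => .right A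
  | _, _, _, _, _, .both A h, .left _ => .both A h
  | _, _, _, _, _, .both A _, .right _ => .right A
  | _, _, _, _, _, .both A h, .both _ _ => .both A h

def OptShare.assocInner : {o₁ o₂ o o₃ o₄ : Option Ty} → OptShare c o₁ o₂ o → OptShare c o₃ o₄ o₁ →
    OptShare c o₄ o₂ (optJoin o₄ o₂)
  | _, _, _, _, _, .none, .none => .none
  | _, _, _, _, _, .drop _ _, .none => .none
  | _, _, _, _, _, .left _, .drop _ _ => .none
  | _, _, _, _, _, .left _, .left _ => .none
  | _, _, _, _, _, .left A, .right _ => .left A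
  | _, _, _, _, _, .left A, .both _ _ => .left A
  | _, _, _, _, _, .right A, .none => .right A
  | _, _, _, _, _, .both A _, .drop _ _ => .right A
  | _, _, _, _, _, .both A _, .left _ => .right A
  | _, _, _, _, _, .both A h, .right _ => .both A h
  | _, _, _, _, _, .both A h, .both _ _ => .both A h

def Drop.refl : (Γ : Ctx) → Drop c Γ Γ
  | [] => .nil
  | o :: Γ => .cons (.keep o) (Drop.refl Γ)

def Drop.comp : {Γ'' Γ' Γ : Ctx} → Drop c Γ'' Γ' → Drop c Γ' Γ → Drop c Γ'' Γ
  | _, _, _, .nil, .nil => .nil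
  | _, _, _, .cons e d, .cons e' d' => .cons (e.comp e') (d.comp d')

namespace Share

def dropBoth : {Γ₁ Γ₂ Θ Γ₁' Γ₂' : Ctx} → Share c Γ₁ Γ₂ Θ → Drop c Γ₁' Γ₁ → Drop c Γ₂' Γ₂ →
    Share c Γ₁' Γ₂' Θ
  | _, _, _, _, _, .nil, .nil, .nil => .nil
  | _, _, _, _, _, .cons l g, .cons e₁ d₁, .cons e₂ d₂ => .cons (l.dropBoth e₁ e₂) (g.dropBoth d₁ d₂)

def dropFirst : {Γ₁ Γ₂ Θ Θ' : Ctx} → Drop c Θ' Θ → Share c Γ₁ Γ₂ Θ' → Share c Γ₁ Γ₂ Θ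
  | _, _, _, _, .nil, .nil => .nil
  | _, _, _, _, .cons e d, .cons l g => .cons (.dropFirst e l) (.dropFirst d g)

def swap : {Γ₁ Γ₂ Θ : Ctx} → Share c Γ₁ Γ₂ Θ → Share c Γ₂ Γ₁ Θ
  | _, _, _, .nil => .nil
  | _, _, _, .cons l g => .cons l.swap g.swap

def join : {Γ₁ Γ₂ Θ : Ctx} → Share c Γ₁ Γ₂ Θ → Share c Γ₁ Γ₂ (join Γ₁ Γ₂)
  | _, _, _, .nil => .nil
  | _, _, _, .cons l g => .cons l.join g.join

def dropJoin : {Γ₁ Γ₂ Θ : Ctx} → Share c Γ₁ Γ₂ Θ → Drop c (SubLambda.join Γ₁ Γ₂) Θ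
  | _, _, _, .nil => .nil
  | _, _, _, .cons l g => .cons l.dropJoin g.dropJoin

def assocOuter : {Γ₁ Γ₂ Θ Γ₃ Γ₄ : Ctx} → Share c Γ₁ Γ₂ Θ → Share c Γ₃ Γ₄ Γ₁ →
    Share c Γ₃ (SubLambda.join Γ₄ Γ₂) Θ
  | _, _, _, _, _, .nil, .nil => .nil
  | _, _, _, _, _, .cons l g, .cons l' g' => .cons (l.assocOuter l') (g.assocOuter g')

def assocInner : {Γ₁ Γ₂ Θ Γ₃ Γ₄ : Ctx} → Share c Γ₁ Γ₂ Θ → Share c Γ₃ Γ₄ Γ₁ →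
    Share c Γ₄ Γ₂ (SubLambda.join Γ₄ Γ₂)
  | _, _, _, _, _, .nil, .nil => .nil
  | _, _, _, _, _, .cons l g, .cons l' g' => .cons (l.assocInner l') (g.assocInner g')

theorem join_nonLinear : {Γ₁ Γ₂ Θ : Ctx} → Share c Γ₁ Γ₂ Θ → Γ₁.NonLinear → Γ₂.NonLinear →
    (SubLambda.join Γ₁ Γ₂).NonLinear
  | _, _, _, .nil, _, _ => trivial
  | _, _, _, .cons .none g, h₁, h₂ => (join_nonLinear g h₁ h₂ :)
  | _, _, _, .cons (.drop _ _) g, h₁, h₂ => (join_nonLinear g h₁ h₂ :)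
  | _, _, _, .cons (.left _) g, h₁, h₂ => ⟨join_nonLinear g h₁.1 h₂, h₁.2⟩
  | _, _, _, .cons (.right _) g, h₁, h₂ => ⟨join_nonLinear g h₁ h₂.1, h₂.2⟩
  | _, _, _, .cons (.both _ _) g, h₁, h₂ => ⟨join_nonLinear g h₁.1 h₂.1, h₁.2⟩

/-- Sharing of a whole non-linear context. -/
def diag : {Φ : Ctx} → Φ.NonLinear → Share c Φ Φ Φ
  | [], _ => .nil
  | none :: Φ, h => .cons .none (diag (Φ := Φ) h)
  | some P :: Φ, h => .cons (.both P h.2) (diag (Φ := Φ) h.1)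

def ofUnion : {Γ Δ Θ : Ctx} → Union Γ Δ Θ → Share c Γ Δ Θ
  | _, _, _, .nil => .nil
  | _, _, _, .skip u => .cons .none (ofUnion u)
  | _, _, _, .inl A u => .cons (.left A) (ofUnion u)
  | _, _, _, .inr A u => .cons (.right A) (ofUnion u)

/-- Discarding the second of two contexts. -/
def dropSnd : {Γ₁ Γ₂ Θ : Ctx} → Share c Γ₁ Γ₂ Θ → DiscCtx c Γ₂ → Drop c Γ₁ Θ
  | _, _, _, .nil, _ => .nil
  | _, _, _, .cons .none g, h => .cons (.keep _) (dropSnd g h)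
  | _, _, _, .cons (.drop A h') g, h => .cons (.drop A h') (dropSnd g h)
  | _, _, _, .cons (.left _) g, h => .cons (.keep _) (dropSnd g h)
  | _, _, _, .cons (.right A) g, h => .cons (.drop A h.2) (dropSnd g h.1)
  | _, _, _, .cons (.both _ _) g, h => .cons (.keep _) (dropSnd g h.1)

end Share

theorem Drop.discCtx : {Γ' Γ : Ctx} → Drop c Γ' Γ → DiscCtx c Γ' → DiscCtx c Γ
  | _, _, .nil, _ => trivial
  | _, _, .cons (.keep none) d, h => (Drop.discCtx d h :)
  | _, _, .cons (.keep (some _)) d, h => ⟨Drop.discCtx d h.1, h.2⟩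
  | _, _, .cons (.drop _ h') d, h => ⟨Drop.discCtx d h, h'⟩

theorem Drop.nonLinear : {Γ' Γ : Ctx} → Drop c Γ' Γ → Γ.NonLinear → Γ'.NonLinear
  | _, _, .nil, _ => trivial
  | _, _, .cons (.keep none) d, h => (Drop.nonLinear d h :)
  | _, _, .cons (.keep (some _)) d, h => ⟨Drop.nonLinear d h.1, h.2⟩
  | _, _, .cons (.drop _ _) d, h => (Drop.nonLinear d h.1 :)

/-! ### Monoidal identities for distributions -/

section Monoidal

variable {C : Type u₃} [Category.{v₃} C] [MonoidalCategory C]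

theorem tensorμ_braiding [SymmetricCategory C] (X₁ X₂ Y₁ Y₂ : C) :
    tensorμ X₁ X₂ Y₁ Y₂ ≫ (β_ (X₁ ⊗ Y₁) (X₂ ⊗ Y₂)).hom =
      ((β_ X₁ X₂).hom ⊗ₘ (β_ Y₁ Y₂).hom) ≫ tensorμ X₂ X₁ Y₂ Y₁ := by
  simp [tensorμ, SymmetricCategory.braiding_swap_eq_inv_braiding Y₁ X₂,
    MonoidalCategory.tensorHom_def]

/-- Coassociativity survives replacing each object by an isomorphic one. It is applied to `consIso`,
which lets declared and undeclared entries be treated alike. -/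
theorem iso_conj_assoc {X X₁ X₂ X₃ X₄ X' Y Y₁ Y₂ Y₃ Y₄ Y' : C} (i : X ≅ Y) (i₁ : X₁ ≅ Y₁)
    (i₂ : X₂ ≅ Y₂) (i₃ : X₃ ≅ Y₃) (i₄ : X₄ ≅ Y₄) (i' : X' ≅ Y')
    {p : Y ⟶ Y₁ ⊗ Y₂} {p₁ : Y₁ ⟶ Y₃ ⊗ Y₄} {p' : Y ⟶ Y₃ ⊗ Y'} {p₂ : Y' ⟶ Y₄ ⊗ Y₂}
    (h : p ≫ p₁ ▷ Y₂ ≫ (α_ _ _ _).hom = p' ≫ Y₃ ◁ p₂) :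
    (i.hom ≫ p ≫ (i₁.inv ⊗ₘ i₂.inv)) ≫ (i₁.hom ≫ p₁ ≫ (i₃.inv ⊗ₘ i₄.inv)) ▷ X₂ ≫ (α_ _ _ _).hom =
      (i.hom ≫ p' ≫ (i₃.inv ⊗ₘ i'.inv)) ≫ X₃ ◁ (i'.hom ≫ p₂ ≫ (i₄.inv ⊗ₘ i₂.inv)) := by
  simp only [← tensorHom_id, ← id_tensorHom, tensorHom_comp_tensorHom_assoc, Category.assoc,
    tensorHom_comp_tensorHom, Iso.inv_hom_id_assoc, Category.comp_id]
  simp only [← whiskerRight_comp_tensorHom, ← whiskerLeft_comp_tensorHom, Category.assoc,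
    associator_naturality, reassoc_of% h]

variable [BraidedCategory C]

/-- The argument that a tensor product of coalgebras in a braided category is coassociative, with
the objects allowed to vary: `tensorμ` is natural and compatible with associators. -/
theorem tensorHom_tensorμ_assoc {X Y X₁ X₂ X₃ X₄ X' Y₁ Y₂ Y₃ Y₄ Y' : C}
    {f : X ⟶ X₁ ⊗ X₂} {f₁ : X₁ ⟶ X₃ ⊗ X₄} {f' : X ⟶ X₃ ⊗ X'} {f₂ : X' ⟶ X₄ ⊗ X₂}
    {l : Y ⟶ Y₁ ⊗ Y₂} {l₁ : Y₁ ⟶ Y₃ ⊗ Y₄} {l' : Y ⟶ Y₃ ⊗ Y'} {l₂ : Y' ⟶ Y₄ ⊗ Y₂}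
    (hf : f ≫ f₁ ▷ X₂ ≫ (α_ _ _ _).hom = f' ≫ X₃ ◁ f₂)
    (hl : l ≫ l₁ ▷ Y₂ ≫ (α_ _ _ _).hom = l' ≫ Y₃ ◁ l₂) :
    ((f ⊗ₘ l) ≫ tensorμ _ _ _ _) ≫ ((f₁ ⊗ₘ l₁) ≫ tensorμ _ _ _ _) ▷ (X₂ ⊗ Y₂) ≫ (α_ _ _ _).hom =
      ((f' ⊗ₘ l') ≫ tensorμ _ _ _ _) ≫ (X₃ ⊗ Y₃) ◁ ((f₂ ⊗ₘ l₂) ≫ tensorμ _ _ _ _) := by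
  have h₁ : tensorμ X₁ X₂ Y₁ Y₂ ≫ (f₁ ⊗ₘ l₁) ▷ (X₂ ⊗ Y₂) =
      (f₁ ▷ X₂ ⊗ₘ l₁ ▷ Y₂) ≫ tensorμ (X₃ ⊗ X₄) X₂ (Y₃ ⊗ Y₄) Y₂ := by
    simpa using (tensorμ_natural f₁ (𝟙 X₂) l₁ (𝟙 Y₂)).symm
  have h₂ : tensorμ X₃ X' Y₃ Y' ≫ (X₃ ⊗ Y₃) ◁ (f₂ ⊗ₘ l₂) =
      (X₃ ◁ f₂ ⊗ₘ Y₃ ◁ l₂) ≫ tensorμ X₃ (X₄ ⊗ X₂) Y₃ (Y₄ ⊗ Y₂) := by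
    simpa using (tensorμ_natural (𝟙 X₃) f₂ (𝟙 Y₃) l₂).symm
  simp only [comp_whiskerRight, whiskerLeft_comp, Category.assoc, reassoc_of% h₁, reassoc_of% h₂,
    associator_monoidal, tensorHom_comp_tensorHom_assoc, hf, hl]

end Monoidal

/-! ### Interpretation of discardings and distributions -/

noncomputable section

namespace LinearModel

variable {B : Type u₁} [Category.{v₁} B] [CartesianMonoidalCategory B]
  [BraidedCategory B] [HasFiniteCoproducts B]
  {V : Type u₂} [Category.{v₂} V] [MonoidalCategory V] [SymmetricCategory V]
  [HasFiniteCoproducts V]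
  {C : Type u₃} [Category.{v₃} C] [MonoidalCategory C] [SymmetricCategory C]
  [HasFiniteCoproducts C]
  (M : LinearModel B V C)

/-- `F⟦P⟧ ≅ ⟦P⟧`. -/
def tyIsoF (P : Ty) (h : P.NonLinear) : M.F.obj (M.tyB P h) ≅ M.tyC P :=
  Rep.comp (M.tyIsoC P) (M.tyIsoV P h)

/-- Discarding `⟦A⟧ ⟶ I`. -/
def discTy : {c : Calculus} → M.Supports c → (A : Ty) → Disc c A → (M.tyC A ⟶ 𝟙_ C)
  | .linear, _, A, h => Rep.discard (M.tyIsoF A h)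
  | .affine, t, A, _ => Rep.push (M.tyIsoC A) (Rep.unit M.L) (IsTerminal.from t (M.tyV A))

variable {c : Calculus} (t : M.Supports c)

/-- In an affine model a non-linear type has two candidate discarding maps, the `F`-image of the
terminal map and the `L`-image of the map to the terminal unit. The first is also an `L`-image, so
terminality makes them agree. -/
theorem discTy_of_nonLinear {P : Ty} (hP : P.NonLinear) (h : Disc c P) :
    M.discTy t P h = Rep.discard (M.tyIsoF P hP) := by
  cases c
  · rfl
  · have e := Rep.comp_unit (J := M.J) (H := M.L)
    rw [discTy, Rep.discard]
    erw [← e]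
    rw [tyIsoF, Rep.push_comp_rep]
    congr 1
    exact IsTerminal.hom_ext t _ _

theorem img_discTy (A : Ty) (h : Disc c A) :
    Rep.Img (M.tyIsoC A) (Rep.unit M.L) (M.discTy t A h) := by
  cases c
  · have e := Rep.comp_unit (J := M.J) (H := M.L)
    rw [discTy, Rep.discard]
    erw [← e]
    exact Rep.Img.of_comp (Rep.img_push ..)
  · exact Rep.img_push ..

/-- The interpretation of an entry of a context. -/
@[reducible] def optC : Option Ty → C
  | none => 𝟙_ C
  | some A => M.tyC A

/-- `⟦o :: Γ⟧ ≅ ⟦Γ⟧ ⊗ ⟦o⟧`. -/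
def consIso : (o : Option Ty) → (Γ : Ctx) → (M.ctxC (o :: Γ) ≅ M.ctxC Γ ⊗ M.optC o)
  | none, Γ => (ρ_ (M.ctxC Γ)).symm
  | some _, _ => Iso.refl _

def optDropMap : {o' o : Option Ty} → OptDrop c o' o → (M.optC o ⟶ M.optC o')
  | _, _, .keep _ => 𝟙 _
  | _, _, .drop A h => M.discTy t A h

def optShareMap : {o₁ o₂ o : Option Ty} → OptShare c o₁ o₂ o → (M.optC o ⟶ M.optC o₁ ⊗ M.optC o₂)
  | _, _, _, .none => (λ_ (𝟙_ C)).inv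
  | _, _, _, .drop A h => M.discTy t A h ≫ (λ_ (𝟙_ C)).inv
  | _, _, _, .left _ => (ρ_ _).inv
  | _, _, _, .right _ => (λ_ _).inv
  | _, _, _, .both A h => Rep.copy (M.tyIsoF A h)

/-- Discarding of some of the variables of a context. -/
def dropMap : {Γ' Γ : Ctx} → Drop c Γ' Γ → (M.ctxC Γ ⟶ M.ctxC Γ')
  | _, _, .nil => 𝟙 _
  | _, _, .cons (o' := o') (o := o) (Γ' := Γ') (Γ := Γ) e d =>
      (M.consIso o Γ).hom ≫ (dropMap d ⊗ₘ M.optDropMap t e) ≫ (M.consIso o' Γ').inv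

/-- Distribution of the variables of a context over two contexts. -/
def shareMap : {Γ₁ Γ₂ Θ : Ctx} → Share c Γ₁ Γ₂ Θ → (M.ctxC Θ ⟶ M.ctxC Γ₁ ⊗ M.ctxC Γ₂)
  | _, _, _, .nil => (λ_ (𝟙_ C)).inv
  | _, _, _, .cons (o₁ := o₁) (o₂ := o₂) (o := o) (Γ₁ := Γ₁) (Γ₂ := Γ₂) (Θ := Θ) l g =>
      (M.consIso o Θ).hom ≫ ((shareMap g ⊗ₘ M.optShareMap t l) ≫ tensorμ _ _ _ _) ≫
        ((M.consIso o₁ Γ₁).inv ⊗ₘ (M.consIso o₂ Γ₂).inv)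

/-- Discarding of all variables of a context. -/
def discMap : (Γ : Ctx) → DiscCtx c Γ → (M.ctxC Γ ⟶ 𝟙_ C)
  | [], _ => 𝟙 _
  | none :: Γ, h => discMap Γ h
  | some A :: Γ, h => (discMap Γ h.1 ⊗ₘ M.discTy t A h.2) ≫ (λ_ (𝟙_ C)).hom

@[simp]
theorem copy_discTy_right {P : Ty} (hP : P.NonLinear) (h : Disc c P) :
    Rep.copy (M.tyIsoF P hP) ≫ M.tyC P ◁ M.discTy t P h = (ρ_ _).inv := by
  rw [M.discTy_of_nonLinear t hP, Rep.copy_discard_right]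

@[simp]
theorem copy_discTy_left {P : Ty} (hP : P.NonLinear) (h : Disc c P) :
    Rep.copy (M.tyIsoF P hP) ≫ M.discTy t P h ▷ M.tyC P = (λ_ _).inv := by
  rw [M.discTy_of_nonLinear t hP, Rep.copy_discard_left]

theorem copy_discTy_discTy {P : Ty} (hP : P.NonLinear) (h : Disc c P) :
    Rep.copy (M.tyIsoF P hP) ≫ (M.discTy t P h ⊗ₘ M.discTy t P h) =
      M.discTy t P h ≫ (λ_ (𝟙_ C)).inv := by
  rw [M.discTy_of_nonLinear t hP, ← Rep.copy_unit (H := M.F)]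
  exact (Rep.img_discard.copy).symm

/-- This and the following laws are checked on single entries by running through all cases, and then
lifted to contexts by induction. -/
theorem optDropMap_comp {o'' o' o : Option Ty} (e' : OptDrop c o'' o') (e : OptDrop c o' o)
    (e'' : OptDrop c o'' o) : M.optDropMap t e ≫ M.optDropMap t e' = M.optDropMap t e'' := by
  cases e <;> cases e' <;> cases e'' <;> simp [optDropMap]

theorem optShareMap_dropBoth {o₁ o₂ o o₁' o₂' : Option Ty} (l : OptShare c o₁ o₂ o)
    (e₁ : OptDrop c o₁' o₁) (e₂ : OptDrop c o₂' o₂) (l' : OptShare c o₁' o₂' o) :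
    M.optShareMap t l ≫ (M.optDropMap t e₁ ⊗ₘ M.optDropMap t e₂) = M.optShareMap t l' := by
  cases l <;> cases e₁ <;> cases e₂ <;> cases l' <;> simp [optDropMap, optShareMap, copy_discTy_discTy, unitors_inv_equal]

theorem optDropMap_share {o₁ o₂ o o' : Option Ty} (e : OptDrop c o' o)
    (l : OptShare c o₁ o₂ o') (l' : OptShare c o₁ o₂ o) :
    M.optDropMap t e ≫ M.optShareMap t l = M.optShareMap t l' := by
  cases e <;> cases l <;> cases l' <;> simp [optDropMap, optShareMap]

theorem optShareMap_swap {o₁ o₂ o : Option Ty} (l : OptShare c o₁ o₂ o) (l' : OptShare c o₂ o₁ o) :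
    M.optShareMap t l ≫ (β_ _ _).hom = M.optShareMap t l' := by
  cases l <;> cases l' <;> simp [optShareMap]
  all_goals monoidal

/-- A variable that reaches all three targets gives coassociativity of copying; one that is copied
and then discarded gives a counit law; the other cases are monoidal coherence. -/
theorem optShareMap_assoc {o₁ o₂ o o₃ o₄ o' : Option Ty} (g : OptShare c o₁ o₂ o)
    (g₁ : OptShare c o₃ o₄ o₁) (g' : OptShare c o₃ o' o) (g₂ : OptShare c o₄ o₂ o') :
    M.optShareMap t g ≫ M.optShareMap t g₁ ▷ _ ≫ (α_ _ _ _).hom =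
      M.optShareMap t g' ≫ _ ◁ M.optShareMap t g₂ := by
  cases g <;> cases g₁ <;> cases g' <;> cases g₂ <;> simp [optShareMap, Rep.copy_assoc, reassoc_of% M.copy_discTy_left t,
    reassoc_of% M.copy_discTy_right t]
  all_goals monoidal

theorem dropMap_comp {Γ'' Γ' Γ : Ctx} (d' : Drop c Γ'' Γ') (d : Drop c Γ' Γ) (d'' : Drop c Γ'' Γ) :
    M.dropMap t d ≫ M.dropMap t d' = M.dropMap t d'' := by
  induction d generalizing Γ'' with
  | nil => cases d'; cases d''; simp [dropMap]
  | cons e d ih =>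
    cases d' with | cons e' d' =>
    cases d'' with | cons e'' d'' =>
    simp [dropMap, tensorHom_comp_tensorHom_assoc, ih d' d'', M.optDropMap_comp t e' e e'']

theorem dropMap_refl {Γ : Ctx} (d : Drop c Γ Γ) : M.dropMap t d = 𝟙 _ := by
  rw [Subsingleton.elim d (Drop.refl Γ)]
  clear d
  induction Γ with
  | nil => rfl
  | cons o Γ ih => simp [Drop.refl, dropMap, ih, optDropMap]

theorem shareMap_dropBoth {Γ₁ Γ₂ Θ Γ₁' Γ₂' : Ctx} (g : Share c Γ₁ Γ₂ Θ)
    (d₁ : Drop c Γ₁' Γ₁) (d₂ : Drop c Γ₂' Γ₂) (g' : Share c Γ₁' Γ₂' Θ) :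
    M.shareMap t g ≫ (M.dropMap t d₁ ⊗ₘ M.dropMap t d₂) = M.shareMap t g' := by
  induction g generalizing Γ₁' Γ₂' with
  | nil => cases d₁; cases d₂; cases g'; simp [dropMap]
  | cons l g ih =>
    cases d₁ with | cons e₁ d₁ =>
    cases d₂ with | cons e₂ d₂ =>
    cases g' with | cons l' g' =>
    simp only [shareMap, dropMap, ← ih d₁ d₂ g', ← M.optShareMap_dropBoth t l e₁ e₂ l',
      Category.assoc, tensorHom_comp_tensorHom, Iso.inv_hom_id_assoc]
    simp only [← tensorHom_comp_tensorHom, Category.assoc, tensorμ_natural_assoc]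

theorem dropMap_share {Γ₁ Γ₂ Θ Θ' : Ctx} (d : Drop c Θ' Θ) (g : Share c Γ₁ Γ₂ Θ')
    (g' : Share c Γ₁ Γ₂ Θ) : M.dropMap t d ≫ M.shareMap t g = M.shareMap t g' := by
  induction d generalizing Γ₁ Γ₂ with
  | nil => cases g; cases g'; simp [dropMap]
  | cons e d ih =>
    cases g with | cons l g =>
    cases g' with | cons l' g' =>
    simp [shareMap, dropMap, ← ih g g', ← M.optDropMap_share t e l l',
      tensorHom_comp_tensorHom_assoc]

theorem shareMap_swap {Γ₁ Γ₂ Θ : Ctx} (g : Share c Γ₁ Γ₂ Θ) (g' : Share c Γ₂ Γ₁ Θ) :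
    M.shareMap t g ≫ (β_ _ _).hom = M.shareMap t g' := by
  induction g with
  | nil => cases g'; simp [shareMap]; monoidal
  | cons l g ih =>
    cases g' with | cons l' g' =>
    simp only [shareMap, ← ih g', ← M.optShareMap_swap t l l', Category.assoc,
      BraidedCategory.braiding_naturality, reassoc_of% tensorμ_braiding,
      tensorHom_comp_tensorHom_assoc]

/-- The intermediate contexts `Γ₁` and `Γ'` are arbitrary, so the law also says that it does not
matter at which stage a variable is discarded. -/
theorem shareMap_assoc {Γ₁ Γ₂ Θ Γ₃ Γ₄ Γ' : Ctx} (g : Share c Γ₁ Γ₂ Θ) (g₁ : Share c Γ₃ Γ₄ Γ₁)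
    (g' : Share c Γ₃ Γ' Θ) (g₂ : Share c Γ₄ Γ₂ Γ') :
    M.shareMap t g ≫ M.shareMap t g₁ ▷ _ ≫ (α_ _ _ _).hom =
      M.shareMap t g' ≫ _ ◁ M.shareMap t g₂ := by
  induction g generalizing Γ₃ Γ₄ Γ' with
  | nil => cases g₁; cases g'; cases g₂; simp only [shareMap]; monoidal
  | cons l g ih =>
    cases g₁ with | cons l₁ g₁ =>
    cases g' with | cons l' g' =>
    cases g₂ with | cons l₂ g₂ =>
    have h := tensorHom_tensorμ_assoc (ih g₁ g' g₂) (M.optShareMap_assoc t l l₁ l' l₂)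
    exact iso_conj_assoc _ _ _ _ _ _ h

end LinearModel

end

/-! ### Contexts with at most one variable, and interchange of distributions -/

/-- The contexts that declare no variable. -/
def Ctx.Empty : Ctx → Prop
  | [] => True
  | none :: Γ => Ctx.Empty Γ
  | some _ :: _ => False

/-- `Single i A Γ`: the context `Γ` declares `xᵢ : A` and nothing else. -/
inductive Single : ℕ → Ty → Ctx → Type
  | zero (A : Ty) {Γ : Ctx} : Γ.Empty → Single 0 A (some A :: Γ)
  | succ {i : ℕ} {A : Ty} {Γ : Ctx} : Single i A Γ → Single (i + 1) A (none :: Γ)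

instance {i : ℕ} {A : Ty} {Γ : Ctx} : Subsingleton (Single i A Γ) :=
  ⟨fun x y => by
    induction x with
    | zero A h => cases y; rfl
    | succ x ih => cases y with | succ y => rw [ih y]⟩

theorem Ctx.Empty.nonLinear : {Γ : Ctx} → Γ.Empty → Γ.NonLinear
  | [], _ => trivial
  | none :: Γ, h => Ctx.Empty.nonLinear (Γ := Γ) h

theorem Single.nonLinear {i : ℕ} {P : Ty} {Γ : Ctx} (s : Single i P Γ) (h : P.NonLinear) :
    Γ.NonLinear := by
  induction s with
  | zero A e => exact ⟨e.nonLinear, h⟩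
  | succ s ih => exact ih h

section Monoidal

variable {C : Type u₃} [Category.{v₃} C] [MonoidalCategory C] [BraidedCategory C]

theorem tensorHom_tensorμ_discard {X Y X₁ X₂ Y₁ Y₂ : C} (f : X ⟶ X₁ ⊗ X₂) (l : Y ⟶ Y₁ ⊗ Y₂)
    (u : X₂ ⟶ 𝟙_ C) (v : Y₂ ⟶ 𝟙_ C) :
    ((f ⊗ₘ l) ≫ tensorμ _ _ _ _) ≫ (X₁ ⊗ Y₁) ◁ ((u ⊗ₘ v) ≫ (λ_ _).hom) ≫ (ρ_ _).hom =
      (f ≫ X₁ ◁ u ≫ (ρ_ _).hom) ⊗ₘ (l ≫ Y₁ ◁ v ≫ (ρ_ _).hom) := by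
  have h : tensorμ X₁ X₂ Y₁ Y₂ ≫ (X₁ ⊗ Y₁) ◁ (u ⊗ₘ v) =
      (X₁ ◁ u ⊗ₘ Y₁ ◁ v) ≫ tensorμ X₁ (𝟙_ C) Y₁ (𝟙_ C) := by
    simpa using (tensorμ_natural (𝟙 X₁) u (𝟙 Y₁) v).symm
  simp only [whiskerLeft_comp, Category.assoc, reassoc_of% h, ← rightUnitor_monoidal,
    tensorHom_comp_tensorHom]

omit [BraidedCategory C] in
theorem iso_conj_discard {X X₁ X₂ Y Y₁ Y₂ : C} (i : X ≅ Y) (i₁ : X₁ ≅ Y₁) (i₂ : X₂ ≅ Y₂)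
    (p : Y ⟶ Y₁ ⊗ Y₂) (w : Y₂ ⟶ 𝟙_ C) :
    (i.hom ≫ p ≫ (i₁.inv ⊗ₘ i₂.inv)) ≫ X₁ ◁ (i₂.hom ≫ w) ≫ (ρ_ _).hom =
      i.hom ≫ (p ≫ Y₁ ◁ w ≫ (ρ_ _).hom) ≫ i₁.inv := by
  simp only [← id_tensorHom, tensorHom_comp_tensorHom_assoc, Category.assoc, Category.comp_id,
    Iso.inv_hom_id_assoc]
  simp [tensorHom_def']

end Monoidal

noncomputable section

namespace LinearModel

variable {B : Type u₁} [Category.{v₁} B] [CartesianMonoidalCategory B]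
  [BraidedCategory B] [HasFiniteCoproducts B]
  {V : Type u₂} [Category.{v₂} V] [MonoidalCategory V] [SymmetricCategory V]
  [HasFiniteCoproducts V]
  {C : Type u₃} [Category.{v₃} C] [MonoidalCategory C] [SymmetricCategory C]
  [HasFiniteCoproducts C]
  (M : LinearModel B V C) {c : Calculus} (t : M.Supports c)

theorem shareMap_dropRight {Γ₁ Γ₂ Θ Γ₂' : Ctx} (g : Share c Γ₁ Γ₂ Θ) (d : Drop c Γ₂' Γ₂)
    (g' : Share c Γ₁ Γ₂' Θ) : M.shareMap t g ≫ _ ◁ M.dropMap t d = M.shareMap t g' := by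
  rw [← M.shareMap_dropBoth t g (Drop.refl _) d g', dropMap_refl, id_tensorHom]

/-- By coassociativity and cocommutativity both sides reduce to one nested distribution: `Γ₁₁` is
split off first, then `Γ₂₁`, and the rest is distributed over `Γ₁₂` and `Γ₂₂`. -/
theorem shareMap_interchange {Γ₁ Γ₂ Θ Γ₁₁ Γ₁₂ Γ₂₁ Γ₂₂ Δ₁ Δ₂ : Ctx} (g : Share c Γ₁ Γ₂ Θ)
    (g₁ : Share c Γ₁₁ Γ₁₂ Γ₁) (g₂ : Share c Γ₂₁ Γ₂₂ Γ₂) (h : Share c Δ₁ Δ₂ Θ)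
    (h₁ : Share c Γ₁₁ Γ₂₁ Δ₁) (h₂ : Share c Γ₁₂ Γ₂₂ Δ₂) :
    M.shareMap t g ≫ (M.shareMap t g₁ ⊗ₘ M.shareMap t g₂) ≫ tensorμ _ _ _ _ =
      M.shareMap t h ≫ (M.shareMap t h₁ ⊗ₘ M.shareMap t h₂) := by
  let a := g.assocOuter g₁
  let b := g.assocInner g₁
  let p := (b.swap.assocOuter g₂.swap).swap
  let q := b.swap.assocInner g₂.swap
  let r := p.assocOuter q
  let u := p.assocInner q
  let a' := h.assocOuter h₁
  let b' := h.assocInner h₁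
  -- `Δ₂` may contain variables that neither `Γ₁₂` nor `Γ₂₂` receives. Cutting it down to the union
  -- of these two makes the targets of `b''` equal to those of `r`.
  let b'' := b'.dropBoth (Drop.refl _) h₂.dropJoin
  have e₁ := M.shareMap_assoc t g g₁ a b
  have e₂ := M.shareMap_assoc t p q.swap b g₂
  have e₃ := M.shareMap_assoc t p q r u
  have e₄ := M.shareMap_assoc t h h₁ a' b'
  have e₅ := M.dropMap_share t h₂.dropJoin u h₂
  have e₆ := M.shareMap_dropRight t b' h₂.dropJoin b''
  have e₇ := M.dropMap_share t b''.dropJoin b''.join b''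
  have e₈ := M.dropMap_share t r.dropJoin b''.join r
  have e₉ := M.shareMap_dropRight t a r.dropJoin (a.dropBoth (Drop.refl _) r.dropJoin)
  have e₁₀ := M.shareMap_dropRight t a' b''.dropJoin (a.dropBoth (Drop.refl _) r.dropJoin)
  have e₁₁ := M.shareMap_swap t q.swap q
  have f₁ : M.shareMap t b ≫ _ ◁ M.shareMap t g₂ ≫ (α_ _ _ _).inv ≫ (β_ _ _).hom ▷ _ ≫
      (α_ _ _ _).hom = M.shareMap t r ≫ _ ◁ M.shareMap t u := by
    rw [← reassoc_of% e₂, Iso.hom_inv_id_assoc, ← comp_whiskerRight_assoc, e₁₁, e₃]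
  have f₂ : M.shareMap t b' ≫ _ ◁ M.shareMap t h₂ = M.shareMap t b'' ≫ _ ◁ M.shareMap t u := by
    rw [← e₅, whiskerLeft_comp, reassoc_of% e₆]
  rw [← cancel_mono (α_ _ _ _).hom, tensorμ]
  simp only [MonoidalCategory.tensorHom_def, Category.assoc, Iso.inv_hom_id, Category.comp_id,
    tensor_whiskerLeft, Iso.inv_hom_id_assoc, reassoc_of% e₁, reassoc_of% e₄]
  simp only [← whiskerLeft_comp, f₁, f₂, ← e₇, ← e₈, Category.assoc]
  simp only [whiskerLeft_comp, reassoc_of% e₉, reassoc_of% e₁₀]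

/-! ### Discarding -/

theorem dropMap_disc {Γ' Γ : Ctx} (d : Drop c Γ' Γ) (h' : DiscCtx c Γ') (h : DiscCtx c Γ) :
    M.dropMap t d ≫ M.discMap t Γ' h' = M.discMap t Γ h := by
  induction d with
  | nil => simp [dropMap, discMap]
  | @cons o' o Γ' Γ e d ih =>
    cases e with
    | keep =>
      cases o' with
      | none =>
        rw [discMap, discMap, ← ih h' h]
        simp [dropMap, consIso, optDropMap]
      | some A =>
        rw [discMap, discMap, ← ih h'.1 h.1]
        simp [dropMap, consIso, optDropMap, MonoidalCategory.tensorHom_def]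
    | drop A hA =>
      rw [discMap, discMap, ← ih h' h.1]
      simp [dropMap, consIso, optDropMap, MonoidalCategory.tensorHom_def', unitors_equal]

theorem shareMap_discSnd {Γ₁ Γ₂ Θ : Ctx} (g : Share c Γ₁ Γ₂ Θ) (h : DiscCtx c Γ₂)
    (d : Drop c Γ₁ Θ) : M.shareMap t g ≫ _ ◁ M.discMap t Γ₂ h ≫ (ρ_ _).hom = M.dropMap t d := by
  induction g with
  | nil => cases d; simp [shareMap, dropMap, discMap]; monoidal
  | @cons o₁ o₂ o Γ₁ Γ₂ Θ l g ih =>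
    cases d with | cons e d =>
    -- Discarding the second context splits into discarding its tail and discarding its first entry
    -- by `v`, where `v` is the identity of the unit if nothing is declared there. The counit law
    -- can then be proved separately for both factors.
    obtain ⟨h', v, hv, hl⟩ : ∃ (h' : DiscCtx c Γ₂) (v : M.optC o₂ ⟶ 𝟙_ C),
        M.discMap t (o₂ :: Γ₂) h =
          (M.consIso o₂ Γ₂).hom ≫ (M.discMap t Γ₂ h' ⊗ₘ v) ≫ (λ_ _).hom ∧
        M.optShareMap t l ≫ _ ◁ v ≫ (ρ_ _).hom = M.optDropMap t e := by
      cases o₂ with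
      | none =>
        refine ⟨h, 𝟙 _, by simp [consIso, discMap, unitors_equal], ?_⟩
        cases l <;> cases e <;> simp [optShareMap, optDropMap] <;> monoidal
      | some A =>
        refine ⟨h.1, M.discTy t A h.2, by simp [consIso, discMap], ?_⟩
        cases l <;> cases e <;> simp [optShareMap, optDropMap,
          reassoc_of% M.copy_discTy_right t]
        monoidal
    have k := tensorHom_tensorμ_discard (M.shareMap t g) (M.optShareMap t l) (M.discMap t Γ₂ h') v
    rw [ih h' d, hl] at k
    rw [shareMap, dropMap, hv, iso_conj_discard, k]

theorem shareMap_discFst {Γ₁ Γ₂ Θ : Ctx} (g : Share c Γ₁ Γ₂ Θ) (h : DiscCtx c Γ₁)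
    (d : Drop c Γ₂ Θ) : M.shareMap t g ≫ M.discMap t Γ₁ h ▷ _ ≫ (λ_ _).hom = M.dropMap t d := by
  rw [← M.shareMap_discSnd t g.swap h d, ← M.shareMap_swap t g g.swap, Category.assoc,
    ← BraidedCategory.braiding_naturality_left_assoc, braiding_rightUnitor]

/-! ### Comparison with the structural morphisms -/

theorem ctxIsoF_nil (h : Ctx.NonLinear []) : M.ctxIsoF [] h = Rep.unit M.F :=
  Rep.comp_unit

theorem ctxIsoF_cons (Φ : Ctx) (P : Ty) (h : Ctx.NonLinear (some P :: Φ)) :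
    M.ctxIsoF (some P :: Φ) h = Rep.tensor (M.ctxIsoF Φ h.1) (M.tyIsoF P h.2) :=
  Rep.comp_tensor _ _ _ _

theorem discard_eq (Φ : Ctx) (h : Φ.NonLinear) : M.discard Φ h = M.discMap t Φ (h.discCtx c) := by
  change Rep.discard (M.ctxIsoF Φ h) = _
  induction Φ with
  | nil => rw [ctxIsoF_nil, Rep.discard_unit]; rfl
  | cons o Φ ih =>
    cases o with
    | none => exact ih h
    | some P => rw [ctxIsoF_cons, Rep.discard_tensor, ih h.1, discMap, M.discTy_of_nonLinear t h.2]

theorem shareMap_none {Γ₁ Γ₂ Θ : Ctx} (g : Share c Γ₁ Γ₂ Θ) :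
    M.shareMap t (.cons .none g) = M.shareMap t g := by
  simp only [shareMap, consIso, optShareMap, Iso.symm_hom, Iso.symm_inv, Category.assoc]
  rw [MonoidalCategory.tensorHom_def, Category.assoc, ← tensor_right_unitality]
  simp

theorem shareMap_left (A : Ty) {Γ₁ Γ₂ Θ : Ctx} (g : Share c Γ₁ Γ₂ Θ) :
    M.shareMap t (.cons (.left A) g) = M.shareMap t g ▷ M.tyC A ≫ (α_ _ _ _).hom ≫
      _ ◁ (β_ _ _).hom ≫ (α_ _ _ _).inv := by
  simp [shareMap, consIso, optShareMap, MonoidalCategory.tensorHom_def, tensorμ]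

theorem shareMap_right (A : Ty) {Γ₁ Γ₂ Θ : Ctx} (g : Share c Γ₁ Γ₂ Θ) :
    M.shareMap t (.cons (.right A) g) = M.shareMap t g ▷ M.tyC A ≫ (α_ _ _ _).hom := by
  simp [shareMap, consIso, optShareMap, MonoidalCategory.tensorHom_def, tensorμ]
  monoidal

theorem unionIso_eq {Γ Δ Θ : Ctx} (u : Union Γ Δ Θ) (g : Share c Γ Δ Θ) :
    (M.unionIso u).hom = M.shareMap t g := by
  rw [Subsingleton.elim g (.ofUnion u)]
  clear g
  induction u with
  | nil => rfl
  | skip u ih => rw [Share.ofUnion, shareMap_none, ← ih]; rfl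
  | inl A u ih => rw [Share.ofUnion, shareMap_left, ← ih]; simp [unionIso]
  | inr A u ih => rw [Share.ofUnion, shareMap_right, ← ih]; simp [unionIso]

theorem copy_eq {Φ : Ctx} (h : Φ.NonLinear) (g : Share c Φ Φ Φ) : M.copy Φ h = M.shareMap t g := by
  rw [Subsingleton.elim g (.diag h)]
  clear g
  change Rep.copy (M.ctxIsoF Φ h) = _
  induction Φ with
  | nil => rw [ctxIsoF_nil, Rep.copy_unit]; rfl
  | cons o Φ ih =>
    cases o with
    | none => rw [Share.diag, shareMap_none, ← ih h]; rfl
    | some P =>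
      rw [ctxIsoF_cons, Rep.copy_tensor, ih h.1]
      simp [Share.diag, shareMap, consIso, optShareMap]

/-- Regard `Θ` as `Φ` together with the pair `Γ, Δ`. Copying `Φ` and regrouping `(Φ, Φ), (Γ, Δ)` as
`(Φ, Γ), (Φ, Δ)` is an instance of interchange. -/
theorem split_eq {Γ₁ Γ₂ Θ : Ctx} (s : Split Γ₁ Γ₂ Θ) (g : Share c Γ₁ Γ₂ Θ) :
    M.split s = M.shareMap t g := by
  let total : Share c Γ₁ s.Δ Θ := .ofUnion s.total
  let first : Share c s.Φ s.Γ Γ₁ := .ofUnion s.first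
  let second : Share c s.Φ s.Δ Γ₂ := .ofUnion s.second
  have e₁ := M.shareMap_assoc t total first (total.assocOuter first) (total.assocInner first)
  have e₂ := M.shareMap_interchange t (total.assocOuter first) (.diag s.nonLinear)
    (total.assocInner first) g first second
  rw [split, ← Category.assoc, ← Category.assoc, ← Category.assoc, ← Category.assoc]
  rw [← tensorIso_inv, Iso.comp_inv_eq]
  simp only [tensorIso_hom, M.unionIso_eq t s.total total, M.unionIso_eq t s.first first,
    M.unionIso_eq t s.second second, M.copy_eq t s.nonLinear (.diag s.nonLinear), ← e₂,
    Category.assoc]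
  rw [tensorHom_def', Category.assoc, ← reassoc_of% e₁, whiskerRight_tensor]
  simp only [Category.assoc, Iso.hom_inv_id_assoc]

end LinearModel

end

/-! ### Unions, splittings and insertions as distributions of variables -/

theorem Split.nonempty_share {c : Calculus} {Γ₁ Γ₂ Θ : Ctx} (s : Split Γ₁ Γ₂ Θ) :
    Nonempty (Share c Γ₁ Γ₂ Θ) := by
  obtain ⟨Φ, Γ, Δ, h, u, v, w⟩ := s
  induction u generalizing Γ₂ Δ Θ with
  | nil => cases v; cases w; exact ⟨.nil⟩
  | skip u ih =>
    cases v with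
    | @skip _ Δ' _ v =>
      cases w with | skip w =>
      obtain ⟨g⟩ := ih Δ' h v w
      exact ⟨.cons .none g⟩
    | @inr A _ Δ' _ v =>
      cases w with | inr _ w =>
      obtain ⟨g⟩ := ih Δ' h v w
      exact ⟨.cons (.right A) g⟩
  | inl A u ih =>
    cases v with | @inl _ _ Δ' _ v =>
    cases w with | inl _ w =>
    obtain ⟨g⟩ := ih Δ' h.1 v w
    exact ⟨.cons (.both A h.2) g⟩
  | inr A u ih =>
    cases v with
    | @skip _ Δ' _ v =>
      cases w with | inl _ w =>
      obtain ⟨g⟩ := ih Δ' h v w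
      exact ⟨.cons (.left A) g⟩
    | inr A v => cases w

/-- A distribution of variables that discards nothing. -/
theorem Share.exists_split {c : Calculus} {Γ₁ Γ₂ Θ : Ctx} (g : Share c Γ₁ Γ₂ Θ) :
    ∃ Θ₁, Nonempty (Split Θ₁ Γ₂ Θ) ∧ Nonempty (Drop c Γ₁ Θ₁) := by
  induction g with
  | nil => exact ⟨[], ⟨⟨[], [], [], trivial, .nil, .nil, .nil⟩⟩, ⟨.nil⟩⟩
  | cons l g ih =>
    obtain ⟨Θ₁, ⟨⟨Φ, Γ, Δ, h, u, v, w⟩⟩, ⟨d⟩⟩ := ih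
    cases l with
    | none => exact ⟨_, ⟨⟨none :: Φ, none :: Γ, none :: Δ, h, .skip u, .skip v, .skip w⟩⟩,
        ⟨.cons (.keep _) d⟩⟩
    -- A `Split` cannot discard, so the variable is handed to the first premise, which then has to
    -- be weakened by it.
    | drop A hA => exact ⟨_, ⟨⟨none :: Φ, some A :: Γ, none :: Δ, h, .inr A u, .skip v, .inl A w⟩⟩,
        ⟨.cons (.drop A hA) d⟩⟩
    | left A => exact ⟨_, ⟨⟨none :: Φ, some A :: Γ, none :: Δ, h, .inr A u, .skip v, .inl A w⟩⟩,
        ⟨.cons (.keep _) d⟩⟩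
    | right A => exact ⟨_, ⟨⟨none :: Φ, none :: Γ, some A :: Δ, h, .skip u, .inr A v, .inr A w⟩⟩,
        ⟨.cons (.keep _) d⟩⟩
    | both A hA => exact ⟨_, ⟨⟨some A :: Φ, none :: Γ, none :: Δ, ⟨h, hA⟩, .inl A u, .inl A v,
        .inl A w⟩⟩, ⟨.cons (.keep _) d⟩⟩

/-- The complement of a subcontext. -/
theorem Drop.exists_union {c : Calculus} {Γ' Γ : Ctx} (d : Drop c Γ' Γ) :
    ∃ Δ, Nonempty (Union Γ' Δ Γ) ∧ DiscCtx c Δ := by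
  induction d with
  | nil => exact ⟨[], ⟨.nil⟩, trivial⟩
  | cons e d ih =>
    obtain ⟨Δ, ⟨u⟩, h⟩ := ih
    cases e with
    | keep =>
      rename_i o _ _
      cases o with
      | none => exact ⟨none :: Δ, ⟨.skip u⟩, h⟩
      | some A => exact ⟨none :: Δ, ⟨.inl A u⟩, h⟩
    | drop A hA => exact ⟨some A :: Δ, ⟨.inr A u⟩, h, hA⟩

theorem Insert.exists_single {c : Calculus} {Γ Θ : Ctx} {i : ℕ} {A : Ty} (s : Insert Γ i A Θ)
    (h : DiscCtx c Γ) : ∃ S, Nonempty (Single i A S) ∧ Nonempty (Drop c S Θ) := by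
  induction s with
  | here Γ A =>
    suffices ∃ E : Ctx, E.Empty ∧ Nonempty (Drop c E Γ) by
      obtain ⟨E, hE, ⟨d⟩⟩ := this
      exact ⟨some A :: E, ⟨.zero A hE⟩, ⟨.cons (.keep _) d⟩⟩
    clear A
    induction Γ with
    | nil => exact ⟨[], trivial, ⟨.nil⟩⟩
    | cons o Γ ih =>
      cases o with
      | none =>
        obtain ⟨E, hE, ⟨d⟩⟩ := ih h
        exact ⟨none :: E, hE, ⟨.cons (.keep _) d⟩⟩
      | some A =>
        obtain ⟨E, hE, ⟨d⟩⟩ := ih h.1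
        exact ⟨none :: E, hE, ⟨.cons (.drop A h.2) d⟩⟩
  | there o s ih =>
    cases o with
    | none =>
      obtain ⟨S, ⟨s⟩, ⟨d⟩⟩ := ih h
      exact ⟨none :: S, ⟨.succ s⟩, ⟨.cons (.keep _) d⟩⟩
    | some A =>
      obtain ⟨S, ⟨s⟩, ⟨d⟩⟩ := ih h.1
      exact ⟨none :: S, ⟨.succ s⟩, ⟨.cons (.drop A h.2) d⟩⟩

theorem Single.exists_insert {c : Calculus} {S Θ : Ctx} {i : ℕ} {A : Ty} (s : Single i A S)
    (d : Drop c S Θ) : ∃ Γ, Nonempty (Insert Γ i A Θ) ∧ DiscCtx c Γ := by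
  induction s generalizing Θ with
  | zero A h =>
    cases d with | cons e d =>
    cases e
    exact ⟨_, ⟨.here _ A⟩, d.discCtx (h.nonLinear.discCtx c)⟩
  | succ s ih =>
    cases d with | cons e d =>
    obtain ⟨Γ, ⟨j⟩, h⟩ := ih d
    cases e with
    | keep => exact ⟨none :: Γ, ⟨.there none j⟩, h⟩
    | drop A hA => exact ⟨some A :: Γ, ⟨.there (some A) j⟩, h, hA⟩

noncomputable section

namespace LinearModel

variable {B : Type u₁} [Category.{v₁} B] [CartesianMonoidalCategory B]
  [BraidedCategory B] [HasFiniteCoproducts B]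
  {V : Type u₂} [Category.{v₂} V] [MonoidalCategory V] [SymmetricCategory V]
  [HasFiniteCoproducts V]
  {C : Type u₃} [Category.{v₃} C] [MonoidalCategory C] [SymmetricCategory C]
  [HasFiniteCoproducts C]
  (M : LinearModel B V C) {c : Calculus} (t : M.Supports c)

/-- Projection to the only variable of a context. -/
def singleMap : {i : ℕ} → {A : Ty} → {S : Ctx} → Single i A S → (M.ctxC S ⟶ M.tyC A)
  | _, _, _, .zero A (Γ := Γ) h =>
      M.discMap t Γ (h.nonLinear.discCtx c) ▷ M.tyC A ≫ (λ_ (M.tyC A)).hom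
  | _, _, _, .succ s => (singleMap s :)

theorem insertIso_disc {Γ Θ S : Ctx} {i : ℕ} {A : Ty} (j : Insert Γ i A Θ) (h : DiscCtx c Γ)
    (s : Single i A S) (d : Drop c S Θ) :
    (M.insertIso j).hom ≫ M.discMap t Γ h ▷ M.tyC A ≫ (λ_ (M.tyC A)).hom =
      M.dropMap t d ≫ M.singleMap t s := by
  induction j generalizing S with
  | here Γ A =>
    cases s with | zero _ hE =>
    cases d with | cons e d =>
    cases e
    rw [discMap, singleMap, ← M.dropMap_disc t d (hE.nonLinear.discCtx c) h]
    simp [insertIso, dropMap, consIso, optDropMap]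
  | @there o Γ i A Θ j ih =>
    cases s with | succ s =>
    cases d with | cons e d =>
    cases e with
    | keep =>
      rw [discMap, singleMap]
      have := ih h s d
      simp [insertIso, dropMap, consIso, optDropMap, this]
    | drop D hD =>
      rw [discMap, singleMap]
      have := ih h.1 s d
      have e : (β_ (M.tyC A) (M.tyC D)).hom ≫ M.discTy t D hD ▷ _ ≫ (λ_ _).hom =
          M.tyC A ◁ M.discTy t D hD ≫ (ρ_ _).hom := by
        rw [← BraidedCategory.braiding_naturality_right_assoc, braiding_leftUnitor]
      replace e := congrArg (M.ctxC Γ ◁ ·) e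
      simp only [whiskerLeft_comp] at e
      simp [insertIso, dropMap, consIso, optDropMap, tensorHom_def', ← this, reassoc_of% e]
      rw [← rightUnitor_naturality_assoc (M.insertIso j).hom, whisker_exchange_assoc]
      simp

/-! ### Morphisms in the image of `L` -/

theorem img_dropMap {Γ' Γ : Ctx} (d : Drop c Γ' Γ) :
    Rep.Img (M.ctxIsoC Γ) (M.ctxIsoC Γ') (M.dropMap t d) := by
  induction d with
  | nil => exact Rep.img_id _
  | cons e d ih =>
    cases e with
    | keep =>
      rename_i o _ _
      cases o with
      | none =>
        have : M.dropMap t (Drop.cons (.keep none) d) = M.dropMap t d := by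
          simp [dropMap, consIso, optDropMap]
        rw [this]; exact ih
      | some A =>
        have : M.dropMap t (Drop.cons (.keep (some A)) d) = M.dropMap t d ▷ _ := by
          simp [dropMap, consIso, optDropMap]
        rw [this]; exact ih.whiskerRight (M.tyIsoC A)
    | drop A hA =>
      have : M.dropMap t (Drop.cons (.drop A hA) d) =
          (M.dropMap t d ⊗ₘ M.discTy t A hA) ≫ (ρ_ _).hom := by
        simp [dropMap, consIso, optDropMap]
      rw [this]
      exact (ih.tensor (M.img_discTy t A hA)).comp ⟨_, Rep.push_rightUnitor _⟩

theorem img_discMap (Γ : Ctx) (h : DiscCtx c Γ) :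
    Rep.Img (M.ctxIsoC Γ) (Rep.unit M.L) (M.discMap t Γ h) := by
  induction Γ with
  | nil => exact Rep.img_id _
  | cons o Γ ih =>
    cases o with
    | none => exact ih h
    | some A => exact ((ih h.1).tensor (M.img_discTy t A h.2)).comp ⟨_, Rep.push_leftUnitor _⟩

theorem img_shareMap {Γ₁ Γ₂ Θ : Ctx} (g : Share c Γ₁ Γ₂ Θ) :
    Rep.Img (M.ctxIsoC Θ) (Rep.tensor (M.ctxIsoC Γ₁) (M.ctxIsoC Γ₂)) (M.shareMap t g) := by
  induction g with
  | nil => exact ⟨_, Rep.push_leftUnitor_inv _⟩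
  | @cons o₁ o₂ o Γ₁ Γ₂ Θ l g ih =>
    let i : (o : Option Ty) → Σ v : V, (M.L.obj v ≅ M.optC o) := fun o =>
      match o with
      | none => ⟨𝟙_ V, Rep.unit M.L⟩
      | some A => ⟨M.tyV A, M.tyIsoC A⟩
    have hom (o : Option Ty) (Γ : Ctx) : Rep.Img (M.ctxIsoC (o :: Γ))
        (Rep.tensor (M.ctxIsoC Γ) (i o).2) (M.consIso o Γ).hom := by
      cases o with
      | none => exact ⟨_, Rep.push_rightUnitor_inv _⟩
      | some A => exact Rep.img_id _
    have inv (o : Option Ty) (Γ : Ctx) : Rep.Img (Rep.tensor (M.ctxIsoC Γ) (i o).2)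
        (M.ctxIsoC (o :: Γ)) (M.consIso o Γ).inv := by
      cases o with
      | none => exact ⟨_, Rep.push_rightUnitor _⟩
      | some A => exact Rep.img_id _
    have hl : Rep.Img (i o).2 (Rep.tensor (i o₁).2 (i o₂).2) (M.optShareMap t l) := by
      cases l with
      | none => exact ⟨_, Rep.push_leftUnitor_inv _⟩
      | drop A h => exact (M.img_discTy t A h).comp ⟨_, Rep.push_leftUnitor_inv _⟩
      | left A => exact ⟨_, Rep.push_rightUnitor_inv _⟩
      | right A => exact ⟨_, Rep.push_leftUnitor_inv _⟩
      | both A h =>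
        have := Rep.img_copy (x := M.tyIsoF A h)
        rw [tyIsoF] at this
        erw [← Rep.comp_tensor] at this
        exact this.of_comp
    exact (hom o Θ).comp (((ih.tensor hl).comp ⟨_, Rep.push_tensorμ _ _ _ _⟩).comp
      ((inv o₁ Γ₁).tensor (inv o₂ Γ₂)))

theorem img_singleMap {i : ℕ} {A : Ty} {S : Ctx} (s : Single i A S) :
    Rep.Img (M.ctxIsoC S) (M.tyIsoC A) (M.singleMap t s) := by
  induction s with
  | zero A h =>
    exact ((M.img_discMap t _ _).whiskerRight (M.tyIsoC A)).comp ⟨_, Rep.push_leftUnitor _⟩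
  | succ s ih => exact ih

theorem discardAll_eq (t : M.Supports .affine) (Γ : Ctx) (h : DiscCtx .affine Γ) :
    M.discardAll t Γ = M.discMap t Γ h := by
  obtain ⟨g, hg⟩ := M.img_discMap t Γ h
  rw [hg, IsTerminal.hom_ext t g (IsTerminal.from t _)]
  rfl

/-- All discarding morphisms in the image of `L` agree in a model of the affine calculus. -/
theorem comp_discMap_affine (t : M.Supports .affine) {Γ Θ : Ctx} {f : M.ctxC Θ ⟶ M.ctxC Γ}
    (hf : Rep.Img (M.ctxIsoC Θ) (M.ctxIsoC Γ) f) (h : DiscCtx .affine Γ) (h' : DiscCtx .affine Θ) :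
    f ≫ M.discMap t Γ h = M.discMap t Θ h' := by
  obtain ⟨g, hg⟩ := hf.comp (M.img_discMap t Γ h)
  obtain ⟨g', hg'⟩ := M.img_discMap t Θ h'
  rw [hg, hg', IsTerminal.hom_ext t g g']

end LinearModel

end

noncomputable section

/-! ### Recursion, for an arbitrary comonad-like endofunctor -/

section Recursion

variable {E : Type u₁} [Category.{v₁} E] [MonoidalCategory E] {T : E ⥤ E}

/-- Naturality of `σ ∘ γ` in the parameter. -/
theorem recursion_natural {P' P W' W D : E} (p : P' ⟶ P)
    {u' : P' ⟶ P' ⊗ T.obj P'} {u : P ⟶ P ⊗ T.obj P}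
    (hu : u' ≫ (p ⊗ₘ T.map p) = p ≫ u)
    {w' : P' ⊗ T.obj W' ⟶ W'} {w : P ⊗ T.obj W ⟶ W} {γ' : P' ⟶ W'} {γ : P ⟶ W}
    (hγ' : γ' = u' ≫ P' ◁ T.map γ' ≫ w') (hγ : γ = u ≫ P ◁ T.map γ ≫ w)
    {k : W' ⟶ W} (hk : w' ≫ k = P' ◁ T.map k ≫ p ▷ T.obj W ≫ w)
    (final : ∀ {D : E} (m : D ⟶ P ⊗ T.obj D) (l l' : D ⟶ W),
      l = m ≫ P ◁ T.map l ≫ w → l' = m ≫ P ◁ T.map l' ≫ w → l = l')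
    {m : P ⊗ T.obj D ⟶ D} {σ : W ⟶ D} {σ' : W' ⟶ D} (hσ : w ≫ σ = P ◁ T.map σ ≫ m)
    (initial : ∀ l : W' ⟶ D, w' ≫ l = P' ◁ T.map l ≫ p ▷ T.obj D ≫ m → l = σ') :
    γ' ≫ σ' = p ≫ γ ≫ σ := by
  -- `k` reindexes the initial algebra along `p`. Following it by `σ` gives an algebra morphism to
  -- the same algebra as `σ'`.
  have h₁ : k ≫ σ = σ' := by
    apply initial
    rw [reassoc_of% hk, hσ, Functor.map_comp, whiskerLeft_comp, Category.assoc,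
      ← whisker_exchange_assoc p (T.map σ)]
  -- Both sides are coalgebra morphisms into the final coalgebra over `P`, out of `P'` with its
  -- structure map pushed forward along `p`.
  have h₂ : γ' ≫ k = p ≫ γ := by
    apply final (u' ≫ p ▷ T.obj P')
    · conv_lhs => rw [hγ']
      simp only [Category.assoc, hk, Functor.map_comp, whiskerLeft_comp]
      rw [← whisker_exchange_assoc, ← whisker_exchange_assoc]
    · conv_lhs => rw [hγ]
      rw [← reassoc_of% hu, Functor.map_comp, whiskerLeft_comp, MonoidalCategory.tensorHom_def]
      simp only [Category.assoc]
  rw [← h₁, reassoc_of% h₂]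

/-- Unfolding of `σ ∘ γ`. -/
theorem recursion_unfold {P W D : E} {u : P ⟶ P ⊗ T.obj P}
    {w : P ⊗ T.obj W ⟶ W} {γ : P ⟶ W} (hγ : γ = u ≫ P ◁ T.map γ ≫ w)
    {m : P ⊗ T.obj D ⟶ D} {σ : W ⟶ D} (hσ : w ≫ σ = P ◁ T.map σ ≫ m) :
    γ ≫ σ = u ≫ P ◁ T.map (γ ≫ σ) ≫ m := by
  conv_lhs => rw [hγ]
  simp [hσ]

end Recursion

namespace LinearModel

variable {B : Type u₁} [Category.{v₁} B] [CartesianMonoidalCategory B]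
  [BraidedCategory B] [HasFiniteCoproducts B]
  {V : Type u₂} [Category.{v₂} V] [MonoidalCategory V] [SymmetricCategory V]
  [HasFiniteCoproducts V]
  {C : Type u₃} [Category.{v₃} C] [MonoidalCategory C] [SymmetricCategory C]
  [HasFiniteCoproducts C]
  (M : LinearModel B V C)

/-! ### Promotion -/

omit [CartesianMonoidalCategory B] [BraidedCategory B] [HasFiniteCoproducts B] [MonoidalCategory C]
  [SymmetricCategory C] [HasFiniteCoproducts C] in
theorem map_unit_natural {F : B ⥤ C} {G : C ⥤ B} (adj : F ⊣ G) {X X' : B} (g : X' ⟶ X) :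
    F.map g ≫ F.map (adj.unit.app X) = F.map (adj.unit.app X') ≫ F.map (G.map (F.map g)) := by
  simp only [← F.map_comp]
  exact congrArg F.map (adj.unit.naturality g)

/-- Promotion is built from the unit of `F ⊣ G`, which is natural only in `B`; hence the requirement
that `s` be an image under `F`. -/
theorem comp_liftMap {Φ' Φ : Ctx} (h' : Φ'.NonLinear) (h : Φ.NonLinear) {s : M.ctxC Φ' ⟶ M.ctxC Φ}
    (hs : Rep.Img (M.ctxIsoF Φ' h') (M.ctxIsoF Φ h) s) {A : Ty} (f : M.ctxC Φ ⟶ M.tyC A) :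
    s ≫ M.liftMap h f = M.liftMap h' (s ≫ f) := by
  obtain ⟨g, rfl⟩ := hs
  have e : M.F.map g ≫ M.F.map (M.adjFG.unit.app _) =
      M.F.map (M.adjFG.unit.app _) ≫ M.bang.map (M.F.map g) := map_unit_natural M.adjFG g
  simp only [liftMap, promote, Rep.push, Category.assoc, Iso.hom_inv_id_assoc, Functor.map_comp]
  rw [← Category.assoc (M.F.map g), e, Category.assoc,
    ← Category.assoc (M.bang.map (M.ctxIsoF Φ' h').hom), ← M.bang.map_comp (M.ctxIsoF Φ' h').hom,
    Iso.hom_inv_id, M.bang.map_id, Category.id_comp]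

theorem liftMap_counit {Φ : Ctx} (h : Φ.NonLinear) {A : Ty} (f : M.ctxC Φ ⟶ M.tyC A) :
    M.liftMap h f ≫ M.adjFG.counit.app (M.tyC A) = f := by
  have e₁ := M.adjFG.counit.naturality f
  have e₂ := M.adjFG.counit.naturality (M.ctxIsoF Φ h).hom
  have e₃ := M.adjFG.left_triangle_components (M.ctxB Φ h)
  simp only [Functor.id_map] at e₁ e₂
  simp only [liftMap, promote, Category.assoc]
  erw [e₁, reassoc_of% e₂, reassoc_of% e₃]
  simp

/-! ### Recursion -/

/-- The structure map of `unfoldCoalgebra`. -/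
def unfold (X : B) : M.F.obj X ⟶ M.F.obj X ⊗ M.bang.obj (M.F.obj X) := (M.unfoldCoalgebra X).str

/-- The structure map of `omega`. -/
def fold (X : B) : M.F.obj X ⊗ M.bang.obj (M.omega X).a ⟶ (M.omega X).a := (M.omega X).str

/-- The inverse of `fold`. -/
def foldInv (X : B) : (M.omega X).a ⟶ M.F.obj X ⊗ M.bang.obj (M.omega X).a :=
  Endofunctor.Algebra.Initial.strInv (M.omegaInitial X)

theorem fold_foldInv (X : B) : M.fold X ≫ M.foldInv X = 𝟙 _ :=
  Endofunctor.Algebra.Initial.right_inv (M.omegaInitial X)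

theorem foldInv_fold (X : B) : M.foldInv X ≫ M.fold X = 𝟙 _ :=
  Endofunctor.Algebra.Initial.left_inv (M.omegaInitial X)

theorem gamma_eq (X : B) :
    M.gamma X = M.unfold X ≫ M.F.obj X ◁ M.bang.map (M.gamma X) ≫ M.fold X := by
  have e : M.unfold X ≫ M.F.obj X ◁ M.bang.map (M.gamma X) = M.gamma X ≫ M.foldInv X :=
    ((M.omegaFinal X).from (M.unfoldCoalgebra X)).h
  rw [← Category.assoc, e, Category.assoc, foldInv_fold, Category.comp_id]

theorem fold_sigma (X : B) {D : C} (m : M.F.obj X ⊗ M.bang.obj D ⟶ D) :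
    M.fold X ≫ M.sigma X m = M.F.obj X ◁ M.bang.map (M.sigma X m) ≫ m :=
  (((M.omegaInitial X).to (⟨D, m⟩ : Endofunctor.Algebra (M.recFunctor X))).h).symm

theorem sigma_unique (X : B) {D : C} (m : M.F.obj X ⊗ M.bang.obj D ⟶ D) (k : (M.omega X).a ⟶ D)
    (hk : M.fold X ≫ k = M.F.obj X ◁ M.bang.map k ≫ m) : k = M.sigma X m := by
  let k' : M.omega X ⟶ (⟨D, m⟩ : Endofunctor.Algebra (M.recFunctor X)) := ⟨k, hk.symm⟩
  exact congrArg Endofunctor.Algebra.Hom.f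
    ((M.omegaInitial X).hom_ext k' ((M.omegaInitial X).to _))

/-- Two coalgebra morphisms to `Ω` agree. -/
theorem coalgebra_unique (X : B) {D : C} (m : D ⟶ M.F.obj X ⊗ M.bang.obj D)
    (k k' : D ⟶ (M.omega X).a) (hk : k = m ≫ M.F.obj X ◁ M.bang.map k ≫ M.fold X)
    (hk' : k' = m ≫ M.F.obj X ◁ M.bang.map k' ≫ M.fold X) : k = k' := by
  have aux (k : D ⟶ (M.omega X).a) (hk : k = m ≫ M.F.obj X ◁ M.bang.map k ≫ M.fold X) :
      m ≫ M.F.obj X ◁ M.bang.map k = k ≫ M.foldInv X := by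
    conv_rhs => rw [hk]
    simp only [Category.assoc, fold_foldInv, Category.comp_id]
  let f (k : D ⟶ (M.omega X).a) (hk) : (⟨D, m⟩ : Endofunctor.Coalgebra (M.recFunctor X)) ⟶
      ⟨(M.omega X).a, Endofunctor.Algebra.Initial.strInv (M.omegaInitial X)⟩ := ⟨k, aux k hk⟩
  exact congrArg Endofunctor.Coalgebra.Hom.f ((M.omegaFinal X).hom_ext (f k hk) (f k' hk'))

omit [BraidedCategory B] [HasFiniteCoproducts B] [SymmetricCategory C] [HasFiniteCoproducts C] in
theorem map_copy_unit_natural {F : B ⥤ C} [F.Monoidal] {G : C ⥤ B} (adj : F ⊣ G) {X X' : B} (g : X' ⟶ X) :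
    (F.map (CartesianMonoidalCategory.lift (𝟙 X') (𝟙 X')) ≫ Functor.OplaxMonoidal.δ F X' X' ≫
      F.obj X' ◁ F.map (adj.unit.app X')) ≫ (F.map g ⊗ₘ F.map (G.map (F.map g))) =
    F.map g ≫ F.map (CartesianMonoidalCategory.lift (𝟙 X) (𝟙 X)) ≫ Functor.OplaxMonoidal.δ F X X ≫
      F.obj X ◁ F.map (adj.unit.app X) := by
  have e : F.obj X' ◁ F.map (adj.unit.app X') ≫ (F.map g ⊗ₘ F.map (G.map (F.map g))) =
      (F.map g ⊗ₘ F.map g) ≫ F.obj X ◁ F.map (adj.unit.app X) := by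
    rw [← id_tensorHom, ← id_tensorHom, tensorHom_comp_tensorHom, tensorHom_comp_tensorHom,
      map_unit_natural]
    simp
  simp only [Category.assoc, e]
  rw [Functor.OplaxMonoidal.δ_natural_assoc, ← F.map_comp_assoc, ← F.map_comp_assoc]
  congr 2
  simp [CartesianMonoidalCategory.comp_lift]

theorem unfold_natural {X' X : B} (g : X' ⟶ X) :
    M.unfold X' ≫ (M.F.map g ⊗ₘ M.bang.map (M.F.map g)) = M.F.map g ≫ M.unfold X :=
  map_copy_unit_natural M.adjFG g

theorem gamma_sigma_natural {X' X : B} (g : X' ⟶ X) {D : C} (m : M.F.obj X ⊗ M.bang.obj D ⟶ D) :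
    M.gamma X' ≫ M.sigma X' (M.F.map g ▷ _ ≫ m) = M.F.map g ≫ M.gamma X ≫ M.sigma X m :=
  recursion_natural (T := M.bang) (M.F.map g) (M.unfold_natural g) (M.gamma_eq X') (M.gamma_eq X)
    -- The comparison between the two initial algebras is the algebra morphism into `Ω` over `X`,
    -- regarded as an algebra over `X'` by acting through `g`.
    (M.fold_sigma X' (M.F.map g ▷ M.bang.obj (M.omega X).a ≫ M.fold X))
    (fun m l l' => M.coalgebra_unique X m l l') (M.fold_sigma X m)
    (fun l hl => M.sigma_unique X' _ l hl)

theorem comp_recMap {Φ' Φ : Ctx} (h' : Φ'.NonLinear) (h : Φ.NonLinear) {s : M.ctxC Φ' ⟶ M.ctxC Φ}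
    (hs : Rep.Img (M.ctxIsoF Φ' h') (M.ctxIsoF Φ h) s) {A : Ty}
    (f : M.ctxC (some (.bang A) :: Φ) ⟶ M.tyC A) :
    s ≫ M.recMap h f = M.recMap h' (s ▷ _ ≫ f) := by
  obtain ⟨g, rfl⟩ := hs
  have e : (M.ctxIsoF Φ' h').hom ▷ M.bang.obj (M.tyC A) ≫
      Rep.push (M.ctxIsoF Φ' h') (M.ctxIsoF Φ h) g ▷ M.bang.obj (M.tyC A) ≫ f =
      M.F.map g ▷ M.bang.obj (M.tyC A) ≫ (M.ctxIsoF Φ h).hom ▷ M.bang.obj (M.tyC A) ≫ f := by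
    simp only [← Category.assoc, ← comp_whiskerRight, Rep.push]
    congr 2
    simp only [Category.assoc, Iso.hom_inv_id_assoc]
  rw [recMap, recMap]
  erw [e, gamma_sigma_natural]
  simp only [Rep.push, Category.assoc, Iso.hom_inv_id_assoc]

/-- A coalgebra morphism followed by an algebra morphism solves the associated fixed point equation.
Here the equation says that `rec z. m` is `m` with `lift (rec z. m)` supplied for `z`, after copying
the context. -/
theorem recMap_unfold {Φ : Ctx} (h : Φ.NonLinear) {A : Ty}
    (f : M.ctxC (some (.bang A) :: Φ) ⟶ M.tyC A) :
    M.recMap h f = M.copy Φ h ≫ M.ctxC Φ ◁ M.liftMap h (M.recMap h f) ≫ f := by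
  let m := (M.ctxIsoF Φ h).hom ▷ M.bang.obj (M.tyC A) ≫ f
  let r := M.gamma (M.ctxB Φ h) ≫ M.sigma (M.ctxB Φ h) m
  have e : r = M.unfold (M.ctxB Φ h) ≫ M.F.obj (M.ctxB Φ h) ◁ M.bang.map r ≫ m :=
    recursion_unfold (T := M.bang) (M.gamma_eq _) (M.fold_sigma _ m)
  have e' : M.recMap h f = (M.ctxIsoF Φ h).inv ≫ r := rfl
  have hl : (M.ctxIsoF Φ h).hom ≫ M.liftMap h (M.recMap h f) =
      M.F.map (M.adjFG.unit.app (M.ctxB Φ h)) ≫ M.bang.map r := by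
    rw [liftMap, promote, e']
    simp only [Category.assoc, Iso.hom_inv_id_assoc, ← Functor.map_comp]
  have hc : M.copy Φ h = (M.ctxIsoF Φ h).inv ≫
    M.F.map (CartesianMonoidalCategory.lift (𝟙 _) (𝟙 _)) ≫
      Functor.OplaxMonoidal.δ M.F (M.ctxB Φ h) (M.ctxB Φ h) ≫
    ((M.ctxIsoF Φ h).hom ⊗ₘ (M.ctxIsoF Φ h).hom) := rfl
  have hu : M.unfold (M.ctxB Φ h) = M.F.map (CartesianMonoidalCategory.lift (𝟙 _) (𝟙 _)) ≫
      Functor.OplaxMonoidal.δ M.F (M.ctxB Φ h) (M.ctxB Φ h) ≫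
      M.F.obj (M.ctxB Φ h) ◁ M.F.map (M.adjFG.unit.app (M.ctxB Φ h)) := rfl
  conv_lhs => rw [e', e, hu]
  rw [hc]
  simp only [Category.assoc]
  congr 3
  rw [tensorHom_def', Category.assoc, ← whisker_exchange_assoc]
  simp only [← Category.assoc, ← whiskerLeft_comp]
  rw [hl]
  simp only [whiskerLeft_comp, Category.assoc]
  rfl

/-! ### Functions -/

/-- The transposition bijection of currying is natural in an object of `V`, so a morphism can enter
an abstraction only if it is an image under `L`. -/
theorem comp_curry {Γ' Γ : Ctx} {s : M.ctxC Γ' ⟶ M.ctxC Γ}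
    (hs : Rep.Img (M.ctxIsoC Γ') (M.ctxIsoC Γ) s) {A B : Ty}
    (f : M.ctxC (some A :: Γ) ⟶ M.tyC B) :
    s ≫ (M.ctxIsoC Γ).inv ≫ M.L.map (M.curry f) =
      (M.ctxIsoC Γ').inv ≫ M.L.map (M.curry (Γ := Γ') (s ▷ M.tyC A ≫ f)) := by
  obtain ⟨g, hg⟩ := hs
  have hs' : s ▷ M.tyC A = Rep.push (M.ctxIsoC (some A :: Γ')) (M.ctxIsoC (some A :: Γ))
      (g ▷ M.tyV A) := by
    rw [hg]; exact Rep.push_whiskerRight _ _ _ _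
  have e : M.curry (Γ := Γ') (s ▷ M.tyC A ≫ f) = g ≫ M.curry f := by
    rw [curry, curry, ← Adjunction.homEquiv_naturality_left, hs']
    simp [Rep.push]
  rw [e, hg]
  simp [Rep.push]

/-- The beta law: evaluation is the counit of the currying adjunction, and the transpose of a
transpose is the original morphism. -/
theorem curry_eval {Γ : Ctx} {A B : Ty} (f : M.ctxC (some A :: Γ) ⟶ M.tyC B) {X : C}
    (g : X ⟶ M.tyC A) :
    (((M.ctxIsoC Γ).inv ≫ M.L.map (M.curry f)) ⊗ₘ g) ≫ M.eval A B = M.ctxC Γ ◁ g ≫ f := by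
  have e : M.L.map (M.curry f ▷ M.tyV A) ≫ (M.adjHom (M.tyV A)).counit.app (M.tyC B) =
      Functor.OplaxMonoidal.δ M.L (M.ctxV Γ) (M.tyV A) ≫
        ((M.ctxIsoC Γ).hom ⊗ₘ (M.tyIsoC A).hom) ≫ f := by
    have := (M.adjHom (M.tyV A)).homEquiv_counit (g := M.curry f)
    rw [curry, Equiv.symm_apply_apply] at this
    rw [curry]
    refine this.symm.trans ?_
    simp [ctxIsoC]
  have e' : (((M.ctxIsoC Γ).inv ≫ M.L.map (M.curry f)) ⊗ₘ g) ≫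
      ((M.tyIsoC (.lolli A B)).inv ⊗ₘ (M.tyIsoC A).inv) =
      ((M.ctxIsoC Γ).inv ⊗ₘ (g ≫ (M.tyIsoC A).inv)) ≫ M.L.map (M.curry f) ▷ _ := by
    rw [tensorHom_comp_tensorHom, ← tensorHom_id, tensorHom_comp_tensorHom]
    simp [tyIsoC]
  rw [eval, reassoc_of% e', Functor.LaxMonoidal.μ_natural_left_assoc, e,
    Functor.Monoidal.μ_δ_assoc, tensorHom_comp_tensorHom_assoc]
  simp

/-! ### Coproducts -/

section Coproducts

variable {D : Type u₁} [Category.{v₁} D] {E : Type u₂} [Category.{v₂} E] [HasFiniteCoproducts D]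
  [HasFiniteCoproducts E] (H : D ⥤ E) [PreservesColimitsOfSize.{0, 0} H] (a b : D)

theorem map_inl_iso_inv :
    H.map coprod.inl ≫ (PreservesColimitPair.iso H a b).inv = coprod.inl := by
  rw [Iso.comp_inv_eq, PreservesColimitPair.iso_hom, coprodComparison_inl]

theorem map_inr_iso_inv :
    H.map coprod.inr ≫ (PreservesColimitPair.iso H a b).inv = coprod.inr := by
  rw [Iso.comp_inv_eq, PreservesColimitPair.iso_hom, coprodComparison_inr]

end Coproducts

theorem map_inl_tyIsoC (A B : Ty) :
    M.L.map (coprod.inl : M.tyV A ⟶ _) ≫ (M.tyIsoC (.sum A B)).hom =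
      (M.tyIsoC A).hom ≫ coprod.inl := by
  have := map_inl_iso_inv M.L (M.tyV A) (M.tyV B)
  simp [tyIsoC, reassoc_of% this]

theorem map_inr_tyIsoC (A B : Ty) :
    M.L.map (coprod.inr : M.tyV B ⟶ _) ≫ (M.tyIsoC (.sum A B)).hom =
      (M.tyIsoC B).hom ≫ coprod.inr := by
  have := map_inr_iso_inv M.L (M.tyV A) (M.tyV B)
  simp [tyIsoC, reassoc_of% this]

theorem map_inl_tyIsoV (A B : Ty) (h : (Ty.sum A B).NonLinear) :
    M.J.map (coprod.inl : M.tyB A h.1 ⟶ _) ≫ (M.tyIsoV (.sum A B) h).hom =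
      (M.tyIsoV A h.1).hom ≫ coprod.inl := by
  have := map_inl_iso_inv M.J (M.tyB A h.1) (M.tyB B h.2)
  simp [tyIsoV, reassoc_of% this]

theorem map_inr_tyIsoV (A B : Ty) (h : (Ty.sum A B).NonLinear) :
    M.J.map (coprod.inr : M.tyB B h.2 ⟶ _) ≫ (M.tyIsoV (.sum A B) h).hom =
      (M.tyIsoV B h.2).hom ≫ coprod.inr := by
  have := map_inr_iso_inv M.J (M.tyB A h.1) (M.tyB B h.2)
  simp [tyIsoV, reassoc_of% this]

/-- `L (⟦D⟧ ⊗ ⟦Γ⟧) ≅ ⟦Γ⟧ ⊗ ⟦D⟧`. -/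
def distribIso (Γ : Ctx) (D : Ty) :
    (tensorRight (M.ctxV Γ) ⋙ M.L).obj (M.tyV D) ≅ M.ctxC Γ ⊗ M.tyC D :=
  (Functor.Monoidal.μIso M.L (M.tyV D) (M.ctxV Γ)).symm ≪≫
    tensorIso (M.tyIsoC D) (M.ctxIsoC Γ) ≪≫ β_ (M.tyC D) (M.ctxC Γ)

theorem distribIso_natural (Γ : Ctx) {D D' : Ty} (f : M.tyV D ⟶ M.tyV D') (g : M.tyC D ⟶ M.tyC D')
    (h : M.L.map f ≫ (M.tyIsoC D').hom = (M.tyIsoC D).hom ≫ g) :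
    M.ctxC Γ ◁ g ≫ (M.distribIso Γ D').inv =
      (M.distribIso Γ D).inv ≫ (tensorRight (M.ctxV Γ) ⋙ M.L).map f := by
  rw [Iso.comp_inv_eq, Category.assoc, Iso.eq_inv_comp]
  have : M.L.map f ▷ M.L.obj (M.ctxV Γ) ≫ ((M.tyIsoC D').hom ⊗ₘ (M.ctxIsoC Γ).hom) =
      ((M.tyIsoC D).hom ⊗ₘ (M.ctxIsoC Γ).hom) ≫ g ▷ _ := by
    rw [← tensorHom_id, ← tensorHom_id, tensorHom_comp_tensorHom, tensorHom_comp_tensorHom, h]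
    simp
  simp only [distribIso, Iso.trans_hom, Iso.symm_hom, Functor.Monoidal.μIso_inv, tensorIso_hom,
    Functor.comp_map, Category.assoc]
  change _ = M.L.map (f ▷ M.ctxV Γ) ≫ _
  rw [← Functor.OplaxMonoidal.δ_natural_left_assoc, reassoc_of% this]
  simp

theorem inl_distrib (Γ : Ctx) (A B : Ty) :
    M.ctxC Γ ◁ (coprod.inl : M.tyC A ⟶ M.tyC A ⨿ M.tyC B) ≫ (M.distrib Γ A B).hom =
      coprod.inl := by
  have e := M.distribIso_natural Γ (D' := .sum A B) coprod.inl coprod.inl (M.map_inl_tyIsoC A B)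
  have e' := map_inl_iso_inv (tensorRight (M.ctxV Γ) ⋙ M.L) (M.tyV A) (M.tyV B)
  change _ ≫ (M.distribIso Γ (.sum A B)).inv ≫ _ ≫
    coprod.map (M.distribIso Γ A).hom (M.distribIso Γ B).hom = _
  erw [reassoc_of% e, reassoc_of% e']
  simp

theorem inr_distrib (Γ : Ctx) (A B : Ty) :
    M.ctxC Γ ◁ (coprod.inr : M.tyC B ⟶ M.tyC A ⨿ M.tyC B) ≫ (M.distrib Γ A B).hom =
      coprod.inr := by
  have e := M.distribIso_natural Γ (D' := .sum A B) coprod.inr coprod.inr (M.map_inr_tyIsoC A B)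
  have e' := map_inr_iso_inv (tensorRight (M.ctxV Γ) ⋙ M.L) (M.tyV A) (M.tyV B)
  change _ ≫ (M.distribIso Γ (.sum A B)).inv ≫ _ ≫
    coprod.map (M.distribIso Γ A).hom (M.distribIso Γ B).hom = _
  erw [reassoc_of% e, reassoc_of% e']
  simp

/-- Distributivity is characterized by its effect on the two injections, and these are untouched by
a map acting on the context factor alone. Hence `s` need not be an image under `L`. -/
theorem comp_distrib {Γ' Γ : Ctx} (s : M.ctxC Γ' ⟶ M.ctxC Γ) (A B : Ty) {X : C}
    (f : M.ctxC Γ ⊗ M.tyC A ⟶ X) (g : M.ctxC Γ ⊗ M.tyC B ⟶ X) :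
    s ▷ _ ≫ (M.distrib Γ A B).hom ≫ coprod.desc f g =
      (M.distrib Γ' A B).hom ≫ coprod.desc (s ▷ _ ≫ f) (s ▷ _ ≫ g) := by
  rw [← cancel_epi (M.distrib Γ' A B).inv]
  have h₁ : coprod.inl ≫ (M.distrib Γ' A B).inv = M.ctxC Γ' ◁ coprod.inl := by
    rw [Iso.comp_inv_eq, inl_distrib]
  have h₂ : coprod.inr ≫ (M.distrib Γ' A B).inv = M.ctxC Γ' ◁ coprod.inr := by
    rw [Iso.comp_inv_eq, inr_distrib]
  apply coprod.hom_ext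
  · rw [reassoc_of% h₁, reassoc_of% h₁, whisker_exchange_assoc, reassoc_of% M.inl_distrib,
      reassoc_of% M.inl_distrib]
    exact congrArg _ (coprod.inl_desc _ _) |>.trans (coprod.inl_desc _ _).symm
  · rw [reassoc_of% h₂, reassoc_of% h₂, whisker_exchange_assoc, reassoc_of% M.inr_distrib,
      reassoc_of% M.inr_distrib]
    exact congrArg _ (coprod.inr_desc _ _) |>.trans (coprod.inr_desc _ _).symm

end LinearModel

end

noncomputable section

namespace LinearModel

variable {B : Type u₁} [Category.{v₁} B] [CartesianMonoidalCategory B]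
  [BraidedCategory B] [HasFiniteCoproducts B]
  {V : Type u₂} [Category.{v₂} V] [MonoidalCategory V] [SymmetricCategory V]
  [HasFiniteCoproducts V]
  {C : Type u₃} [Category.{v₃} C] [MonoidalCategory C] [SymmetricCategory C]
  [HasFiniteCoproducts C]
  (M : LinearModel B V C) {c : Calculus} (t : M.Supports c)

/-! ### Morphisms in the image of `F` -/

theorem imgF_discTy {A : Ty} (h : A.NonLinear) (h' : Disc c A) :
    Rep.Img (M.tyIsoF A h) (Rep.unit M.F) (M.discTy t A h') := by
  rw [M.discTy_of_nonLinear t h]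
  exact Rep.img_discard

theorem dropMap_keep_none {Γ' Γ : Ctx} (d : Drop c Γ' Γ) :
    M.dropMap t (Drop.cons (.keep none) d) = M.dropMap t d := by
  simp [dropMap, consIso, optDropMap]

theorem dropMap_keep_some (A : Ty) {Γ' Γ : Ctx} (d : Drop c Γ' Γ) :
    M.dropMap t (Drop.cons (.keep (some A)) d) = M.dropMap t d ▷ M.tyC A := by
  simp [dropMap, consIso, optDropMap]

theorem dropMap_drop (A : Ty) (h : Disc c A) {Γ' Γ : Ctx} (d : Drop c Γ' Γ) :
    M.dropMap t (Drop.cons (.drop A h) d) =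
      (M.dropMap t d ⊗ₘ M.discTy t A h) ≫ (ρ_ (M.ctxC Γ')).hom := by
  simp [dropMap, consIso, optDropMap]

theorem imgF_dropMap {Γ' Γ : Ctx} (d : Drop c Γ' Γ) (h' : Γ'.NonLinear) (h : Γ.NonLinear) :
    Rep.Img (M.ctxIsoF Γ h) (M.ctxIsoF Γ' h') (M.dropMap t d) := by
  induction d with
  | nil => exact Rep.img_id _
  | cons e d ih =>
    cases e with
    | keep =>
      rename_i o _ _
      cases o with
      | none =>
        rw [dropMap_keep_none]
        exact ih h' h
      | some A =>
        rw [dropMap_keep_some, ctxIsoF_cons, ctxIsoF_cons]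
        exact (ih h'.1 h.1).whiskerRight (M.tyIsoF A h.2)
    | drop A hA =>
      rw [dropMap_drop, ctxIsoF_cons]
      exact ((ih h' h.1).tensor (M.imgF_discTy t h.2 hA)).comp ⟨_, Rep.push_rightUnitor _⟩

theorem imgF_discMap (Γ : Ctx) (h : Γ.NonLinear) (h' : DiscCtx c Γ) :
    Rep.Img (M.ctxIsoF Γ h) (Rep.unit M.F) (M.discMap t Γ h') := by
  rw [← M.discard_eq t Γ h]
  exact Rep.img_discard

/-- On a non-linear context every distribution is full copying followed by discarding on each side,
and both are images under `F`. -/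
theorem imgF_shareMap {Γ₁ Γ₂ Θ : Ctx} (g : Share c Γ₁ Γ₂ Θ) (h₁ : Γ₁.NonLinear)
    (h₂ : Γ₂.NonLinear) (h : Θ.NonLinear) :
    Rep.Img (M.ctxIsoF Θ h) (Rep.tensor (M.ctxIsoF Γ₁ h₁) (M.ctxIsoF Γ₂ h₂)) (M.shareMap t g) := by
  have d₁ : Drop c Γ₁ Θ := g.dropSnd (h₂.discCtx c)
  have d₂ : Drop c Γ₂ Θ := g.swap.dropSnd (h₁.discCtx c)
  rw [← M.shareMap_dropBoth t (.diag h) d₁ d₂ g, ← M.copy_eq t h]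
  exact Rep.img_copy.comp ((M.imgF_dropMap t d₁ h₁ h).tensor (M.imgF_dropMap t d₂ h₂ h))

theorem imgF_singleMap {i : ℕ} {A : Ty} {S : Ctx} (s : Single i A S) (h : S.NonLinear)
    (hA : A.NonLinear) : Rep.Img (M.ctxIsoF S h) (M.tyIsoF A hA) (M.singleMap t s) := by
  induction s with
  | zero A hE =>
    rw [ctxIsoF_cons]
    exact ((M.imgF_discMap t _ _ _).whiskerRight (M.tyIsoF A hA)).comp ⟨_, Rep.push_leftUnitor _⟩
  | succ s ih => exact ih h hA

/-- Promotion followed by `!f` is the `F`-image of the transpose of `f` under `F ⊣ G`, whatever `f`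
is. So a `lift` may be copied and discarded even if the term under it is not a value. -/
theorem imgF_liftMap {Φ : Ctx} (h : Φ.NonLinear) {A : Ty} (f : M.ctxC Φ ⟶ M.tyC A)
    (hA : (Ty.bang A).NonLinear) :
    Rep.Img (M.ctxIsoF Φ h) (M.tyIsoF (.bang A) hA) (M.liftMap h f) := by
  refine ⟨M.adjFG.unit.app _ ≫ M.G.map ((M.ctxIsoF Φ h).hom ≫ f), ?_⟩
  simp only [liftMap, promote, Rep.push, Functor.map_comp, Category.assoc]
  congr 3
  simp [tyIsoF, Rep.comp, tyIsoC, tyIsoV]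

theorem imgF_inl {A D : Ty} (h : (Ty.sum A D).NonLinear) :
    Rep.Img (M.tyIsoF A h.1) (M.tyIsoF (.sum A D) h)
      (coprod.inl : M.tyC A ⟶ M.tyC A ⨿ M.tyC D) := by
  refine ⟨coprod.inl, ?_⟩
  have e := congrArg M.L.map (M.map_inl_tyIsoV A D h)
  rw [Rep.eq_push_iff]
  simp only [Functor.map_comp] at e
  simp only [tyIsoF, Rep.comp, Iso.trans_hom, Functor.mapIso_hom, Category.assoc,
    Functor.comp_map, reassoc_of% e]
  rw [M.map_inl_tyIsoC]

theorem imgF_inr {A D : Ty} (h : (Ty.sum A D).NonLinear) :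
    Rep.Img (M.tyIsoF D h.2) (M.tyIsoF (.sum A D) h)
      (coprod.inr : M.tyC D ⟶ M.tyC A ⨿ M.tyC D) := by
  refine ⟨coprod.inr, ?_⟩
  have e := congrArg M.L.map (M.map_inr_tyIsoV A D h)
  rw [Rep.eq_push_iff]
  simp only [Functor.map_comp] at e
  simp only [tyIsoF, Rep.comp, Iso.trans_hom, Functor.mapIso_hom, Category.assoc,
    Functor.comp_map, reassoc_of% e]
  rw [M.map_inr_tyIsoC]

theorem tyIsoF_tensor {A D : Ty} (h : (Ty.tensor A D).NonLinear) :
    M.tyIsoF (.tensor A D) h = Rep.tensor (M.tyIsoF A h.1) (M.tyIsoF D h.2) :=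
  Rep.comp_tensor _ _ _ _

theorem tyIsoF_unit (h : Ty.unit.NonLinear) : M.tyIsoF .unit h = Rep.unit M.F :=
  Rep.comp_unit

/-! ### Further morphisms in the image of `L` -/

theorem img_inl (A D : Ty) : Rep.Img (M.tyIsoC A) (M.tyIsoC (.sum A D))
    (coprod.inl : M.tyC A ⟶ M.tyC A ⨿ M.tyC D) :=
  ⟨coprod.inl, by rw [Rep.eq_push_iff, map_inl_tyIsoC]⟩

theorem img_inr (A D : Ty) : Rep.Img (M.tyIsoC D) (M.tyIsoC (.sum A D))
    (coprod.inr : M.tyC D ⟶ M.tyC A ⨿ M.tyC D) :=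
  ⟨coprod.inr, by rw [Rep.eq_push_iff, map_inr_tyIsoC]⟩

theorem img_curry {Γ : Ctx} {A D : Ty} (f : M.ctxC (some A :: Γ) ⟶ M.tyC D) :
    Rep.Img (M.ctxIsoC Γ) (M.tyIsoC (.lolli A D)) ((M.ctxIsoC Γ).inv ≫ M.L.map (M.curry f)) :=
  ⟨M.curry f, by simp [Rep.push, tyIsoC]⟩

theorem img_liftMap {Φ : Ctx} (h : Φ.NonLinear) {A : Ty} (f : M.ctxC Φ ⟶ M.tyC A) :
    Rep.Img (M.ctxIsoC Φ) (M.tyIsoC (.bang A)) (M.liftMap h f) :=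
  (M.imgF_liftMap h f trivial).of_comp

end LinearModel

end

/-- In the linear calculus only non-linear variables are discarded, so weakening keeps a context
non-linear. This is why `lift` and `rec` need no weakened form there. -/
theorem Drop.nonLinear_of_linear {Φ Θ : Ctx} (d : Drop .linear Φ Θ) (h : Φ.NonLinear) :
    Θ.NonLinear :=
  nonLinear_of_discCtx (d.discCtx (h.discCtx .linear))

noncomputable section

namespace LinearModel

variable {B : Type u₁} [Category.{v₁} B] [CartesianMonoidalCategory B]
  [BraidedCategory B] [HasFiniteCoproducts B]
  {V : Type u₂} [Category.{v₂} V] [MonoidalCategory V] [SymmetricCategory V]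
  [HasFiniteCoproducts V]
  {C : Type u₃} [Category.{v₃} C] [MonoidalCategory C] [SymmetricCategory C]
  [HasFiniteCoproducts C]
  (M : LinearModel B V C)

/-! ### The rules with two premises -/

/-- `⟦m; n⟧` on separate contexts. -/
def seqMap {X Y D : C} (f : X ⟶ 𝟙_ C) (g : Y ⟶ D) : X ⊗ Y ⟶ D := (f ⊗ₘ g) ≫ (λ_ D).hom

/-- `⟦m n⟧` on separate contexts. -/
def appMap {X Y : C} {A D : Ty} (f : X ⟶ M.tyC (.lolli A D)) (g : Y ⟶ M.tyC A) :
    X ⊗ Y ⟶ M.tyC D := (f ⊗ₘ g) ≫ M.eval A D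

/-- `⟦case m of {left x → n | right y → p}⟧` on separate contexts. -/
def caseMap {X : C} {Γ : Ctx} {A D E : Ty} (f : X ⟶ M.tyC (.sum A D))
    (g : M.ctxC (some A :: Γ) ⟶ M.tyC E) (g' : M.ctxC (some D :: Γ) ⟶ M.tyC E) :
    X ⊗ M.ctxC Γ ⟶ M.tyC E :=
  (β_ X (M.ctxC Γ)).hom ≫ M.ctxC Γ ◁ f ≫ (M.distrib Γ A D).hom ≫ coprod.desc g g'

/-- `⟦let ⟨x, y⟩ = m in n⟧` on separate contexts. -/
def letPairMap {X : C} {Γ : Ctx} {A D E : Ty} (f : X ⟶ M.tyC (.tensor A D))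
    (g : M.ctxC (some D :: some A :: Γ) ⟶ M.tyC E) : X ⊗ M.ctxC Γ ⟶ M.tyC E :=
  f ▷ M.ctxC Γ ≫ (β_ (M.tyC A ⊗ M.tyC D) (M.ctxC Γ)).hom ≫
    (α_ (M.ctxC Γ) (M.tyC A) (M.tyC D)).inv ≫ g

omit [SymmetricCategory C] [HasFiniteCoproducts C] in
theorem comp_seqMap {X X' Y Y' D : C} (s : X' ⟶ X) (s' : Y' ⟶ Y) (f : X ⟶ 𝟙_ C) (g : Y ⟶ D) :
    (s ⊗ₘ s') ≫ seqMap f g = seqMap (s ≫ f) (s' ≫ g) := by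
  simp only [seqMap, tensorHom_comp_tensorHom_assoc]

theorem comp_appMap {X X' Y Y' : C} {A D : Ty} (s : X' ⟶ X) (s' : Y' ⟶ Y)
    (f : X ⟶ M.tyC (.lolli A D)) (g : Y ⟶ M.tyC A) :
    (s ⊗ₘ s') ≫ M.appMap f g = M.appMap (s ≫ f) (s' ≫ g) := by
  simp only [appMap, tensorHom_comp_tensorHom_assoc]

theorem comp_caseMap {X X' : C} {Γ Γ' : Ctx} {A D E : Ty} (s : X' ⟶ X) (s' : M.ctxC Γ' ⟶ M.ctxC Γ)
    (f : X ⟶ M.tyC (.sum A D))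
    (g : M.ctxC (some A :: Γ) ⟶ M.tyC E) (g' : M.ctxC (some D :: Γ) ⟶ M.tyC E) :
    (s ⊗ₘ s') ≫ M.caseMap f g g' =
      M.caseMap (Γ := Γ') (s ≫ f) (s' ▷ M.tyC A ≫ g) (s' ▷ M.tyC D ≫ g') := by
  rw [caseMap, caseMap, BraidedCategory.braiding_naturality_assoc, tensorHom_def', Category.assoc,
    ← whisker_exchange_assoc, M.comp_distrib]
  simp only [whiskerLeft_comp, Category.assoc]

theorem comp_letPairMap {X X' : C} {Γ Γ' : Ctx} {A D E : Ty} (s : X' ⟶ X)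
    (s' : M.ctxC Γ' ⟶ M.ctxC Γ) (f : X ⟶ M.tyC (.tensor A D))
    (g : M.ctxC (some D :: some A :: Γ) ⟶ M.tyC E) :
    (s ⊗ₘ s') ≫ M.letPairMap f g =
      M.letPairMap (Γ := Γ') (s ≫ f) (s' ▷ M.tyC A ▷ M.tyC D ≫ g) := by
  rw [letPairMap, letPairMap, MonoidalCategory.tensorHom_def, Category.assoc,
    whisker_exchange_assoc, BraidedCategory.braiding_naturality_right_assoc, whiskerRight_tensor]
  simp only [comp_whiskerRight, Category.assoc, Iso.hom_inv_id_assoc]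

variable {c : Calculus} (t : M.Supports c)

/-! ### Derivations with implicit weakening -/

/-- `GDer t Γ m A f`: the morphism `f` interprets a derivation of `Γ ⊢ m : A` in which variables
may be discarded wherever a context is distributed over premises. -/
inductive GDer : (Γ : Ctx) → Tm → (A : Ty) → (M.ctxC Γ ⟶ M.tyC A) → Prop
  | var {S Θ : Ctx} {i : ℕ} {A : Ty} (s : Single i A S) (d : Drop c S Θ) :
      GDer Θ (.var i) A (M.dropMap t d ≫ M.singleMap t s)
  | star {Θ : Ctx} (h : DiscCtx c Θ) : GDer Θ .star .unit (M.discMap t Θ h)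
  | lift {Φ Θ : Ctx} {m : Tm} {A : Ty} {f : M.ctxC Φ ⟶ M.tyC A} (h : Φ.NonLinear)
      (d : Drop c Φ Θ) (hm : GDer Φ m A f) :
      GDer Θ (.lift m) (.bang A) (M.dropMap t d ≫ M.liftMap h f)
  | recur {Φ Θ : Ctx} {m : Tm} {A : Ty} {f : M.ctxC (some (.bang A) :: Φ) ⟶ M.tyC A}
      (h : Φ.NonLinear) (d : Drop c Φ Θ) (hm : GDer (some (.bang A) :: Φ) m A f) :
      GDer Θ (.recur A m) A (M.dropMap t d ≫ M.recMap h f)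
  | force {Γ : Ctx} {m : Tm} {A : Ty} {f : M.ctxC Γ ⟶ M.tyC (.bang A)}
      (hm : GDer Γ m (.bang A) f) :
      GDer Γ (.force m) A (f ≫ M.adjFG.counit.app (M.tyC A))
  | left {Γ : Ctx} {m : Tm} {A D : Ty} {f : M.ctxC Γ ⟶ M.tyC A} (hm : GDer Γ m A f) :
      GDer Γ (.left A D m) (.sum A D) (f ≫ (coprod.inl : M.tyC A ⟶ M.tyC A ⨿ M.tyC D))
  | right {Γ : Ctx} {m : Tm} {A D : Ty} {f : M.ctxC Γ ⟶ M.tyC D} (hm : GDer Γ m D f) :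
      GDer Γ (.right A D m) (.sum A D) (f ≫ (coprod.inr : M.tyC D ⟶ M.tyC A ⨿ M.tyC D))
  | lam {Γ : Ctx} {m : Tm} {A D : Ty} {f : M.ctxC (some A :: Γ) ⟶ M.tyC D}
      (hm : GDer (some A :: Γ) m D f) :
      GDer Γ (.lam A m) (.lolli A D) ((M.ctxIsoC Γ).inv ≫ M.L.map (M.curry f))
  | seq {Γ₁ Γ₂ Θ : Ctx} {m n : Tm} {A : Ty} {f : M.ctxC Γ₁ ⟶ M.tyC .unit}
      {f' : M.ctxC Γ₂ ⟶ M.tyC A} (g : Share c Γ₁ Γ₂ Θ) (hm : GDer Γ₁ m .unit f)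
      (hn : GDer Γ₂ n A f') : GDer Θ (.seq m n) A (M.shareMap t g ≫ seqMap f f')
  | case {Γ₁ Γ₂ Θ : Ctx} {m n p : Tm} {A D E : Ty} {f : M.ctxC Γ₁ ⟶ M.tyC (.sum A D)}
      {f' : M.ctxC (some A :: Γ₂) ⟶ M.tyC E} {f'' : M.ctxC (some D :: Γ₂) ⟶ M.tyC E}
      (g : Share c Γ₁ Γ₂ Θ) (hm : GDer Γ₁ m (.sum A D) f) (hn : GDer (some A :: Γ₂) n E f')
      (hp : GDer (some D :: Γ₂) p E f'') :
      GDer Θ (.case m n p) E (M.shareMap t g ≫ M.caseMap f f' f'')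
  | pair {Γ₁ Γ₂ Θ : Ctx} {m n : Tm} {A D : Ty} {f : M.ctxC Γ₁ ⟶ M.tyC A}
      {f' : M.ctxC Γ₂ ⟶ M.tyC D} (g : Share c Γ₁ Γ₂ Θ) (hm : GDer Γ₁ m A f)
      (hn : GDer Γ₂ n D f') : GDer Θ (.pair m n) (.tensor A D) (M.shareMap t g ≫ (f ⊗ₘ f'))
  | letPair {Γ₁ Γ₂ Θ : Ctx} {m n : Tm} {A D E : Ty} {f : M.ctxC Γ₁ ⟶ M.tyC (.tensor A D)}
      {f' : M.ctxC (some D :: some A :: Γ₂) ⟶ M.tyC E}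
      (g : Share c Γ₁ Γ₂ Θ) (hm : GDer Γ₁ m (.tensor A D) f)
      (hn : GDer (some D :: some A :: Γ₂) n E f') :
      GDer Θ (.letPair m n) E (M.shareMap t g ≫ M.letPairMap f f')
  | app {Γ₁ Γ₂ Θ : Ctx} {m n : Tm} {A D : Ty} {f : M.ctxC Γ₁ ⟶ M.tyC (.lolli A D)}
      {f' : M.ctxC Γ₂ ⟶ M.tyC A} (g : Share c Γ₁ Γ₂ Θ) (hm : GDer Γ₁ m (.lolli A D) f)
      (hn : GDer Γ₂ n A f') : GDer Θ (.app m n) D (M.shareMap t g ≫ M.appMap f f')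

variable {M t}

theorem GDer.congr {Γ : Ctx} {m : Tm} {A : Ty} {f f' : M.ctxC Γ ⟶ M.tyC A} (h : M.GDer t Γ m A f)
    (e : f = f') : M.GDer t Γ m A f' := e ▸ h

/-- Weakening. -/
theorem GDer.weaken {Γ Θ : Ctx} {m : Tm} {A : Ty} {f : M.ctxC Γ ⟶ M.tyC A}
    (h : M.GDer t Γ m A f) (d : Drop c Γ Θ) : M.GDer t Θ m A (M.dropMap t d ≫ f) := by
  induction h generalizing Θ with
  | var s d' =>
    refine (GDer.var s (d'.comp d)).congr ?_
    rw [← M.dropMap_comp t d' d, Category.assoc]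
  | star h =>
    refine (GDer.star (d.discCtx h)).congr ?_
    rw [M.dropMap_disc t d]
  | lift h d' hm ih =>
    refine (GDer.lift h (d'.comp d) hm).congr ?_
    rw [← M.dropMap_comp t d' d, Category.assoc]
  | recur h d' hm ih =>
    refine (GDer.recur h (d'.comp d) hm).congr ?_
    rw [← M.dropMap_comp t d' d, Category.assoc]
  | force hm ih => exact (GDer.force (ih d)).congr (Category.assoc ..)
  | left hm ih => exact (GDer.left (ih d)).congr (Category.assoc ..)
  | right hm ih => exact (GDer.right (ih d)).congr (Category.assoc ..)
  | lam hm ih =>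
    refine (GDer.lam (ih (.cons (.keep _) d))).congr ?_
    rw [M.comp_curry (M.img_dropMap t d), dropMap_keep_some]
  | seq g hm hn ihm ihn =>
    refine (GDer.seq (g.dropFirst d) hm hn).congr ?_
    rw [← M.dropMap_share t d g, Category.assoc]
  | case g hm hn hp ihm ihn ihp =>
    refine (GDer.case (g.dropFirst d) hm hn hp).congr ?_
    rw [← M.dropMap_share t d g, Category.assoc]
  | pair g hm hn ihm ihn =>
    refine (GDer.pair (g.dropFirst d) hm hn).congr ?_
    rw [← M.dropMap_share t d g, Category.assoc]
  | letPair g hm hn ihm ihn =>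
    refine (GDer.letPair (g.dropFirst d) hm hn).congr ?_
    rw [← M.dropMap_share t d g, Category.assoc]
  | app g hm hn ihm ihn =>
    refine (GDer.app (g.dropFirst d) hm hn).congr ?_
    rw [← M.dropMap_share t d g, Category.assoc]

/-- Each rule has its counterpart once the structural morphisms of the interpretation are rewritten
as instances of `dropMap`, `discMap` and `shareMap`. -/
theorem gDer_interp {Γ : Ctx} {m : Tm} {A : Ty} (d : Der c Γ m A) :
    M.GDer t Γ m A (M.interp t d) := by
  induction d with
  | varL h s =>
    obtain ⟨S, ⟨s'⟩, ⟨d⟩⟩ := s.exists_single (h.discCtx .linear)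
    refine (GDer.var s' d).congr ?_
    rw [interp, M.discard_eq t, M.insertIso_disc t s _ s' d]
  | starL h =>
    refine (GDer.star (h.discCtx _)).congr ?_
    rw [interp, M.discard_eq t]
  | liftL h d ih =>
    refine (GDer.lift h (.refl _) (ih (t := t))).congr ?_
    rw [interp, dropMap_refl, Category.id_comp]
  | varA s =>
    obtain ⟨S, ⟨s'⟩, ⟨d⟩⟩ := s.exists_single (discCtx_affine _)
    refine (GDer.var s' d).congr ?_
    rw [interp, M.discardAll_eq t _ (discCtx_affine _), M.insertIso_disc t s _ s' d]
  | starA =>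
    refine (GDer.star (discCtx_affine _)).congr ?_
    rw [interp, M.discardAll_eq t _ (discCtx_affine _)]
  | liftA h s d ih =>
    have e := M.shareMap_discSnd t (.ofUnion s) (discCtx_affine _)
      (Share.dropSnd (.ofUnion s) (discCtx_affine _))
    refine (GDer.lift h (Share.dropSnd (.ofUnion s) (discCtx_affine _)) (ih (t := t))).congr ?_
    rw [interp, M.discardAll_eq t _ (discCtx_affine _), M.unionIso_eq t s (.ofUnion s), ← e]
    simp only [Category.assoc]
  | recurA h s d ih =>
    have e := M.shareMap_discSnd t (.ofUnion s) (discCtx_affine _)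
      (Share.dropSnd (.ofUnion s) (discCtx_affine _))
    refine (GDer.recur h (Share.dropSnd (.ofUnion s) (discCtx_affine _)) (ih (t := t))).congr ?_
    rw [interp, M.discardAll_eq t _ (discCtx_affine _), M.unionIso_eq t s (.ofUnion s), ← e]
    simp only [Category.assoc]
  | @seq c _ _ _ _ _ _ s d e ihd ihe =>
    obtain ⟨g⟩ := s.nonempty_share (c := c)
    refine (GDer.seq g (ihd (t := t)) (ihe (t := t))).congr ?_
    rw [interp, M.split_eq t s g]; rfl
  | force d ih => exact GDer.force ih
  | left d ih => exact GDer.left ih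
  | right d ih => exact GDer.right ih
  | @case c _ _ _ _ _ _ _ _ _ s d e f ihd ihe ihf =>
    obtain ⟨g⟩ := s.nonempty_share (c := c)
    refine (GDer.case g (ihd (t := t)) (ihe (t := t)) (ihf (t := t))).congr ?_
    rw [interp, M.split_eq t s g]; rfl
  | @pair c _ _ _ _ _ _ _ s d e ihd ihe =>
    obtain ⟨g⟩ := s.nonempty_share (c := c)
    refine (GDer.pair g (ihd (t := t)) (ihe (t := t))).congr ?_
    rw [interp, M.split_eq t s g]
  | @letPair c _ _ _ _ _ _ _ _ s d e ihd ihe =>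
    obtain ⟨g⟩ := s.nonempty_share (c := c)
    refine (GDer.letPair g (ihd (t := t)) (ihe (t := t))).congr ?_
    rw [interp, M.split_eq t s g]; rfl
  | lam d ih => exact GDer.lam ih
  | @app c _ _ _ _ _ _ _ s d e ihd ihe =>
    obtain ⟨g⟩ := s.nonempty_share (c := c)
    refine (GDer.app g (ihd (t := t)) (ihe (t := t))).congr ?_
    rw [interp, M.split_eq t s g]; rfl
  | recur h d ih =>
    refine (GDer.recur h (.refl _) (ih (t := t))).congr ?_
    rw [interp, dropMap_refl, Category.id_comp]

/-- A derivation proper can discard only at certain rules. Generalizing to a larger context `Θ` lets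
the induction push discarded variables upwards, into the first premise of each binary rule, until a
rule absorbs them. -/
theorem GDer.nonempty_der {Γ Θ : Ctx} {m : Tm} {A : Ty} {f : M.ctxC Γ ⟶ M.tyC A}
    (h : M.GDer t Γ m A f) (d : Drop c Γ Θ) : Nonempty (Der c Θ m A) := by
  induction h generalizing Θ with
  | var s d' =>
    obtain ⟨Γ, ⟨j⟩, h⟩ := s.exists_insert (d'.comp d)
    cases c with
    | linear => exact ⟨.varL (nonLinear_of_discCtx h) j⟩
    | affine => exact ⟨.varA j⟩
  | star h =>
    cases c with
    | linear => exact ⟨.starL (nonLinear_of_discCtx (d.discCtx h))⟩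
    | affine => exact ⟨.starA⟩
  | lift h d' hm ih =>
    -- In `λ_l` the enlarged context is still non-linear and is passed to the premise; in `λ_a` the
    -- extra variables become the discarded part `Γ` of the rule.
    cases c with
    | linear =>
      obtain ⟨e⟩ := ih (d'.comp d)
      exact ⟨.liftL ((d'.comp d).nonLinear_of_linear h) e⟩
    | affine =>
      obtain ⟨Δ, ⟨u⟩, -⟩ := (d'.comp d).exists_union
      obtain ⟨e⟩ := ih (.refl _)
      exact ⟨.liftA h u e⟩
  | recur h d' hm ih =>
    cases c with
    | linear =>
      obtain ⟨e⟩ := ih (.cons (.keep _) (d'.comp d))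
      exact ⟨.recur ((d'.comp d).nonLinear_of_linear h) e⟩
    | affine =>
      obtain ⟨Δ, ⟨u⟩, -⟩ := (d'.comp d).exists_union
      obtain ⟨e⟩ := ih (.refl _)
      exact ⟨.recurA h u e⟩
  | force hm ih => exact (ih d).map .force
  | left hm ih => exact (ih d).map .left
  | right hm ih => exact (ih d).map .right
  | lam hm ih => exact (ih (.cons (.keep _) d)).map .lam
  | seq g hm hn ihm ihn =>
    obtain ⟨Θ₁, ⟨s⟩, ⟨d₁⟩⟩ := (g.dropFirst d).exists_split
    obtain ⟨e₁⟩ := ihm d₁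
    obtain ⟨e₂⟩ := ihn (.refl _)
    exact ⟨.seq s e₁ e₂⟩
  | case g hm hn hp ihm ihn ihp =>
    obtain ⟨Θ₁, ⟨s⟩, ⟨d₁⟩⟩ := (g.dropFirst d).exists_split
    obtain ⟨e₁⟩ := ihm d₁
    obtain ⟨e₂⟩ := ihn (.refl _)
    obtain ⟨e₃⟩ := ihp (.refl _)
    exact ⟨.case s e₁ e₂ e₃⟩
  | pair g hm hn ihm ihn =>
    obtain ⟨Θ₁, ⟨s⟩, ⟨d₁⟩⟩ := (g.dropFirst d).exists_split
    obtain ⟨e₁⟩ := ihm d₁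
    obtain ⟨e₂⟩ := ihn (.refl _)
    exact ⟨.pair s e₁ e₂⟩
  | letPair g hm hn ihm ihn =>
    obtain ⟨Θ₁, ⟨s⟩, ⟨d₁⟩⟩ := (g.dropFirst d).exists_split
    obtain ⟨e₁⟩ := ihm d₁
    obtain ⟨e₂⟩ := ihn (.refl _)
    exact ⟨.letPair s e₁ e₂⟩
  | app g hm hn ihm ihn =>
    obtain ⟨Θ₁, ⟨s⟩, ⟨d₁⟩⟩ := (g.dropFirst d).exists_split
    obtain ⟨e₁⟩ := ihm d₁
    obtain ⟨e₂⟩ := ihn (.refl _)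
    exact ⟨.app s e₁ e₂⟩

end LinearModel

end

/-! ## Coherence -/

/-- Two entries that do not disagree. -/
def OptCompat (o o' : Option Ty) : Prop := ∀ A A', o = some A → o' = some A' → A = A'

/-- Two contexts of the same length that agree on the types of the variables declared in both. -/
abbrev Compat : Ctx → Ctx → Prop := List.Forall₂ OptCompat

theorem Compat.refl (Γ : Ctx) : Compat Γ Γ :=
  List.forall₂_same.2 fun _ _ _ _ h h' => Option.some.inj (h.symm.trans h')

theorem Compat.cons_some (A : Ty) {Γ Γ' : Ctx} (h : Compat Γ Γ') :
    Compat (some A :: Γ) (some A :: Γ') :=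
  .cons (fun _ _ h h' => Option.some.inj (h.symm.trans h')) h

variable {c : Calculus}

/-- Two derivations of one judgement may pass different subcontexts to corresponding premises.
Equality of contexts is lost on the way up, but compatibility is inherited. -/
theorem Compat.drop {Γ Γ' Θ Θ' : Ctx} (h : Compat Θ Θ') (d : Drop c Γ Θ) (d' : Drop c Γ' Θ') :
    Compat Γ Γ' := by
  induction h generalizing Γ Γ' with
  | nil => cases d; cases d'; exact .nil
  | cons r h ih =>
    cases d with | cons e d =>
    cases d' with | cons e' d' =>
    refine .cons ?_ (ih d d')
    cases e <;> cases e' <;> first | exact r | (intro _ _ h h'; cases h; done) | (intro _ _ h h'; cases h')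

theorem Compat.share_fst {Γ₁ Γ₂ Γ₁' Γ₂' Θ Θ' : Ctx} (h : Compat Θ Θ') (g : Share c Γ₁ Γ₂ Θ)
    (g' : Share c Γ₁' Γ₂' Θ') : Compat Γ₁ Γ₁' := by
  induction h generalizing Γ₁ Γ₂ Γ₁' Γ₂' with
  | nil => cases g; cases g'; exact .nil
  | cons r h ih =>
    cases g with | cons l g =>
    cases g' with | cons l' g' =>
    refine .cons ?_ (ih g g')
    cases l <;> cases l' <;> first | exact r | (intro _ _ h h'; cases h; done) | (intro _ _ h h'; cases h')

theorem Compat.share_snd {Γ₁ Γ₂ Γ₁' Γ₂' Θ Θ' : Ctx} (h : Compat Θ Θ') (g : Share c Γ₁ Γ₂ Θ)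
    (g' : Share c Γ₁' Γ₂' Θ') : Compat Γ₂ Γ₂' :=
  h.share_fst g.swap g'.swap

theorem Compat.empty_eq {Γ Γ' : Ctx} (h : Compat Γ Γ') (e : Γ.Empty) (e' : Γ'.Empty) : Γ = Γ' := by
  induction h with
  | nil => rfl
  | @cons o o' Γ Γ' r h ih =>
    cases o with
    | some A => exact e.elim
    | none =>
      cases o' with
      | some A => exact e'.elim
      | none => rw [ih e e']

theorem Compat.single_eq {i : ℕ} {A A' : Ty} {Γ Γ' : Ctx} (h : Compat Γ Γ') (s : Single i A Γ)
    (s' : Single i A' Γ') : A = A' ∧ Γ = Γ' := by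
  induction s generalizing Γ' with
  | zero A e =>
    cases s' with | zero _ e' =>
    cases h with | cons r h =>
    obtain rfl := r _ _ rfl rfl
    obtain rfl := Compat.empty_eq h e e'
    exact ⟨rfl, rfl⟩
  | succ s ih =>
    cases s' with | succ s' =>
    cases h with | cons r h =>
    obtain ⟨rfl, rfl⟩ := ih h s'
    exact ⟨rfl, rfl⟩

theorem Compat.exists_empty {Γ Γ' : Ctx} (h : Compat Γ Γ') (e : DiscCtx c Γ) (e' : DiscCtx c Γ') :
    ∃ Δ : Ctx, Δ.Empty ∧ Nonempty (Drop c Δ Γ) ∧ Nonempty (Drop c Δ Γ') := by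
  induction h with
  | nil => exact ⟨[], trivial, ⟨.nil⟩, ⟨.nil⟩⟩
  | @cons o o' Γ Γ' r h ih =>
    have aux (o : Option Ty) (Γ : Ctx) (e : DiscCtx c (o :: Γ)) :
        DiscCtx c Γ ∧ Nonempty (OptDrop c none o) := by
      cases o with
      | none => exact ⟨e, ⟨.keep _⟩⟩
      | some A => exact ⟨e.1, ⟨.drop A e.2⟩⟩
    obtain ⟨e, ⟨l⟩⟩ := aux o Γ e
    obtain ⟨e', ⟨l'⟩⟩ := aux o' Γ' e'
    obtain ⟨Δ, hΔ, ⟨d⟩, ⟨d'⟩⟩ := ih e e'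
    exact ⟨none :: Δ, hΔ, ⟨.cons l d⟩, ⟨.cons l' d'⟩⟩

/-- The union of two subcontexts. -/
theorem Drop.exists_join {Δ₁ Δ₂ Γ : Ctx} (d₁ : Drop c Δ₁ Γ) (d₂ : Drop c Δ₂ Γ) :
    Nonempty (Drop c Δ₁ (join Δ₁ Δ₂)) ∧ Nonempty (Drop c Δ₂ (join Δ₁ Δ₂)) ∧
      Nonempty (Drop c (join Δ₁ Δ₂) Γ) := by
  induction d₁ generalizing Δ₂ with
  | nil => cases d₂; exact ⟨⟨.nil⟩, ⟨.nil⟩, ⟨.nil⟩⟩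
  | cons e₁ d₁ ih =>
    cases d₂ with | cons e₂ d₂ =>
    obtain ⟨⟨a₁⟩, ⟨a₂⟩, ⟨a⟩⟩ := ih d₂
    cases e₁ with
    | keep =>
      cases e₂ with
      | keep =>
        have (o : Option Ty) : optJoin o o = o := by cases o <;> rfl
        rw [join, this]
        exact ⟨⟨.cons (.keep _) a₁⟩, ⟨.cons (.keep _) a₂⟩, ⟨.cons (.keep _) a⟩⟩
      | drop A h => exact ⟨⟨.cons (.keep _) a₁⟩, ⟨.cons (.drop A h) a₂⟩, ⟨.cons (.keep _) a⟩⟩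
    | drop A h =>
      cases e₂ with
      | keep => exact ⟨⟨.cons (.drop A h) a₁⟩, ⟨.cons (.keep _) a₂⟩, ⟨.cons (.keep _) a⟩⟩
      | drop => exact ⟨⟨.cons (.keep _) a₁⟩, ⟨.cons (.keep _) a₂⟩, ⟨.cons (.drop A h) a⟩⟩

noncomputable section

namespace LinearModel

variable {B : Type u₁} [Category.{v₁} B] [CartesianMonoidalCategory B]
  [BraidedCategory B] [HasFiniteCoproducts B]
  {V : Type u₂} [Category.{v₂} V] [MonoidalCategory V] [SymmetricCategory V]
  [HasFiniteCoproducts V]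
  {C : Type u₃} [Category.{v₃} C] [MonoidalCategory C] [SymmetricCategory C]
  [HasFiniteCoproducts C]
  (M : LinearModel B V C) (t : M.Supports c)

/-- Two morphisms that factor in the same way through a common subcontext. -/
inductive Same (Γ : Ctx) : (A : Ty) → (M.ctxC Γ ⟶ M.tyC A) → (Γ' : Ctx) → (A' : Ty) →
    (M.ctxC Γ' ⟶ M.tyC A') → Prop
  | mk {Δ Γ' : Ctx} {A : Ty} (δ : Drop c Δ Γ) (δ' : Drop c Δ Γ') (f : M.ctxC Δ ⟶ M.tyC A) :
      Same Γ A (M.dropMap t δ ≫ f) Γ' A (M.dropMap t δ' ≫ f)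

variable {M t}

theorem Same.eq {Γ : Ctx} {A : Ty} {f f' : M.ctxC Γ ⟶ M.tyC A} (h : M.Same t Γ A f Γ A f') :
    f = f' := by
  obtain ⟨δ, δ', k⟩ := h
  rw [Subsingleton.elim δ δ']

variable (M t) in
/-- Like `Same`, where the first variable of the context is not discarded. -/
inductive SameUnder (Γ : Ctx) : (A D : Ty) → (M.ctxC (some A :: Γ) ⟶ M.tyC D) → (Γ' : Ctx) →
    (D' : Ty) → (M.ctxC (some A :: Γ') ⟶ M.tyC D') → Prop
  | mk {Δ Γ' : Ctx} {A D : Ty} (δ : Drop c Δ Γ) (δ' : Drop c Δ Γ')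
      (f : M.ctxC (some A :: Δ) ⟶ M.tyC D) :
      SameUnder Γ A D (M.dropMap t δ ▷ M.tyC A ≫ f) Γ' D (M.dropMap t δ' ▷ M.tyC A ≫ f)

variable (M t) in
/-- Like `Same`, where the first two variables of the context are not discarded. -/
inductive SameUnderTwo (Γ : Ctx) : (A E D : Ty) → (M.ctxC (some E :: some A :: Γ) ⟶ M.tyC D) →
    (Γ' : Ctx) → (D' : Ty) → (M.ctxC (some E :: some A :: Γ') ⟶ M.tyC D') → Prop
  | mk {Δ Γ' : Ctx} {A E D : Ty} (δ : Drop c Δ Γ) (δ' : Drop c Δ Γ')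
      (f : M.ctxC (some E :: some A :: Δ) ⟶ M.tyC D) :
      SameUnderTwo Γ A E D (M.dropMap t δ ▷ M.tyC A ▷ M.tyC E ≫ f) Γ' D
        (M.dropMap t δ' ▷ M.tyC A ▷ M.tyC E ≫ f)

/-- The common subcontext may lack the bound variable. Its discarding is then absorbed into the
common morphism, so that the binder sees the variable on both sides. -/
theorem Same.under {Γ Γ' : Ctx} {A D D' : Ty} {f : M.ctxC (some A :: Γ) ⟶ M.tyC D}
    {f' : M.ctxC (some A :: Γ') ⟶ M.tyC D'} (h : M.Same t (some A :: Γ) D f (some A :: Γ') D' f') :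
    M.SameUnder t Γ A D f Γ' D' f' := by
  cases h with | mk δ δ' k =>
  cases δ with | @cons o _ Δ _ e δ =>
  cases δ' with | cons e' δ' =>
  rw [← M.dropMap_comp t (.cons e (.refl _)) (.cons (.keep _) δ),
    ← M.dropMap_comp t (.cons e (.refl _)) (.cons (.keep _) δ'), dropMap_keep_some,
    dropMap_keep_some, Category.assoc, Category.assoc]
  exact .mk δ δ' _

theorem Same.underTwo {Γ Γ' : Ctx} {A E D D' : Ty} {f : M.ctxC (some E :: some A :: Γ) ⟶ M.tyC D}
    {f' : M.ctxC (some E :: some A :: Γ') ⟶ M.tyC D'}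
    (h : M.Same t (some E :: some A :: Γ) D f (some E :: some A :: Γ') D' f') :
    M.SameUnderTwo t Γ A E D f Γ' D' f' := by
  cases h with | mk δ δ' k =>
  cases δ with | cons e₁ δ =>
  cases δ with | cons e₂ δ =>
  cases δ' with | cons e₁' δ' =>
  cases δ' with | cons e₂' δ' =>
  rw [← M.dropMap_comp t (.cons e₁ (.cons e₂ (.refl _))) (.cons (.keep _) (.cons (.keep _) δ)),
    ← M.dropMap_comp t (.cons e₁ (.cons e₂ (.refl _))) (.cons (.keep _) (.cons (.keep _) δ')),
    dropMap_keep_some, dropMap_keep_some, dropMap_keep_some, dropMap_keep_some, Category.assoc,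
    Category.assoc]
  exact .mk δ δ' _

/-- The two branches of a `case` yield unrelated common subcontexts, but share one context in the
rule; both are enlarged to the union. The heterogeneous equalities are due to `D₁'` and `D₂'` being
identified with `D₁` and `D₂` only in the conclusion. -/
theorem SameUnder.merge {Γ Γ' : Ctx} {A₁ A₂ D₁ D₂ D₁' D₂' : Ty}
    {f₁ : M.ctxC (some A₁ :: Γ) ⟶ M.tyC D₁} {f₁' : M.ctxC (some A₁ :: Γ') ⟶ M.tyC D₁'}
    {f₂ : M.ctxC (some A₂ :: Γ) ⟶ M.tyC D₂} {f₂' : M.ctxC (some A₂ :: Γ') ⟶ M.tyC D₂'}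
    (h₁ : M.SameUnder t Γ A₁ D₁ f₁ Γ' D₁' f₁') (h₂ : M.SameUnder t Γ A₂ D₂ f₂ Γ' D₂' f₂') :
    ∃ (Δ : Ctx) (δ : Drop c Δ Γ) (δ' : Drop c Δ Γ'), D₁ = D₁' ∧ D₂ = D₂' ∧
      ∃ k₁ : M.ctxC (some A₁ :: Δ) ⟶ M.tyC D₁, ∃ k₂ : M.ctxC (some A₂ :: Δ) ⟶ M.tyC D₂,
      f₁ = M.dropMap t δ ▷ M.tyC A₁ ≫ k₁ ∧ f₂ = M.dropMap t δ ▷ M.tyC A₂ ≫ k₂ ∧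
      HEq f₁' (M.dropMap t δ' ▷ M.tyC A₁ ≫ k₁) ∧ HEq f₂' (M.dropMap t δ' ▷ M.tyC A₂ ≫ k₂) := by
  cases h₁ with | @mk Δ₁ _ _ _ δ₁ δ₁' k₁ =>
  cases h₂ with | @mk Δ₂ _ _ _ δ₂ δ₂' k₂ =>
  obtain ⟨⟨a₁⟩, ⟨a₂⟩, ⟨a⟩⟩ := δ₁.exists_join δ₂
  obtain ⟨-, -, ⟨a'⟩⟩ := δ₁'.exists_join δ₂'
  refine ⟨_, a, a', rfl, rfl, M.dropMap t a₁ ▷ _ ≫ k₁, M.dropMap t a₂ ▷ _ ≫ k₂, ?_, ?_,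
    heq_of_eq ?_, heq_of_eq ?_⟩ <;>
  rw [← comp_whiskerRight_assoc, M.dropMap_comp]

/-- The union of `Δ₁` and `Δ₂` serves as common subcontext: both composites discard everything else
and then distribute it in the only possible way. -/
theorem Same.share {Γ₁ Γ₂ Θ Γ₁' Γ₂' Θ' Δ₁ Δ₂ : Ctx} {A : Ty} (g : Share c Γ₁ Γ₂ Θ)
    (g' : Share c Γ₁' Γ₂' Θ') (δ₁ : Drop c Δ₁ Γ₁) (δ₂ : Drop c Δ₂ Γ₂) (δ₁' : Drop c Δ₁ Γ₁')
    (δ₂' : Drop c Δ₂ Γ₂') (k : M.ctxC Δ₁ ⊗ M.ctxC Δ₂ ⟶ M.tyC A) :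
    M.Same t Θ A (M.shareMap t g ≫ (M.dropMap t δ₁ ⊗ₘ M.dropMap t δ₂) ≫ k)
      Θ' A (M.shareMap t g' ≫ (M.dropMap t δ₁' ⊗ₘ M.dropMap t δ₂') ≫ k) := by
  have e := g.dropBoth δ₁ δ₂
  have e' := g'.dropBoth δ₁' δ₂'
  rw [reassoc_of% M.shareMap_dropBoth t g δ₁ δ₂ e, reassoc_of% M.shareMap_dropBoth t g' δ₁' δ₂' e',
    ← M.dropMap_share t e.dropJoin e.join, ← M.dropMap_share t e'.dropJoin e.join, Category.assoc,
    Category.assoc]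
  exact .mk _ _ _

/-- All derivations of the same judgement have the same interpretation. -/
theorem GDer.same {Γ Γ' : Ctx} {m : Tm} {A A' : Ty} {f : M.ctxC Γ ⟶ M.tyC A}
    {f' : M.ctxC Γ' ⟶ M.tyC A'} (h : M.GDer t Γ m A f) (h' : M.GDer t Γ' m A' f')
    (r : Compat Γ Γ') : M.Same t Γ A f Γ' A' f' := by
  induction h generalizing Γ' A' f' with
  | var s d =>
    cases h' with | var s' d' =>
    obtain ⟨rfl, rfl⟩ := Compat.single_eq (Compat.drop r d d') s s'
    rw [Subsingleton.elim s s']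
    exact .mk _ _ _
  | star h =>
    cases h' with | star h' =>
    obtain ⟨Δ, hΔ, ⟨d⟩, ⟨d'⟩⟩ := Compat.exists_empty r h h'
    rw [← M.dropMap_disc t d (hΔ.nonLinear.discCtx c), ← M.dropMap_disc t d' (hΔ.nonLinear.discCtx c)]
    exact .mk _ _ _
  | lift h d hm ih =>
    cases h' with | lift h' d' hm' =>
    cases ih hm' (Compat.drop r d d') with | mk δ δ' k =>
    have hΔ := δ.nonLinear h
    rw [← M.comp_liftMap h hΔ (M.imgF_dropMap t δ _ _), ← M.comp_liftMap h' hΔ (M.imgF_dropMap t δ' _ _),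
      reassoc_of% M.dropMap_comp t δ d (δ.comp d), reassoc_of% M.dropMap_comp t δ' d' (δ'.comp d')]
    exact .mk _ _ _
  | recur h d hm ih =>
    cases h' with | recur h' d' hm' =>
    cases (ih hm' (Compat.cons_some _ (Compat.drop r d d'))).under with | mk δ δ' k =>
    have hΔ := δ.nonLinear h
    rw [← M.comp_recMap h hΔ (M.imgF_dropMap t δ _ _), ← M.comp_recMap h' hΔ (M.imgF_dropMap t δ' _ _),
      reassoc_of% M.dropMap_comp t δ d (δ.comp d), reassoc_of% M.dropMap_comp t δ' d' (δ'.comp d')]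
    exact .mk _ _ _
  | force hm ih =>
    cases h' with | force hm' =>
    cases ih hm' r with | mk δ δ' k =>
    rw [Category.assoc, Category.assoc]
    exact .mk _ _ _
  | left hm ih =>
    cases h' with | left hm' =>
    cases ih hm' r with | mk δ δ' k =>
    rw [Category.assoc, Category.assoc]
    exact .mk (A := .sum _ _) _ _ _
  | right hm ih =>
    cases h' with | right hm' =>
    cases ih hm' r with | mk δ δ' k =>
    rw [Category.assoc, Category.assoc]
    exact .mk (A := .sum _ _) _ _ _
  | lam hm ih =>
    cases h' with | lam hm' =>
    cases (ih hm' (Compat.cons_some _ r)).under with | mk δ δ' k =>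
    rw [← M.comp_curry (M.img_dropMap t δ), ← M.comp_curry (M.img_dropMap t δ')]
    exact .mk (A := .lolli _ _) _ _ _
  | seq g hm hn ihm ihn =>
    cases h' with | seq g' hm' hn' =>
    cases ihm hm' (Compat.share_fst r g g') with | mk δ₁ δ₁' k₁ =>
    cases ihn hn' (Compat.share_snd r g g') with | mk δ₂ δ₂' k₂ =>
    rw [← comp_seqMap, ← comp_seqMap]
    exact .share g g' _ _ _ _ _
  | case g hm hn hp ihm ihn ihp =>
    cases h' with | case g' hm' hn' hp' =>
    -- The two derivations could use different types for the scrutinee. The induction hypothesis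
    -- identifies them, which is needed before the contexts of the branches can be compared.
    cases ihm hm' (Compat.share_fst r g g') with | mk δ₁ δ₁' k₁ =>
    have r₂ := Compat.share_snd r g g'
    obtain ⟨Δ, δ₂, δ₂', rfl, -, k₂, k₃, rfl, rfl, e, e'⟩ := (ihn hn' (Compat.cons_some _ r₂)).under.merge
      (ihp hp' (Compat.cons_some _ r₂)).under
    rw [eq_of_heq e, eq_of_heq e', ← comp_caseMap, ← comp_caseMap]
    exact .share g g' _ _ _ _ _
  | pair g hm hn ihm ihn =>
    cases h' with | pair g' hm' hn' =>
    cases ihm hm' (Compat.share_fst r g g') with | mk δ₁ δ₁' k₁ =>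
    cases ihn hn' (Compat.share_snd r g g') with | mk δ₂ δ₂' k₂ =>
    rw [← tensorHom_comp_tensorHom, ← tensorHom_comp_tensorHom]
    exact .share (A := .tensor _ _) g g' _ _ _ _ _
  | letPair g hm hn ihm ihn =>
    cases h' with | letPair g' hm' hn' =>
    cases ihm hm' (Compat.share_fst r g g') with | mk δ₁ δ₁' k₁ =>
    cases (ihn hn' (Compat.cons_some _ (Compat.cons_some _ (Compat.share_snd r g g')))).underTwo with
    | mk δ₂ δ₂' k₂ =>
    rw [← comp_letPairMap, ← comp_letPairMap]
    exact .share g g' _ _ _ _ _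
  | app g hm hn ihm ihn =>
    cases h' with | app g' hm' hn' =>
    cases ihm hm' (Compat.share_fst r g g') with | mk δ₁ δ₁' k₁ =>
    cases ihn hn' (Compat.share_snd r g g') with | mk δ₂ δ₂' k₂ =>
    rw [← comp_appMap, ← comp_appMap]
    exact .share g g' _ _ _ _ _

theorem GDer.unique {Γ : Ctx} {m : Tm} {A : Ty} {f f' : M.ctxC Γ ⟶ M.tyC A}
    (h : M.GDer t Γ m A f) (h' : M.GDer t Γ m A f') : f = f' :=
  (h.same h' (.refl Γ)).eq

end LinearModel

end

/-! ## Substitution -/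

variable {c : Calculus}

theorem DiscCtx.exists_empty {Γ : Ctx} (h : DiscCtx c Γ) : ∃ Δ : Ctx, Δ.Empty ∧ Nonempty (Drop c Δ Γ) :=
  let ⟨Δ, hΔ, d, _⟩ := (Compat.refl Γ).exists_empty h h
  ⟨Δ, hΔ, d⟩

theorem Share.exists_interchange {Γ₁ Γ₂ Θ Γ₁₁ Γ₁₂ Γ₂₁ Γ₂₂ : Ctx} (g : Share c Γ₁ Γ₂ Θ)
    (g₁ : Share c Γ₁₁ Γ₁₂ Γ₁) (g₂ : Share c Γ₂₁ Γ₂₂ Γ₂) :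
    ∃ Δ₁ Δ₂, Nonempty (Share c Δ₁ Δ₂ Θ) ∧ Nonempty (Share c Γ₁₁ Γ₂₁ Δ₁) ∧
      Nonempty (Share c Γ₁₂ Γ₂₂ Δ₂) := by
  induction g generalizing Γ₁₁ Γ₁₂ Γ₂₁ Γ₂₂ with
  | nil => cases g₁; cases g₂; exact ⟨[], [], ⟨.nil⟩, ⟨.nil⟩, ⟨.nil⟩⟩
  | cons l g ih =>
    cases g₁ with | @cons a₁ b₁ _ _ _ _ l₁ g₁ =>
    cases g₂ with | @cons a₂ b₂ _ _ _ _ l₂ g₂ =>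
    obtain ⟨Δ₁, Δ₂, ⟨h⟩, ⟨h₁⟩, ⟨h₂⟩⟩ := ih g₁ g₂
    suffices Nonempty (OptShare c (optJoin a₁ a₂) (optJoin b₁ b₂) _) ∧
        Nonempty (OptShare c a₁ a₂ (optJoin a₁ a₂)) ∧
        Nonempty (OptShare c b₁ b₂ (optJoin b₁ b₂)) by
      obtain ⟨⟨e⟩, ⟨e₁⟩, ⟨e₂⟩⟩ := this
      exact ⟨_, _, ⟨.cons e h⟩, ⟨.cons e₁ h₁⟩, ⟨.cons e₂ h₂⟩⟩
    cases l <;> cases l₁ <;> cases l₂ <;> refine ⟨⟨?_⟩, ⟨?_⟩, ⟨?_⟩⟩ <;> constructor <;> assumption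

theorem Share.exists_assoc {Γ Γ₁ Γ₁₁ Γ₁₂ Θ : Ctx} (g : Share c Γ Γ₁ Θ) (g₁ : Share c Γ₁₁ Γ₁₂ Γ₁) :
    ∃ Δ, Nonempty (Share c Γ Γ₁₁ Δ) ∧ Nonempty (Share c Δ Γ₁₂ Θ) :=
  ⟨_, ⟨(g.swap.assocInner g₁.swap).swap⟩, ⟨(g.swap.assocOuter g₁.swap).swap⟩⟩

theorem Share.exists_unit (Γ : Ctx) : ∃ Δ : Ctx, Δ.Empty ∧ Nonempty (Share c Γ Δ Γ) := by
  induction Γ with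
  | nil => exact ⟨[], trivial, ⟨.nil⟩⟩
  | cons o Γ ih =>
    obtain ⟨Δ, hΔ, ⟨g⟩⟩ := ih
    refine ⟨none :: Δ, hΔ, ?_⟩
    cases o with
    | none => exact ⟨.cons .none g⟩
    | some A => exact ⟨.cons (.left A) g⟩

theorem Tm.upSub_var : Tm.upSub Tm.var = Tm.var := by
  funext i
  cases i <;> rfl

noncomputable section

namespace LinearModel

variable {B : Type u₁} [Category.{v₁} B] [CartesianMonoidalCategory B]
  [BraidedCategory B] [HasFiniteCoproducts B]
  {V : Type u₂} [Category.{v₂} V] [MonoidalCategory V] [SymmetricCategory V]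
  [HasFiniteCoproducts V]
  {C : Type u₃} [Category.{v₃} C] [MonoidalCategory C] [SymmetricCategory C]
  [HasFiniteCoproducts C]
  (M : LinearModel B V C) (t : M.Supports c)

theorem shareMap_disc {Γ₁ Γ₂ Θ : Ctx} (g : Share c Γ₁ Γ₂ Θ) (h₁ : DiscCtx c Γ₁) (h₂ : DiscCtx c Γ₂)
    (h : DiscCtx c Θ) : M.shareMap t g ≫ (M.discMap t Γ₁ h₁ ⊗ₘ M.discMap t Γ₂ h₂) =
      M.discMap t Θ h ≫ (λ_ (𝟙_ C)).inv := by
  rw [← M.dropMap_disc t (g.dropSnd h₂) h₁ h, ← M.shareMap_discSnd t g h₂ (g.dropSnd h₂),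
    tensorHom_def']
  simp [unitors_inv_equal]

/-- A class of interpreted derivations that can be substituted for variables. -/
structure Substitutable (Q : (Θ : Ctx) → Tm → (A : Ty) → (M.ctxC Θ ⟶ M.tyC A) → Prop) : Prop where
  gDer {Θ : Ctx} {v : Tm} {A : Ty} {f : M.ctxC Θ ⟶ M.tyC A} : Q Θ v A f → M.GDer t Θ v A f
  shift {Θ : Ctx} {v : Tm} {A : Ty} {f : M.ctxC Θ ⟶ M.tyC A} :
    Q Θ v A f → Q (none :: Θ) (v.rename Nat.succ) A f
  img {Θ : Ctx} {v : Tm} {A : Ty} {f : M.ctxC Θ ⟶ M.tyC A} :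
    Q Θ v A f → Rep.Img (M.ctxIsoC Θ) (M.tyIsoC A) f
  imgF {Θ : Ctx} {v : Tm} {A : Ty} {f : M.ctxC Θ ⟶ M.tyC A} (h : A.NonLinear) : Q Θ v A f →
    ∃ (Θ₀ : Ctx) (h₀ : Θ₀.NonLinear) (δ : Drop c Θ₀ Θ) (f₀ : M.ctxC Θ₀ ⟶ M.tyC A),
      Q Θ₀ v A f₀ ∧ f = M.dropMap t δ ≫ f₀ ∧ Rep.Img (M.ctxIsoF Θ₀ h₀) (M.tyIsoF A h) f₀
  var {Θ : Ctx} {A : Ty} (s : Single 0 A Θ) : Q Θ (.var 0) A (M.singleMap t s)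

/-- The interpretation of a simultaneous substitution by derivations in `Q`. -/
inductive Env (Q : (Θ : Ctx) → Tm → (A : Ty) → (M.ctxC Θ ⟶ M.tyC A) → Prop) :
    (Θ : Ctx) → (ℕ → Tm) → (Γ : Ctx) → (M.ctxC Θ ⟶ M.ctxC Γ) → Prop
  | nil {Θ : Ctx} {σ : ℕ → Tm} (h : DiscCtx c Θ) : Env Q Θ σ [] (M.discMap t Θ h)
  | none {Θ Γ : Ctx} {σ : ℕ → Tm} {s : M.ctxC Θ ⟶ M.ctxC Γ} (e : Env Q Θ (fun i => σ (i + 1)) Γ s) :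
      Env Q Θ σ (none :: Γ) s
  | some {Θ₁ Θ₂ Θ Γ : Ctx} {σ : ℕ → Tm} {A : Ty} {s : M.ctxC Θ₁ ⟶ M.ctxC Γ}
      {f : M.ctxC Θ₂ ⟶ M.tyC A} (g : Share c Θ₁ Θ₂ Θ) (e : Env Q Θ₁ (fun i => σ (i + 1)) Γ s)
      (q : Q Θ₂ (σ 0) A f) : Env Q Θ σ (some A :: Γ) (M.shareMap t g ≫ (s ⊗ₘ f))

/-- The interpretation of the substitution for a single entry of a context. -/
inductive OptEnv (Q : (Θ : Ctx) → Tm → (A : Ty) → (M.ctxC Θ ⟶ M.tyC A) → Prop) (Θ : Ctx) (v : Tm) :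
    (o : Option Ty) → (M.ctxC Θ ⟶ M.optC o) → Prop
  | none (h : DiscCtx c Θ) : OptEnv Q Θ v none (M.discMap t Θ h)
  | some {A : Ty} {f : M.ctxC Θ ⟶ M.tyC A} (q : Q Θ v A f) : OptEnv Q Θ v (some A) f

variable {M t} {Q : (Θ : Ctx) → Tm → (A : Ty) → (M.ctxC Θ ⟶ M.tyC A) → Prop}

theorem Env.congr {Θ Γ : Ctx} {σ : ℕ → Tm} {s s' : M.ctxC Θ ⟶ M.ctxC Γ} (e : M.Env t Q Θ σ Γ s)
    (h : s = s') : M.Env t Q Θ σ Γ s' := h ▸ e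

theorem Env.weaken {Θ Θ' Γ : Ctx} {σ : ℕ → Tm} {s : M.ctxC Θ ⟶ M.ctxC Γ} (e : M.Env t Q Θ σ Γ s)
    (d : Drop c Θ Θ') : M.Env t Q Θ' σ Γ (M.dropMap t d ≫ s) := by
  induction e generalizing Θ' with
  | nil h => exact (Env.nil (d.discCtx h)).congr (M.dropMap_disc t d _ _).symm
  | none e ih => exact .none (ih d)
  | some g e q ih =>
    refine (Env.some (g.dropFirst d) e q).congr ?_
    rw [← M.dropMap_share t d g, Category.assoc]

/-- An undeclared entry contributes only a discarding map, which is absorbed by weakening the rest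
of the environment. -/
theorem Env.cons {Θ₁ Θ₂ Θ Γ : Ctx} {σ : ℕ → Tm} {o : Option Ty} {s : M.ctxC Θ₁ ⟶ M.ctxC Γ}
    {f : M.ctxC Θ₂ ⟶ M.optC o} (g : Share c Θ₁ Θ₂ Θ) (e : M.Env t Q Θ₁ (fun i => σ (i + 1)) Γ s)
    (q : M.OptEnv t Q Θ₂ (σ 0) o f) :
    M.Env t Q Θ σ (o :: Γ) (M.shareMap t g ≫ (s ⊗ₘ f) ≫ (M.consIso o Γ).inv) := by
  cases q with
  | none h =>
    refine (e.weaken (g.dropSnd h)).none.congr ?_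
    rw [← M.shareMap_discSnd t g h, tensorHom_def']
    simp [consIso]
  | some q => exact (Env.some g e q).congr (by simp [consIso])

section Substitutable

variable (K : M.Substitutable t Q)
include K

/-- In `λ_l` a discardable type is non-linear, so the term is an `F`-image and terminal maps are
natural. In `λ_a` it is an `L`-image, and any two maps to the terminal unit agree. -/
theorem Substitutable.disc {Θ : Ctx} {v : Tm} {A : Ty} {f : M.ctxC Θ ⟶ M.tyC A} (q : Q Θ v A f)
    (h : Disc c A) : ∃ h' : DiscCtx c Θ, f ≫ M.discTy t A h = M.discMap t Θ h' := by
  cases c with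
  | linear =>
    obtain ⟨Θ₀, h₀, δ, f₀, -, rfl, i⟩ := K.imgF h q
    refine ⟨δ.discCtx (h₀.discCtx _), ?_⟩
    rw [← M.dropMap_disc t δ (h₀.discCtx _), ← M.discard_eq t Θ₀ h₀, Category.assoc]
    exact congrArg _ i.discard
  | affine =>
    refine ⟨discCtx_affine Θ, ?_⟩
    obtain ⟨k, hk⟩ := (K.img q).comp (M.img_discTy t A h)
    obtain ⟨k', hk'⟩ := M.img_discMap t Θ (discCtx_affine Θ)
    rw [hk, hk', IsTerminal.hom_ext t k k']

theorem Env.img {Θ Γ : Ctx} {σ : ℕ → Tm} {s : M.ctxC Θ ⟶ M.ctxC Γ} (e : M.Env t Q Θ σ Γ s) :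
    Rep.Img (M.ctxIsoC Θ) (M.ctxIsoC Γ) s := by
  induction e with
  | nil h => exact M.img_discMap t _ h
  | none e ih => exact ih
  | some g e q ih => exact (M.img_shareMap t g).comp (ih.tensor (K.img q))

theorem Env.imgF {Θ Γ : Ctx} {σ : ℕ → Tm} {s : M.ctxC Θ ⟶ M.ctxC Γ} (e : M.Env t Q Θ σ Γ s)
    (h : Γ.NonLinear) :
    ∃ (Θ₀ : Ctx) (h₀ : Θ₀.NonLinear) (δ : Drop c Θ₀ Θ) (s₀ : M.ctxC Θ₀ ⟶ M.ctxC Γ),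
      M.Env t Q Θ₀ σ Γ s₀ ∧ s = M.dropMap t δ ≫ s₀ ∧
        Rep.Img (M.ctxIsoF Θ₀ h₀) (M.ctxIsoF Γ h) s₀ := by
  induction e with
  | nil h' =>
    obtain ⟨E, hE, ⟨δ⟩⟩ := h'.exists_empty
    refine ⟨E, hE.nonLinear, δ, M.discMap t E (hE.nonLinear.discCtx c), .nil _,
      (M.dropMap_disc t δ _ _).symm, ?_⟩
    rw [ctxIsoF_nil]
    exact M.imgF_discMap t E _ _
  | none e ih =>
    obtain ⟨Θ₀, h₀, δ, s₀, e₀, rfl, i⟩ := ih h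
    exact ⟨Θ₀, h₀, δ, s₀, .none e₀, rfl, i⟩
  | some g e q ih =>
    obtain ⟨Θ₁, h₁, δ₁, s₁, e₁, rfl, i₁⟩ := ih h.1
    obtain ⟨Θ₂, h₂, δ₂, f₂, q₂, rfl, i₂⟩ := K.imgF h.2 q
    -- In `λ_a` the context `Θ` may contain variables of linear type, so the factorization goes
    -- through the union of `Θ₁` and `Θ₂`, which is non-linear.
    have k := g.dropBoth δ₁ δ₂
    refine ⟨_, k.join_nonLinear h₁ h₂, k.dropJoin, M.shareMap t k.join ≫ (s₁ ⊗ₘ f₂),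
      .some k.join e₁ q₂, ?_, ?_⟩
    · rw [reassoc_of% M.dropMap_share t k.dropJoin k.join k, ← tensorHom_comp_tensorHom,
        reassoc_of% M.shareMap_dropBoth t g δ₁ δ₂ k]
    · rw [ctxIsoF_cons]
      exact (M.imgF_shareMap t k.join h₁ h₂ _).comp (i₁.tensor i₂)

theorem Env.disc {Θ Γ : Ctx} {σ : ℕ → Tm} {s : M.ctxC Θ ⟶ M.ctxC Γ} (e : M.Env t Q Θ σ Γ s)
    (h : DiscCtx c Γ) : ∃ h' : DiscCtx c Θ, s ≫ M.discMap t Γ h = M.discMap t Θ h' := by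
  cases c with
  | linear =>
    have h' := nonLinear_of_discCtx h
    obtain ⟨Θ₀, h₀, δ, s₀, -, rfl, i⟩ := e.imgF K h'
    refine ⟨δ.discCtx (h₀.discCtx _), ?_⟩
    rw [← M.dropMap_disc t δ (h₀.discCtx _), ← M.discard_eq t Θ₀ h₀, Category.assoc,
      ← M.discard_eq t Γ h']
    exact congrArg _ i.discard
  | affine => exact ⟨discCtx_affine Θ, M.comp_discMap_affine t (e.img K) _ _⟩

/-- A substitution restricts to subcontexts. -/
theorem Env.drop {Θ Γ Γ' : Ctx} {σ : ℕ → Tm} {s : M.ctxC Θ ⟶ M.ctxC Γ} (e : M.Env t Q Θ σ Γ s)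
    (d : Drop c Γ' Γ) : M.Env t Q Θ σ Γ' (s ≫ M.dropMap t d) := by
  induction e generalizing Γ' with
  | nil h =>
    cases d
    exact (Env.nil h).congr (by simp [dropMap])
  | none e ih =>
    cases d with | cons l d =>
    cases l
    rw [dropMap_keep_none]
    exact .none (ih d)
  | some g e q ih =>
    cases d with | cons l d =>
    cases l with
    | keep =>
      rw [dropMap_keep_some, Category.assoc, ← tensorHom_id, tensorHom_comp_tensorHom,
        Category.comp_id]
      exact .some g (ih d) q
    | drop A h =>
      obtain ⟨h', eq⟩ := K.disc q h
      refine ((ih d).weaken (g.dropSnd h')).none.congr ?_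
      rw [dropMap_drop, Category.assoc, tensorHom_comp_tensorHom_assoc, eq,
        ← M.shareMap_discSnd t g h', tensorHom_def']
      simp

/-- Substitution for a variable. -/
theorem Env.lookup {Θ Γ S : Ctx} {σ : ℕ → Tm} {s : M.ctxC Θ ⟶ M.ctxC Γ} (e : M.Env t Q Θ σ Γ s)
    {i : ℕ} {A : Ty} (j : Single i A S) (d : Drop c S Γ) :
    M.GDer t Θ (σ i) A (s ≫ M.dropMap t d ≫ M.singleMap t j) := by
  induction e generalizing S i with
  | nil h => cases d; cases j
  | none e ih =>
    cases d with | cons l d =>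
    cases l
    cases j with | succ j =>
    rw [dropMap_keep_none]
    exact ih j d
  | some g e q ih =>
    cases d with | cons l d =>
    cases l with
    | keep =>
      cases j with | zero _ hE =>
      -- Looking up this variable discards all others, so the rest of the environment followed by
      -- discarding turns into discarding of its own context.
      obtain ⟨h', eq⟩ := e.disc K (d.discCtx (hE.nonLinear.discCtx c))
      refine ((K.gDer q).weaken (g.swap.dropSnd h')).congr ?_
      rw [← M.shareMap_discFst t g h', dropMap_keep_some, singleMap, ← comp_whiskerRight_assoc,
        M.dropMap_disc t d _ (d.discCtx (hE.nonLinear.discCtx c)), ← eq,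
        tensorHom_def']
      simp only [Category.assoc, comp_whiskerRight]
      rw [← leftUnitor_naturality, ← whisker_exchange_assoc, ← whisker_exchange_assoc]
    | drop A h =>
      cases j with | succ j =>
      obtain ⟨h', eq⟩ := K.disc q h
      refine ((ih j d).weaken (g.dropSnd h')).congr ?_
      rw [dropMap_drop, ← M.shareMap_discSnd t g h', Category.assoc, Category.assoc, Category.assoc,
        Category.assoc, tensorHom_comp_tensorHom_assoc, eq, tensorHom_def']
      simp
      rfl

/-- A side that does not receive the entry is given an empty context. The decisive case is `both`:
the type is non-linear, so the term is an `F`-image after discarding and commutes with copying. -/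
theorem Substitutable.share {Θ : Ctx} {v : Tm} {A : Ty} {f : M.ctxC Θ ⟶ M.tyC A}
    (q : Q Θ v A f) {o₁ o₂ : Option Ty} (l : OptShare c o₁ o₂ (Option.some A)) :
    ∃ (Θ₁ Θ₂ : Ctx) (g : Share c Θ₁ Θ₂ Θ) (f₁ : M.ctxC Θ₁ ⟶ M.optC o₁)
      (f₂ : M.ctxC Θ₂ ⟶ M.optC o₂), M.OptEnv t Q Θ₁ v o₁ f₁ ∧ M.OptEnv t Q Θ₂ v o₂ f₂ ∧
        f ≫ M.optShareMap t l = M.shareMap t g ≫ (f₁ ⊗ₘ f₂) := by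
  cases l with
  | drop A h =>
    obtain ⟨h', eq⟩ := K.disc q h
    obtain ⟨E, hE, ⟨δ⟩⟩ := h'.exists_empty
    refine ⟨E, E, .dropFirst δ (.diag hE.nonLinear), _, _, .none (hE.nonLinear.discCtx c),
      .none (hE.nonLinear.discCtx c), ?_⟩
    rw [M.shareMap_disc t _ _ _ h', optShareMap, reassoc_of% eq]
  | left A =>
    obtain ⟨E, hE, ⟨g⟩⟩ := Share.exists_unit (c := c) Θ
    have h := M.shareMap_discSnd t g (hE.nonLinear.discCtx c) (.refl _)
    refine ⟨Θ, E, g, _, _, .some q, .none (hE.nonLinear.discCtx c), ?_⟩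
    rw [dropMap_refl, ← Category.assoc, ← Iso.eq_comp_inv, Category.id_comp] at h
    rw [tensorHom_def', reassoc_of% h]
    simp [optShareMap]
  | right A =>
    obtain ⟨E, hE, ⟨g⟩⟩ := Share.exists_unit (c := c) Θ
    have h := M.shareMap_discFst t g.swap (hE.nonLinear.discCtx c) (.refl _)
    refine ⟨E, Θ, g.swap, _, _, .none (hE.nonLinear.discCtx c), .some q, ?_⟩
    rw [dropMap_refl, ← Category.assoc, ← Iso.eq_comp_inv, Category.id_comp] at h
    rw [MonoidalCategory.tensorHom_def, reassoc_of% h]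
    simp [optShareMap]
  | both A h =>
    obtain ⟨Θ₀, h₀, δ, f₀, q₀, rfl, i⟩ := K.imgF h q
    refine ⟨Θ₀, Θ₀, .dropFirst δ (.diag h₀), _, _, .some q₀, .some q₀, ?_⟩
    rw [← M.dropMap_share t δ (.diag h₀), ← M.copy_eq t h₀, Category.assoc, Category.assoc]
    exact congrArg _ i.copy

/-- Distribution of the entries of a substitution over two contexts. -/
theorem Env.share {Θ Γ Γ₁ Γ₂ : Ctx} {σ : ℕ → Tm} {s : M.ctxC Θ ⟶ M.ctxC Γ}
    (e : M.Env t Q Θ σ Γ s) (g : Share c Γ₁ Γ₂ Γ) :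
    ∃ (Θ₁ Θ₂ : Ctx) (g' : Share c Θ₁ Θ₂ Θ) (s₁ : M.ctxC Θ₁ ⟶ M.ctxC Γ₁)
      (s₂ : M.ctxC Θ₂ ⟶ M.ctxC Γ₂), M.Env t Q Θ₁ σ Γ₁ s₁ ∧ M.Env t Q Θ₂ σ Γ₂ s₂ ∧
        s ≫ M.shareMap t g = M.shareMap t g' ≫ (s₁ ⊗ₘ s₂) := by
  induction e generalizing Γ₁ Γ₂ with
  | nil h =>
    cases g
    obtain ⟨E, hE, ⟨δ⟩⟩ := h.exists_empty
    refine ⟨E, E, .dropFirst δ (.diag hE.nonLinear), _, _, .nil (hE.nonLinear.discCtx c),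
      .nil (hE.nonLinear.discCtx c), ?_⟩
    exact (M.shareMap_disc t _ _ _ h).symm
  | none e ih =>
    cases g with | cons l g =>
    cases l
    obtain ⟨Θ₁, Θ₂, g', s₁, s₂, e₁, e₂, eq⟩ := ih g
    exact ⟨Θ₁, Θ₂, g', s₁, s₂, .none e₁, .none e₂, by rw [shareMap_none, eq]⟩
  | some h e q ih =>
    cases g with | @cons o₁ o₂ _ Γ₁ Γ₂ _ l g =>
    obtain ⟨Θ₁, Θ₂, g', s₁, s₂, e₁, e₂, eq⟩ := ih g
    obtain ⟨Θ₁', Θ₂', g'', f₁, f₂, q₁, q₂, eq'⟩ := K.share q l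
    obtain ⟨Δ₁, Δ₂, ⟨k⟩, ⟨k₁⟩, ⟨k₂⟩⟩ := h.exists_interchange g' g''
    -- The tail and the first entry have been distributed separately; interchange regroups the four
    -- pieces by target.
    have ex := M.shareMap_interchange t h g' g'' k k₁ k₂
    refine ⟨Δ₁, Δ₂, k, _, _, .cons k₁ e₁ q₁, .cons k₂ e₂ q₂, ?_⟩
    rw [← tensorHom_comp_tensorHom, ← reassoc_of% ex, ← tensorHom_comp_tensorHom,
      ← tensorμ_natural_assoc, tensorHom_comp_tensorHom_assoc, ← eq, ← eq', shareMap, consIso,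
      Iso.refl_hom, Category.id_comp, ← tensorHom_comp_tensorHom]
    simp only [Category.assoc]

/-- Substitutions under a binder, in the extended context. -/
theorem Env.shift {Θ Γ : Ctx} {σ : ℕ → Tm} {s : M.ctxC Θ ⟶ M.ctxC Γ} (e : M.Env t Q Θ σ Γ s) :
    M.Env t Q (Option.none :: Θ) (fun i => (σ i).rename Nat.succ) Γ s := by
  induction e with
  | nil h => exact Env.nil (Θ := Option.none :: _) h
  | none e ih => exact .none ih
  | some g e q ih =>
    refine (Env.some (Share.cons .none g) ih (K.shift q)).congr ?_
    rw [shareMap_none]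

/-- The new variable is substituted for itself in a context of its own, and a counit law removes the
trivial remainder of that context. -/
theorem Env.up {Θ Γ : Ctx} {σ : ℕ → Tm} {s : M.ctxC Θ ⟶ M.ctxC Γ} (e : M.Env t Q Θ σ Γ s) (A : Ty) :
    M.Env t Q (Option.some A :: Θ) (Tm.upSub σ) (Option.some A :: Γ) (s ▷ M.tyC A) := by
  obtain ⟨E, hE, ⟨g⟩⟩ := Share.exists_unit (c := c) Θ
  have h := M.shareMap_discSnd t g (hE.nonLinear.discCtx c) (.refl _)
  refine (Env.some (σ := Tm.upSub σ) (Share.cons (.right A) g) (e.shift K)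
    (K.var (.zero A hE))).congr ?_
  rw [shareMap_right, singleMap]
  rw [dropMap_refl] at h
  have h' := congrArg (· ▷ M.tyC A) h
  simp only [comp_whiskerRight, id_whiskerRight] at h'
  rw [tensorHom_def', Category.assoc]
  change _ ≫ _ ≫ M.ctxC Θ ◁ _ ≫ _ = _
  rw [whiskerLeft_comp, Category.assoc, ← associator_naturality_middle_assoc, triangle_assoc, reassoc_of% h']

theorem Env.id (Γ : Ctx) : M.Env t Q Γ Tm.var Γ (𝟙 _) := by
  induction Γ with
  | nil => exact Env.nil (Θ := []) trivial
  | cons o Γ ih =>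
    cases o with
    | none => exact .none (ih.shift K)
    | some A =>
      have := ih.up K A
      rw [Tm.upSub_var, id_whiskerRight] at this
      exact this

/-- Binary rules distribute the environment over the premises, abstraction uses that it is an
`L`-image, and `lift` and `rec` use that on a non-linear context it factors through discarding and
an `F`-image. -/
theorem GDer.subst {Θ Γ : Ctx} {σ : ℕ → Tm} {s : M.ctxC Θ ⟶ M.ctxC Γ} {m : Tm} {A : Ty}
    {f : M.ctxC Γ ⟶ M.tyC A} (h : M.GDer t Γ m A f) (e : M.Env t Q Θ σ Γ s) :
    M.GDer t Θ (m.subst σ) A (s ≫ f) := by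
  induction h generalizing Θ σ with
  | var j d => exact e.lookup K j d
  | star h =>
    obtain ⟨h', eq⟩ := e.disc K h
    exact (GDer.star h').congr eq.symm
  | lift h d hm ih =>
    obtain ⟨Θ₀, h₀, δ, s₀, e₀, eq, i⟩ := (e.drop K d).imgF K h
    refine (GDer.lift h₀ δ (ih e₀)).congr ?_
    rw [← M.comp_liftMap h₀ h i, reassoc_of% eq]
  | recur h d hm ih =>
    obtain ⟨Θ₀, h₀, δ, s₀, e₀, eq, i⟩ := (e.drop K d).imgF K h
    refine (GDer.recur h₀ δ (ih (e₀.up K _))).congr ?_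
    rw [← M.comp_recMap h₀ h i, reassoc_of% eq]
  | force hm ih => exact (GDer.force (ih e)).congr (Category.assoc ..)
  | left hm ih => exact (GDer.left (ih e)).congr (Category.assoc ..)
  | right hm ih => exact (GDer.right (ih e)).congr (Category.assoc ..)
  | lam hm ih =>
    refine (GDer.lam (ih (e.up K _))).congr ?_
    rw [M.comp_curry (e.img K)]
  | seq g hm hn ihm ihn =>
    obtain ⟨Θ₁, Θ₂, g', s₁, s₂, e₁, e₂, eq⟩ := e.share K g
    refine (GDer.seq g' (ihm e₁) (ihn e₂)).congr ?_
    rw [reassoc_of% eq, comp_seqMap]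
  | case g hm hn hp ihm ihn ihp =>
    obtain ⟨Θ₁, Θ₂, g', s₁, s₂, e₁, e₂, eq⟩ := e.share K g
    refine (GDer.case g' (ihm e₁) (ihn (e₂.up K _)) (ihp (e₂.up K _))).congr ?_
    rw [reassoc_of% eq, comp_caseMap]
  | pair g hm hn ihm ihn =>
    obtain ⟨Θ₁, Θ₂, g', s₁, s₂, e₁, e₂, eq⟩ := e.share K g
    refine (GDer.pair g' (ihm e₁) (ihn e₂)).congr ?_
    rw [reassoc_of% eq, tensorHom_comp_tensorHom]
  | letPair g hm hn ihm ihn =>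
    obtain ⟨Θ₁, Θ₂, g', s₁, s₂, e₁, e₂, eq⟩ := e.share K g
    refine (GDer.letPair g' (ihm e₁) (ihn ((e₂.up K _).up K _))).congr ?_
    rw [reassoc_of% eq, comp_letPairMap]
  | app g hm hn ihm ihn =>
    obtain ⟨Θ₁, Θ₂, g', s₁, s₂, e₁, e₂, eq⟩ := e.share K g
    refine (GDer.app g' (ihm e₁) (ihn e₂)).congr ?_
    rw [reassoc_of% eq, comp_appMap]

end Substitutable

end LinearModel

end

/-! ### Renaming as substitution, and substitution of values -/

variable {c : Calculus}

theorem Tm.upSub_var_comp (ρ : ℕ → ℕ) :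
    Tm.upSub (fun i => .var (ρ i)) = fun i => .var (Tm.upRen ρ i) := by
  funext i
  cases i <;> rfl

theorem Tm.rename_eq_subst (m : Tm) (ρ : ℕ → ℕ) : m.rename ρ = m.subst fun i => .var (ρ i) := by
  induction m generalizing ρ <;> simp_all [Tm.rename, Tm.subst, Tm.upSub_var_comp]

theorem IsValue.rename {v : Tm} (h : IsValue v) (ρ : ℕ → ℕ) : IsValue (v.rename ρ) := by
  induction h with
  | var i => exact .var _
  | star => exact .star
  | left _ ih => exact .left ih
  | right _ ih => exact .right ih
  | pair _ _ ih ih' => exact .pair ih ih'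
  | lam => exact .lam _ _
  | lift => exact .lift _

noncomputable section

namespace LinearModel

variable {B : Type u₁} [Category.{v₁} B] [CartesianMonoidalCategory B]
  [BraidedCategory B] [HasFiniteCoproducts B]
  {V : Type u₂} [Category.{v₂} V] [MonoidalCategory V] [SymmetricCategory V]
  [HasFiniteCoproducts V]
  {C : Type u₃} [Category.{v₃} C] [MonoidalCategory C] [SymmetricCategory C]
  [HasFiniteCoproducts C]
  (M : LinearModel B V C) (t : M.Supports c)

/-! ### Renaming -/

/-- The derivations of variables in minimal contexts. -/
inductive VarDer : (Θ : Ctx) → Tm → (A : Ty) → (M.ctxC Θ ⟶ M.tyC A) → Prop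
  | mk {Θ : Ctx} {i : ℕ} {A : Ty} (s : Single i A Θ) : VarDer Θ (.var i) A (M.singleMap t s)

/-- Substitution is used twice. Variables come first because their minimal contexts make shifting
immediate; the resulting renaming lemma `GDer.shift` supplies the shift condition for values. -/
theorem substitutable_varDer : M.Substitutable t (M.VarDer t) where
  gDer := by
    rintro _ _ _ _ ⟨s⟩
    refine (GDer.var s (.refl _)).congr ?_
    rw [dropMap_refl, Category.id_comp]
  shift := by
    rintro _ _ _ _ ⟨s⟩
    exact .mk (.succ s)
  img := by
    rintro _ _ _ _ ⟨s⟩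
    exact M.img_singleMap t s
  imgF := by
    rintro _ _ _ _ h ⟨s⟩
    exact ⟨_, s.nonLinear h, .refl _, _, .mk s, by rw [dropMap_refl, Category.id_comp],
      M.imgF_singleMap t s _ _⟩
  var s := .mk s

variable {M t}

theorem GDer.shift {Θ : Ctx} {m : Tm} {A : Ty} {f : M.ctxC Θ ⟶ M.tyC A} (h : M.GDer t Θ m A f) :
    M.GDer t (none :: Θ) (m.rename Nat.succ) A f := by
  rw [Tm.rename_eq_subst]
  have K := M.substitutable_varDer t
  exact (h.subst K ((Env.id K Θ).shift K)).congr (Category.id_comp f)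

/-! ### Values -/

theorem GDer.img_of_isValue {Θ : Ctx} {v : Tm} {A : Ty} {f : M.ctxC Θ ⟶ M.tyC A}
    (h : M.GDer t Θ v A f) (hv : IsValue v) : Rep.Img (M.ctxIsoC Θ) (M.tyIsoC A) f := by
  induction h with
  | var s d => exact (M.img_dropMap t d).comp (M.img_singleMap t s)
  | star h => exact M.img_discMap t _ h
  | lift h d hm => exact (M.img_dropMap t d).comp (M.img_liftMap h _)
  | left hm ih => cases hv with | left hv => exact (ih hv).comp (M.img_inl _ _)
  | right hm ih => cases hv with | right hv => exact (ih hv).comp (M.img_inr _ _)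
  | lam hm => exact M.img_curry _
  | pair g hm hn ihm ihn =>
    cases hv with | pair hv hw =>
    exact (M.img_shareMap t g).comp ((ihm hv).tensor (ihn hw))
  | recur | force | seq | case | letPair | app => cases hv

/-- Abstractions are excluded by their type and every `lift` is an `F`-image. A variable, a `lift`
or a unit value first discards the variables it does not need, and injections and pairs inherit the
factorization. -/
theorem GDer.imgF_of_isValue {Θ : Ctx} {v : Tm} {A : Ty} {f : M.ctxC Θ ⟶ M.tyC A}
    (h : M.GDer t Θ v A f) (hv : IsValue v) (hA : A.NonLinear) :
    ∃ (Θ₀ : Ctx) (h₀ : Θ₀.NonLinear) (δ : Drop c Θ₀ Θ) (f₀ : M.ctxC Θ₀ ⟶ M.tyC A),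
      M.GDer t Θ₀ v A f₀ ∧ f = M.dropMap t δ ≫ f₀ ∧
        Rep.Img (M.ctxIsoF Θ₀ h₀) (M.tyIsoF A hA) f₀ := by
  induction h with
  | var s d =>
    exact ⟨_, s.nonLinear hA, d, _, (M.substitutable_varDer t).gDer (.mk s), rfl,
      M.imgF_singleMap t s _ _⟩
  | star h =>
    obtain ⟨E, hE, ⟨δ⟩⟩ := h.exists_empty
    refine ⟨E, hE.nonLinear, δ, _, .star (hE.nonLinear.discCtx c),
      (M.dropMap_disc t δ _ _).symm, ?_⟩
    rw [tyIsoF_unit]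
    exact M.imgF_discMap t E _ _
  | lift h d hm =>
    refine ⟨_, h, d, _, (GDer.lift h (.refl _) hm).congr ?_, rfl, M.imgF_liftMap h _ _⟩
    rw [dropMap_refl, Category.id_comp]
  | left hm ih =>
    cases hv with | left hv =>
    obtain ⟨Θ₀, h₀, δ, f₀, hf, rfl, i⟩ := ih hv hA.1
    exact ⟨Θ₀, h₀, δ, _, .left hf, Category.assoc .., i.comp (M.imgF_inl hA)⟩
  | right hm ih =>
    cases hv with | right hv =>
    obtain ⟨Θ₀, h₀, δ, f₀, hf, rfl, i⟩ := ih hv hA.2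
    exact ⟨Θ₀, h₀, δ, _, .right hf, Category.assoc .., i.comp (M.imgF_inr hA)⟩
  | lam hm => exact hA.elim
  | pair g hm hn ihm ihn =>
    cases hv with | pair hv hw =>
    obtain ⟨Θ₁, h₁, δ₁, f₁, hf₁, rfl, i₁⟩ := ihm hv hA.1
    obtain ⟨Θ₂, h₂, δ₂, f₂, hf₂, rfl, i₂⟩ := ihn hw hA.2
    have k := g.dropBoth δ₁ δ₂
    refine ⟨_, k.join_nonLinear h₁ h₂, k.dropJoin, M.shareMap t k.join ≫ (f₁ ⊗ₘ f₂),
      .pair k.join hf₁ hf₂, ?_, ?_⟩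
    · rw [reassoc_of% M.dropMap_share t k.dropJoin k.join k, ← tensorHom_comp_tensorHom,
        reassoc_of% M.shareMap_dropBoth t g δ₁ δ₂ k]
    · rw [tyIsoF_tensor]
      exact (M.imgF_shareMap t k.join h₁ h₂ _).comp (i₁.tensor i₂)
  | recur | force | seq | case | letPair | app => cases hv

variable (M t) in
/-- The derivations of values. -/
def ValueDer (Θ : Ctx) (v : Tm) (A : Ty) (f : M.ctxC Θ ⟶ M.tyC A) : Prop :=
  IsValue v ∧ M.GDer t Θ v A f

theorem substitutable_valueDer : M.Substitutable t (M.ValueDer t) where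
  gDer h := h.2
  shift h := ⟨h.1.rename _, h.2.shift⟩
  img h := h.2.img_of_isValue h.1
  imgF hA h := by
    obtain ⟨Θ₀, h₀, δ, f₀, hf, e, i⟩ := h.2.imgF_of_isValue h.1 hA
    exact ⟨Θ₀, h₀, δ, f₀, ⟨h.1, hf⟩, e, i⟩
  var s := ⟨.var 0, (M.substitutable_varDer t).gDer (.mk s)⟩

theorem GDer.subst1 {Γ Γ' Θ : Ctx} {m v : Tm} {A D : Ty} {f : M.ctxC (some A :: Γ) ⟶ M.tyC D}
    {k : M.ctxC Γ' ⟶ M.tyC A} (h : M.GDer t (some A :: Γ) m D f) (hv : IsValue v)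
    (h' : M.GDer t Γ' v A k) (g : Share c Γ Γ' Θ) :
    M.GDer t Θ (m.subst1 v) D (M.shareMap t g ≫ M.ctxC Γ ◁ k ≫ f) := by
  have K := substitutable_valueDer (M := M) (t := t)
  refine (h.subst K (Env.some (σ := Tm.scons v .var) g (Env.id K Γ) ⟨hv, h'⟩)).congr ?_
  rw [id_tensorHom, Category.assoc]

theorem GDer.subst2 {Γ Γ' Γ₁ Γ₂ Θ : Ctx} {m v w : Tm} {A D E : Ty}
    {f : M.ctxC (some D :: some A :: Γ) ⟶ M.tyC E}
    {k : M.ctxC Γ₁ ⟶ M.tyC A} {l : M.ctxC Γ₂ ⟶ M.tyC D}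
    (h : M.GDer t (some D :: some A :: Γ) m E f) (hv : IsValue v) (hw : IsValue w)
    (h₁ : M.GDer t Γ₁ v A k) (h₂ : M.GDer t Γ₂ w D l) (g : Share c Γ Γ' Θ)
    (g' : Share c Γ₁ Γ₂ Γ') :
    M.GDer t Θ (m.subst2 v w) E
      (M.shareMap t g ≫ M.ctxC Γ ◁ (M.shareMap t g' ≫ (k ⊗ₘ l)) ≫ (α_ _ _ _).inv ≫ f) := by
  have K := substitutable_valueDer (M := M) (t := t)
  -- Environments are nested to the left, so the contexts are regrouped to add `v` to `Γ` before
  -- `w`.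
  obtain ⟨Δ, ⟨p⟩, ⟨q⟩⟩ := g.exists_assoc g'
  have e := M.shareMap_assoc t q p g g'
  have e' : M.ctxC Γ ◁ (k ⊗ₘ l) ≫ (α_ _ _ _).inv = (α_ _ _ _).inv ≫ (M.ctxC Γ ◁ k ⊗ₘ l) := by
    rw [← id_tensorHom, ← id_tensorHom, associator_inv_naturality]
  refine (h.subst K (Env.some (σ := Tm.scons w (Tm.scons v .var)) q
    (Env.some p (Env.id K Γ) ⟨hv, h₁⟩) ⟨hw, h₂⟩)).congr ?_
  rw [whiskerLeft_comp, Category.assoc, Category.assoc, ← reassoc_of% e, reassoc_of% e', Iso.hom_inv_id_assoc,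
    id_tensorHom, ← whiskerRight_comp_tensorHom]
  simp only [Category.assoc]

/-! ### Preservation -/

/-- Evaluation preserves types and interpretations. -/
theorem GDer.eval {Γ : Ctx} {m v : Tm} {A : Ty} {f : M.ctxC Γ ⟶ M.tyC A} (h : M.GDer t Γ m A f)
    (r : Eval m v) : M.GDer t Γ v A f := by
  induction r generalizing Γ A with
  | var | star | lam | lift => exact h
  | seq _ _ ihm ihn =>
    cases h with | seq g hm hn =>
    -- The first premise, now a derivation of `*`, discards its whole context; a counit law turns
    -- the distribution into a weakening of the second premise.
    cases ihm hm with | star hd =>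
    refine ((ihn hn).weaken (g.swap.dropSnd hd)).congr ?_
    rw [← M.shareMap_discFst t g hd, seqMap, tensorHom_def']
    simp only [Category.assoc]
    rw [← leftUnitor_naturality, ← whisker_exchange_assoc]
  | left _ ih => cases h with | left hm => exact .left (ih hm)
  | right _ ih => cases h with | right hm => exact .right (ih hm)
  | caseLeft r _ ihm ihn =>
    cases h with | case g hm hn hp =>
    have hv := r.isValue
    cases hv with | left hv =>
    cases ihm hm with | left hw =>
    refine ihn ((hn.subst1 hv hw g.swap).congr ?_)
    -- Distributivity carries the injected value to the left injection, so copairing selects the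
    -- first branch.
    rw [caseMap, whiskerLeft_comp, Category.assoc, reassoc_of% M.inl_distrib,
      reassoc_of% M.shareMap_swap t g g.swap]
    congr 2
    exact (coprod.inl_desc _ _).symm
  | caseRight r _ ihm ihn =>
    cases h with | case g hm hn hp =>
    have hv := r.isValue
    cases hv with | right hv =>
    cases ihm hm with | right hw =>
    refine ihn ((hp.subst1 hv hw g.swap).congr ?_)
    rw [caseMap, whiskerLeft_comp, Category.assoc, reassoc_of% M.inr_distrib,
      reassoc_of% M.shareMap_swap t g g.swap]
    congr 2
    exact (coprod.inr_desc _ _).symm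
  | pair _ _ ihm ihn => cases h with | pair g hm hn => exact .pair g (ihm hm) (ihn hn)
  | letPair r _ ihm ihn =>
    cases h with | letPair g hm hn =>
    have hv := r.isValue
    cases hv with | pair hv hw =>
    cases ihm hm with | pair g' h₁ h₂ =>
    refine ihn ((hn.subst2 hv hw h₁ h₂ g.swap g').congr ?_)
    rw [letPairMap, BraidedCategory.braiding_naturality_left_assoc,
      reassoc_of% M.shareMap_swap t g g.swap]
  | app r r' _ ihm ihn ihb =>
    cases h with | app g hm hn =>
    cases ihm hm with | lam hb =>
    refine ihb ((hb.subst1 r'.isValue (ihn hn) g).congr ?_)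
    rw [appMap, curry_eval]
  | force _ _ ihm ihn =>
    cases h with | force hm =>
    cases ihm hm with | lift hΦ d hb =>
    refine ihn ((hb.weaken d).congr ?_)
    rw [Category.assoc, liftMap_counit]
  | recur _ ih =>
    cases h with | recur hΦ d hm =>
    -- The substituted value `lift (rec z. m)` is derived over the same `Φ` as the body, so sharing
    -- all of `Φ` gives exactly the copying in `recMap_unfold`. The discarding `d` is postponed by
    -- weakening.
    have hr := GDer.recur hΦ (.refl _) hm
    have hl := GDer.lift hΦ (.refl _) hr
    refine ih (((hm.subst1 (.lift _) hl (.diag hΦ)).weaken d).congr ?_)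
    rw [dropMap_refl, Category.id_comp, Category.id_comp, ← M.copy_eq t hΦ, ← recMap_unfold]

/-- The soundness theorem, for both calculi. -/
theorem interp_eq_of_eval {Γ : Ctx} {m v : Tm} {A : Ty} (r : Eval m v) (d : Der c Γ m A)
    (d' : Der c Γ v A) : M.interp t d = M.interp t d' :=
  ((gDer_interp d).eval r).unique (gDer_interp d')

/-- Typability is read off from preservation of interpretations, so some model must be supplied, but
any model supporting the calculus will do. -/
theorem nonempty_der_of_eval (t : M.Supports c) {Γ : Ctx} {m v : Tm} {A : Ty} (r : Eval m v)
    (d : Der c Γ m A) : Nonempty (Der c Γ v A) :=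
  ((gDer_interp (t := t) d).eval r).nonempty_der (.refl Γ)

end LinearModel

end

/-! ### Subject reduction

In a model on the category with one morphism, interpretations carry no information, so that
preservation of interpretations under evaluation becomes a statement about derivations alone. -/

noncomputable section

namespace OneMorphism

/-- The category with one object and one morphism. -/
def Point : Type := Discrete PUnit.{1}

instance : Category Point := inferInstanceAs (Category (Discrete PUnit.{1}))

instance : HasFiniteCoproducts Point := inferInstanceAs (HasFiniteCoproducts (Discrete PUnit.{1}))

instance (X Y : Point) : Unique (X ⟶ Y) where
  default := eqToHom (Subsingleton.elim (α := Discrete PUnit.{1}) X Y)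
  uniq _ := ULift.ext _ _ rfl

/-- Every object is terminal. -/
def isTerminal (X : Point) : IsTerminal X := IsTerminal.ofUnique X

instance : CartesianMonoidalCategory Point :=
  .ofChosenFiniteProducts ⟨asEmptyCone ⟨⟨⟩⟩, isTerminal _⟩ fun X _ =>
    ⟨BinaryFan.mk (P := X) default default, BinaryFan.IsLimit.mk _ (fun _ _ => default)
      (fun _ _ => Subsingleton.elim _ _) (fun _ _ => Subsingleton.elim _ _)
      (fun _ _ _ _ _ => Subsingleton.elim _ _)⟩

instance : BraidedCategory Point := .ofCartesianMonoidalCategory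

instance : SymmetricCategory Point where
  symmetry _ _ := Subsingleton.elim _ _

/-- The adjunction between any two endofunctors. -/
def adjunction (F G : Point ⥤ Point) : F ⊣ G :=
  Adjunction.mkOfHomEquiv { homEquiv := fun _ _ => Equiv.ofUnique _ _ }

/-- The model on `Point`. -/
def model : LinearModel Point Point Point where
  J := 𝟭 _
  K := 𝟭 _
  L := 𝟭 _
  R := 𝟭 _
  adjJK := .id
  monoidalJK := inferInstance
  adjLR := .id
  monoidalLR := inferInstance
  hom _ := 𝟭 _
  adjHom _ := adjunction _ _
  omega _ := ⟨𝟙_ Point, default⟩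
  omegaInitial _ := IsInitial.ofUniqueHom (fun _ => ⟨default, Subsingleton.elim _ _⟩)
    (fun _ _ => Endofunctor.Algebra.Hom.ext (Subsingleton.elim _ _))
  omegaFinal _ := IsTerminal.ofUniqueHom (fun _ => ⟨default, Subsingleton.elim _ _⟩)
    (fun _ _ => Endofunctor.Coalgebra.Hom.ext (Subsingleton.elim _ _))

/-- The model on `Point` interprets both calculi. -/
def supports : (c : Calculus) → model.Supports c
  | .linear => PUnit.unit
  | .affine => isTerminal (𝟙_ Point)

end OneMorphism

/-- Evaluation preserves types. -/
theorem Der.nonempty_of_eval {c : Calculus} {Γ : Ctx} {m v : Tm} {A : Ty} (d : Der c Γ m A)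
    (r : Eval m v) : Nonempty (Der c Γ v A) :=
  LinearModel.nonempty_der_of_eval (OneMorphism.supports c) r d

end

end SubLambda

theorem mainTheorem1
    {B : Type u₁} [Category.{v₁} B] [CartesianMonoidalCategory B]
    [BraidedCategory B] [HasFiniteCoproducts B]
    {V : Type u₂} [Category.{v₂} V] [MonoidalCategory V] [SymmetricCategory V]
    [HasFiniteCoproducts V]
    {C : Type u₃} [Category.{v₃} C] [MonoidalCategory C] [SymmetricCategory C]
    [HasFiniteCoproducts C] :
    (∀ (Γ : SubLambda.Ctx) (m v : SubLambda.Tm) (A : SubLambda.Ty)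
        (d : SubLambda.Der .linear Γ m A), SubLambda.Eval m v →
      Nonempty (SubLambda.Der .linear Γ v A) ∧
        ∀ (M : SubLambda.LinearModel B V C) (d' : SubLambda.Der .linear Γ v A),
          M.interpL d = M.interpL d') ∧
    (∀ (Γ : SubLambda.Ctx) (m v : SubLambda.Tm) (A : SubLambda.Ty)
        (d : SubLambda.Der .affine Γ m A), SubLambda.Eval m v →
      Nonempty (SubLambda.Der .affine Γ v A) ∧
        ∀ (M : SubLambda.AffineModel B V C) (d' : SubLambda.Der .affine Γ v A),
          M.interpA d = M.interpA d') :=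
  ⟨fun _ _ _ _ d r => ⟨d.nonempty_of_eval r, fun _ d' =>
      SubLambda.LinearModel.interp_eq_of_eval r d d'⟩,
    fun _ _ _ _ d r => ⟨d.nonempty_of_eval r, fun _ d' =>
      SubLambda.LinearModel.interp_eq_of_eval r d d'⟩⟩
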